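/- **Theorem 1.2.** Let $q,t$ be indeterminates and $\mathbb F=\mathbb C(q,t)$. Let $\Lambda=\varprojlim_n\Lambda^{(n)}$ (limit of graded rings), $\Lambda^{(n)}=\mathbb F[x_1,\dots,x_n]^{\mathfrak S_n}$, be the ring of symmetric functions over $\mathbb F$, with power sums $p_n$ and $p_\lambda=p_{\lambda_1}p_{\lambda_2}\cdots$. For $0\le k\le n$ let $$D^{(n)}_k=t^{k(k-1)/2}\sum_{I\subset\{1,\dots,n\},\,|I|=k}\ \prod_{i\in I,\,j\notin I}\frac{tx_i-x_j}{x_i-x_j}\prod_{i\in I}T_{q,x_i},$$ where $T_{q,x_i}$ replaces $x_i$ by $qx_i$, and for $n\ge r\ge1$ let $$E^{(n)}_r=\sum_{k=0}^r\frac{t^{-nr-\binom{r-k+1}{2}}}{(t^{-1};t^{-1})_{r-k}}D^{(n)}_k,\qquad (x;p)_m=\prod_{k=0}^{m-1}(1-xp^k).$$ The $r$-th Macdonald operator is the unique operator $E_r$ on $\Lambda$ whose reduction to $n$ variables is $E_r^{(n)}$ for every $n\ge r$. Let $\mathcal F$ be the Fock representation, generated from the vacuum $|0\rangle$, of the Heisenberg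 algebra with generators $a_n$ $(n\in\mathbb Z\setminus\{0\})$ and relations $[a_m,a_n]=m\frac{1-q^{|m|}}{1-t^{|m|}}\delta_{m+n,0}$, where $a_n|0\rangle=0$ for $n>0$; that is, $\mathcal F=\mathbb F[a_{-1},a_{-2},\dots]|0\rangle$. Let $\iota:\mathcal F\to\Lambda$ be the unique linear isomorphism with $\iota(a_{-\lambda_1}a_{-\lambda_2}\cdots|0\rangle)=p_\lambda$ for all partitions $\lambda$. The free field realization of $E_r$ is $\widehat E_r=\iota^{-1}E_r\iota$. Let $$\eta(z)=\eta(z)_-\eta(z)_+,\quad \eta(z)_-=\exp\Big(\sum_{n>0}\frac{1-t^{-n}}{n}a_{-n}z^n\Big),\quad \eta(z)_+=\exp\Big(-\sum_{n>0}\frac{1-t^{n}}{n}a_nz^{-n}\Big),$$ and let ${:}\eta(z_1)\cdots\eta(z_r){:}=\eta(z_1)_-\cdots\eta(z_r)_-\,\eta(z_1)_+\cdots\eta(z_r)_+$. Then for every $r\ge1$ $$\widehat E_r=\frac{t^{-r}}{r!}\int\Big(\prod_{i=1}^r\frac{dz_i}{2\pi\sqrt{-1}}\Big)\det\Big(\frac1{z_i-t^{-1}z_j}\Big)_{1\le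 i,j\le r}\ {:}\eta(z_1)\cdots\eta(z_r){:}.$$ Here $\int\prod_i\frac{dz_i}{2\pi\sqrt{-1}}$ takes the coefficient of $z_1^{-1}\cdots z_r^{-1}$. For $i\ne j$, the entry $\frac1{z_i-t^{-1}z_j}$ is expanded as $\sum_{k\ge0}t^{-k}z_j^kz_i^{-k-1}$, and the diagonal entries are $\frac{1}{(1-t^{-1})z_i}$. The determinant is expanded by the Leibniz formula; every coefficient of each product of entries in it is a series in powers of $t^{-1}$ that converges in the $t^{-1}$-adic topology of $\mathbb F$. When the right-hand side is applied to a vector of $\mathcal F$, only finitely many terms of all other sums over exponents are nonzero. -/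

import Mathlib

noncomputable section

namespace MacdonaldFock

open scoped BigOperators

/-! ### The base field `ℂ(q, t)` and its `t⁻¹`-adic topology -/

/-- The base field `ℂ(q, t) = ℂ(q)(t)`, with `q` and `t` indeterminates. -/
abbrev 𝔽 : Type := RatFunc (RatFunc ℂ)

/-- The indeterminate `q`. -/
def q : 𝔽 := RatFunc.C RatFunc.X

/-- The indeterminate `t`. -/
def t : 𝔽 := RatFunc.X

/-- The `t⁻¹`-adic topology on `ℂ(q)(t)`, that is, the topology of the place `t = ∞`
(the powers `t⁻ⁿ` tend to zero). -/
@[reducible] def tInvTopology : TopologicalSpace 𝔽 :=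
  open Classical in
  (RatFunc.inftyValued (RatFunc ℂ)).toUniformSpace.toTopologicalSpace

/-- Convergence of a family of elements of `ℂ(q, t)`, expanded in powers of `t⁻¹`. -/
def TInvSummable {ι : Type} (a : ι → 𝔽) : Prop :=
  @Summable 𝔽 ι _ tInvTopology a (SummationFilter.unconditional ι)

/-- The sum of a family of elements of `ℂ(q, t)`, expanded in powers of `t⁻¹`. -/
def tInvSum {ι : Type} (a : ι → 𝔽) : 𝔽 :=
  @tsum 𝔽 ι _ tInvTopology a (SummationFilter.unconditional ι)

/-- The `q`-Pochhammer symbol `(x; p)_n = ∏_{k < n} (1 - x pᵏ)`. -/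
def qPochhammer (x p : 𝔽) (n : ℕ) : 𝔽 := ∏ k ∈ Finset.range n, (1 - x * p ^ k)

/-! ### Symmetric functions and the Macdonald operators -/

/-- The projection `𝔽[x₁, …, xₙ₊₁] → 𝔽[x₁, …, xₙ]` that sends the last variable to zero. -/
def dropLast (n : ℕ) : MvPolynomial (Fin (n + 1)) 𝔽 →ₐ[𝔽] MvPolynomial (Fin n) 𝔽 :=
  MvPolynomial.aeval
    (Fin.snoc (α := fun _ => MvPolynomial (Fin n) 𝔽) (fun i => MvPolynomial.X i) 0)

/-- The ring of symmetric functions: the limit, in the category of graded rings, of the rings of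
symmetric polynomials in `n` variables. Its elements are the compatible sequences of symmetric
polynomials of bounded degree. -/
def symmFunc : Subalgebra 𝔽 (∀ n : ℕ, MvPolynomial (Fin n) 𝔽) where
  carrier := {f | (∀ n, (f n).IsSymmetric) ∧ (∀ n, dropLast n (f (n + 1)) = f n) ∧
    ∃ d, ∀ n, (f n).totalDegree ≤ d}
  mul_mem' := by
    rintro f g ⟨hf, hf', d, hd⟩ ⟨hg, hg', e, he⟩
    refine ⟨fun n => (hf n).mul (hg n), fun n => ?_, d + e, fun n => ?_⟩
    · rw [Pi.mul_apply, Pi.mul_apply, map_mul, hf', hg']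
    · exact (MvPolynomial.totalDegree_mul _ _).trans (add_le_add (hd n) (he n))
  add_mem' := by
    rintro f g ⟨hf, hf', d, hd⟩ ⟨hg, hg', e, he⟩
    refine ⟨fun n => (hf n).add (hg n), fun n => ?_, max d e, fun n => ?_⟩
    · rw [Pi.add_apply, Pi.add_apply, map_add, hf', hg']
    · exact (MvPolynomial.totalDegree_add _ _).trans (max_le_max (hd n) (he n))
  algebraMap_mem' := by
    intro c
    refine ⟨fun n => MvPolynomial.IsSymmetric.C c, fun n => ?_, 0, fun n => ?_⟩
    · exact (dropLast n).commutes c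
    · exact (MvPolynomial.totalDegree_C c).le

/-- The ring `Λ` of symmetric functions over `ℂ(q, t)`. -/
abbrev Sym : Type := symmFunc

/-- The `n`-variable reduction of a symmetric function. -/
def reduction (n : ℕ) (f : Sym) : MvPolynomial (Fin n) 𝔽 := f.1 n

/-- The power sum symmetric function `p_k = ∑ xᵢᵏ`, `k ≥ 1`. -/
def powerSum (k : ℕ+) : Sym :=
  ⟨fun n => MvPolynomial.psum (Fin n) 𝔽 k, fun n => MvPolynomial.psum_isSymmetric _ _ _,
    fun n => by
      simp [dropLast, MvPolynomial.psum, Fin.sum_univ_castSucc, k.ne_zero],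
    k, fun n => by
      refine MvPolynomial.totalDegree_finsetSum_le fun i _ => ?_
      exact (MvPolynomial.totalDegree_X_pow i (k : ℕ)).le⟩

/-- The product `p_{λ₁} p_{λ₂} ⋯`. -/
def powerSumProd (l : List ℕ+) : Sym := (l.map powerSum).prod

/-- The field of rational functions in `x₁, …, xₙ` over `ℂ(q, t)`. -/
abbrev RatField (n : ℕ) : Type := FractionRing (MvPolynomial (Fin n) 𝔽)

/-- The variable `xᵢ` as a rational function. -/
def ratX {n : ℕ} (i : Fin n) : RatField n :=
  algebraMap (MvPolynomial (Fin n) 𝔽) (RatField n) (MvPolynomial.X i)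

/-- The product `∏_{i ∈ I} T_{q, xᵢ}` of `q`-shift operators: `xᵢ ↦ q xᵢ` for `i ∈ I`. -/
def qShift {n : ℕ} (I : Finset (Fin n)) :
    MvPolynomial (Fin n) 𝔽 →ₐ[𝔽] MvPolynomial (Fin n) 𝔽 :=
  MvPolynomial.aeval fun i => if i ∈ I then q • MvPolynomial.X i else MvPolynomial.X i

/-- The Macdonald difference operator
`D_k^{(n)} = t^{k(k-1)/2} ∑_{|I| = k} ∏_{i ∈ I, j ∉ I} (t xᵢ - xⱼ)/(xᵢ - xⱼ) ∏_{i ∈ I} T_{q, xᵢ}`,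
with values in rational functions. -/
def macdonaldD (n k : ℕ) (f : MvPolynomial (Fin n) 𝔽) : RatField n :=
  t ^ (k * (k - 1) / 2) •
    ∑ I ∈ Finset.powersetCard k (Finset.univ : Finset (Fin n)),
      (∏ i ∈ I, ∏ j ∈ Iᶜ, (t • ratX i - ratX j) / (ratX i - ratX j)) *
        algebraMap (MvPolynomial (Fin n) 𝔽) (RatField n) (qShift I f)

/-- The renormalized operator
`E_r^{(n)} = ∑_{k ≤ r} t^{- n r - binom(r-k+1, 2)} / (t⁻¹; t⁻¹)_{r-k} D_k^{(n)}`. -/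
def macdonaldEFin (r n : ℕ) (f : MvPolynomial (Fin n) 𝔽) : RatField n :=
  ∑ k ∈ Finset.range (r + 1),
    ((t⁻¹) ^ (n * r + (r - k + 1).choose 2) / qPochhammer t⁻¹ t⁻¹ (r - k)) • macdonaldD n k f

/-- `E` is the `r`-th Macdonald operator on symmetric functions, the limit of the operators
`E_r^{(n)}`, `n ≥ r`. -/
def IsMacdonaldOperator (r : ℕ) (E : Module.End 𝔽 Sym) : Prop :=
  ∀ n, r ≤ n → ∀ f : Sym,
    algebraMap (MvPolynomial (Fin n) 𝔽) (RatField n) (reduction n (E f)) =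
      macdonaldEFin r n (reduction n f)

/-! ### The Fock representation of the Heisenberg algebra -/

/-- The Fock space, the polynomial ring in the variables `a₋₁, a₋₂, …`: the variable with index
`n` is `a₋ₙ |0⟩` and the vacuum `|0⟩` is `1`. -/
abbrev Fock : Type := MvPolynomial ℕ+ 𝔽

/-- The vacuum vector. -/
def vacuum : Fock := 1

/-- The Heisenberg generators on the Fock space: for `n > 0`, `a₋ₙ` is multiplication by the
`n`-th variable and `aₙ = n (1 - qⁿ)/(1 - tⁿ) ∂/∂a₋ₙ`. By convention the value at `0`, which is
not a generator, is zero. -/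
def heis : ℤ → Module.End 𝔽 Fock
  | Int.ofNat 0 => 0
  | Int.ofNat (n + 1) => (((n + 1 : ℕ) : 𝔽) * ((1 - q ^ (n + 1)) / (1 - t ^ (n + 1)))) •
      (MvPolynomial.pderiv n.succPNat).toLinearMap
  | Int.negSucc n => LinearMap.mulLeft 𝔽 (MvPolynomial.X n.succPNat)

/-- The positive modes annihilate the vacuum. -/
theorem heis_vacuum (n : ℕ) : heis (n + 1 : ℕ) vacuum = 0 := by
  change heis (Int.ofNat (n + 1)) vacuum = 0
  simp [heis, vacuum]

/-- Partial derivatives commute. -/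
theorem pderiv_comm (i j : ℕ+) (v : Fock) :
    MvPolynomial.pderiv i (MvPolynomial.pderiv j v) =
      MvPolynomial.pderiv j (MvPolynomial.pderiv i v) := by
  have h : ⁅(MvPolynomial.pderiv i : Derivation 𝔽 Fock Fock),
      (MvPolynomial.pderiv j : Derivation 𝔽 Fock Fock)⁆ = 0 := by
    refine MvPolynomial.derivation_ext fun k => ?_
    simp only [Derivation.commutator_apply, MvPolynomial.pderiv_X, Derivation.zero_apply]
    rw [Pi.single_apply, Pi.single_apply]
    split_ifs <;> simp
  have h' := congrArg (fun D : Derivation 𝔽 Fock Fock => D v) h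
  simpa [Derivation.commutator_apply, sub_eq_zero] using h'

/-- The Heisenberg relations at central charge one,
`[aₘ, aₙ] = m (1 - q^|m|)/(1 - t^|m|) δ_{m+n,0}`. -/
theorem heis_comm (m n : ℤ) :
    heis m * heis n - heis n * heis m =
      (if m + n = 0 then (m : 𝔽) * ((1 - q ^ m.natAbs) / (1 - t ^ m.natAbs)) else 0) •
        (1 : Module.End 𝔽 Fock) := by
  rcases m with (_ | m) | m <;> rcases n with (_ | n) | n <;> refine LinearMap.ext fun v => ?_
  · simp [heis]
  · simp [heis]
  · simp [heis]
  · have h : ¬ ((m : ℤ) + 1 = 0) := by omega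
    simp [heis, if_neg h]
  · have h : ¬ ((m : ℤ) + 1 + ((n : ℤ) + 1) = 0) := by omega
    have hc := pderiv_comm m.succPNat n.succPNat v
    simp only [heis, Int.ofNat_eq_natCast, Nat.cast_add, Nat.cast_one, if_neg h, zero_smul,
      LinearMap.sub_apply, Module.End.mul_apply, LinearMap.smul_apply, map_smul,
      Derivation.coeFn_coe, LinearMap.zero_apply, hc]
    rw [smul_comm, sub_self]
  · simp only [heis, LinearMap.sub_apply, Module.End.mul_apply, LinearMap.smul_apply, map_smul,
      Derivation.coeFn_coe, LinearMap.mulLeft_apply,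
      Derivation.leibniz, MvPolynomial.pderiv_X, smul_eq_mul]
    by_cases h : m = n
    · subst h
      rw [if_pos (show Int.ofNat (m + 1) + Int.negSucc m = 0 by simp [Int.negSucc_eq]),
        show (Int.ofNat (m + 1)).natAbs = m + 1 from rfl]
      simp
    · have h1 : ¬ (Int.ofNat (m + 1) + Int.negSucc n = 0) := by
        simp only [Int.ofNat_eq_natCast, Int.negSucc_eq]; omega
      have h2 : n.succPNat ≠ m.succPNat := fun h' => h (Nat.succPNat_injective h').symm
      rw [if_neg h1]
      simp [h2]
  · simp [heis]
  · simp only [heis, LinearMap.sub_apply, Module.End.mul_apply, LinearMap.smul_apply, map_smul,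
      Derivation.coeFn_coe, LinearMap.mulLeft_apply,
      Derivation.leibniz, MvPolynomial.pderiv_X, smul_eq_mul]
    by_cases h : m = n
    · subst h
      rw [if_pos (show Int.negSucc m + Int.ofNat (m + 1) = 0 by simp [Int.negSucc_eq]),
        show (Int.negSucc m).natAbs = m + 1 from rfl]
      simp
      rw [← neg_smul]
      congr 1
      ring
    · have h1 : ¬ (Int.negSucc m + Int.ofNat (n + 1) = 0) := by
        simp only [Int.ofNat_eq_natCast, Int.negSucc_eq]; omega
      have h2 : m.succPNat ≠ n.succPNat := fun h' => h (Nat.succPNat_injective h')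
      rw [if_neg h1]
      simp [h2]
  · have h : ¬ (Int.negSucc m + Int.negSucc n = 0) := by omega
    rw [if_neg h]
    simp only [heis, LinearMap.sub_apply, Module.End.mul_apply, LinearMap.mulLeft_apply, zero_smul,
      LinearMap.zero_apply]
    ring

/-- The vector `|λ⟩ = a_{-λ₁} a_{-λ₂} ⋯ |0⟩`. -/
def ket (l : List ℕ+) : Fock := (l.map fun n => heis (-(n : ℤ))).prod vacuum

/-- The identification of the Fock space with symmetric functions, `|λ⟩ ↦ p_λ` for all
partitions `λ = (λ₁ ≥ λ₂ ≥ ⋯)`. -/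
def IsFockIso (iota : Fock ≃ₗ[𝔽] Sym) : Prop :=
  ∀ l : List ℕ+, l.Pairwise (· ≥ ·) → iota (ket l) = powerSumProd l

/-- The free field realization `ι⁻¹ T ι` of an operator `T` on symmetric functions. -/
def freeField (iota : Fock ≃ₗ[𝔽] Sym) (T : Module.End 𝔽 Sym) : Module.End 𝔽 Fock :=
  iota.symm.toLinearMap ∘ₗ T ∘ₗ iota.toLinearMap

/-! ### Vertex operators -/

/-- The coefficient of `u^m` in `exp (∑_{n > 0} A n uⁿ) = ∑ₖ (1/k!) (∑_{n > 0} A n uⁿ)ᵏ`. The terms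
with `k > m` do not contribute, because the series in the exponent has no constant term. -/
def expCoeff (A : ℕ → Module.End 𝔽 Fock) (m : ℕ) : Module.End 𝔽 Fock :=
  ∑ k ∈ Finset.range (m + 1), ((k.factorial : 𝔽)⁻¹) •
    PowerSeries.coeff m ((PowerSeries.mk fun n => if n = 0 then 0 else A n) ^ k)

/-- The coefficient of `z^m` in `η(z)₋ = exp (∑_{n > 0} (1 - t⁻ⁿ)/n a₋ₙ zⁿ)`. -/
def etaMinus (m : ℕ) : Module.End 𝔽 Fock :=
  expCoeff (fun n => ((1 - (t⁻¹) ^ n) / (n : 𝔽)) • heis (-(n : ℤ))) m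

/-- The coefficient of `z^{-m}` in `η(z)₊ = exp (- ∑_{n > 0} (1 - tⁿ)/n aₙ z⁻ⁿ)`. -/
def etaPlus (m : ℕ) : Module.End 𝔽 Fock :=
  expCoeff (fun n => (-((1 - t ^ n) / (n : 𝔽))) • heis (n : ℤ)) m

/-- The ways to write the exponent `e` as a difference of exponents of the two halves. -/
abbrev Splitting {r : ℕ} (e : Fin r → ℤ) : Type :=
  {p : (Fin r → ℕ) × (Fin r → ℕ) // ∀ i, (p.1 i : ℤ) - (p.2 i : ℤ) = e i}

/-- One term of the coefficient of `z^e` in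
`:η(z₁)⋯η(z_r): = η(z₁)₋⋯η(z_r)₋ η(z₁)₊⋯η(z_r)₊`, applied to the vector `v`. -/
def normalTerm {r : ℕ} (e : Fin r → ℤ) (v : Fock) (p : Splitting e) : Fock :=
  (List.ofFn fun i => etaMinus (p.1.1 i)).prod ((List.ofFn fun i => etaPlus (p.1.2 i)).prod v)

/-- The coefficient of `z^e` in `:η(z₁)⋯η(z_r):`, applied to the vector `v` (a sum with finitely
many nonzero terms). -/
def normalCoeff {r : ℕ} (e : Fin r → ℤ) (v : Fock) : Fock := ∑ᶠ p : Splitting e, normalTerm e v p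

/-! ### The determinant and the residue -/

/-- The coefficients of `1/(zᵢ - t⁻¹ zⱼ)`, as a formal series in `z₁^{±1}, …, z_r^{±1}`: for `i ≠ j`
the expansion `∑_{k ≥ 0} t⁻ᵏ zⱼᵏ zᵢ^{-k-1}`, for `i = j` the monomial `(1 - t⁻¹)⁻¹ zᵢ⁻¹`. -/
def entryCoeff {r : ℕ} (i j : Fin r) (e : Fin r → ℤ) : 𝔽 :=
  open Classical in
  if i = j then
    if e = Pi.single i (-1) then (1 - t⁻¹)⁻¹ else 0
  else
    if 0 ≤ e j ∧ e = Pi.single j (e j) - Pi.single i (e j + 1) then (t⁻¹) ^ (e j).toNat else 0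

/-- The families of `r` exponents with sum `e`. -/
abbrev ExponentFamily {r : ℕ} (e : Fin r → ℤ) : Type :=
  {k : Fin r → Fin r → ℤ // ∑ i, k i = e}

/-- One term of the coefficient of `z^e` in the product `∏ᵢ 1/(z_{σ(i)} - t⁻¹ zᵢ)`. -/
def permTerm {r : ℕ} (σ : Equiv.Perm (Fin r)) (e : Fin r → ℤ) (k : ExponentFamily e) : 𝔽 :=
  ∏ i, entryCoeff (σ i) i (k.1 i)

/-- The coefficient of `z^e` in `det (1/(zᵢ - t⁻¹ zⱼ)) = ∑_σ sgn(σ) ∏ᵢ 1/(z_{σ(i)} - t⁻¹ zᵢ)`. -/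
def detCoeff {r : ℕ} (e : Fin r → ℤ) : 𝔽 :=
  ∑ σ : Equiv.Perm (Fin r), ((Equiv.Perm.sign σ : ℤ) : 𝔽) * tInvSum (permTerm σ e)

/-- One term of the coefficient of `z₁⁻¹⋯z_r⁻¹` in
`det (1/(zᵢ - t⁻¹ zⱼ)) :η(z₁)⋯η(z_r):`, applied to the vector `v`. -/
def residueTerm {r : ℕ} (v : Fock) (e : Fin r → ℤ) : Fock :=
  detCoeff e • normalCoeff (fun i => -1 - e i) v

/-- The formal residue
`∫ ∏ dzᵢ/(2π√-1) det (1/(zᵢ - t⁻¹ zⱼ)) :η(z₁)⋯η(z_r):`, applied to the vector `v` (a sum with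
finitely many nonzero terms). -/
def detResidue (r : ℕ) (v : Fock) : Fock := ∑ᶠ e : Fin r → ℤ, residueTerm v e

end MacdonaldFock

end

/-!
The formula is proved in `n` variables for every `n`, as an identity between the Macdonald operator
and the image of the residue under `fockToPoly n`, the map `a₋ₖ ↦ x₁ᵏ + ⋯ + xₙᵏ`. There `η(z)₋` is the
multiplication by `Q(z) = ∏ (1 - t⁻¹xᵢz)/(1 - xᵢz)` (`fockToPoly_etaMinus`), while
`η(z₁)₊⋯η(z_r)₊` is the algebra homomorphism `a₋ₖ ↦ a₋ₖ + (qᵏ - 1) ∑ wᵢᵏ` with `wᵢ = 1/zᵢ`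
(`prod_etaPlus_apply`). Hence the residue at a vector `v` is a linear functional, depending only on
`Q` and on the determinant, of a symmetric polynomial `G` in `w₁, …, w_r` (`fockToPoly_detResidue`).
The Macdonald operators are functionals of the same `G`: substituting the `xⱼ`, `j ∈ I`, and `r - |I|`
zeros for the `wᵢ` turns `G` into the `q`-shift of `v` in the variables `xⱼ`, `j ∈ I`
(`aeval_paddedPoint_multiShiftHom`). It remains to compare two linear functionals on symmetric
polynomials, and by polarization it is enough to do so on the products `g(w₁)⋯g(w_r)`
(`linearMap_eq_of_isSymmetric`).

Put `τ = t⁻¹`. The coefficients of the determinant are elements of the valuation ring of the place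
`t = ∞`, and modulo `τ^M` they are given by finite sums (`tau_pow_dvd_detCoeffInt_sub`). Modulo
`τ^M` the residue of `g(w₁)⋯g(w_r)` is therefore a sum of `r × r` minors of the matrix
`τᵏ [wᵏ] (Q · g wˡ)` (`residueFunctional_detTrunc`), that is, `r!` times the coefficient of `uʳ` in the
Fredholm determinant `det (1 + u A)` of a Toeplitz operator `A` with symbol `Q(z) g(1/z)` followed by
the dilation `w ↦ τw` (`sum_det_eq_factorial_mul`).

This Fredholm determinant can be computed, because `A` maps multiples of `∏ (w - xᵢ)` to multiples of
`∏ (w - xᵢ)`: multiplication by `Q` replaces `∏ (w - xᵢ)` by `∏ (w - τxᵢ)`, and the dilation takes the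
latter back to `τⁿ ∏ (w - xᵢ)` (`contract_nodal_mul`, `toeplitz_nodal_mul`). On these multiples `A` is
triangular with diagonal entries `τ^{n+k} g(0)`, and on the quotient, which consists of the values at
the points `xᵢ`, it is a Cauchy matrix with columns scaled by the `g(xⱼ)` (`fredholm_toeplitz`).
The principal minors of the Cauchy matrix are `τ^{k(k-1)/2} ∏ (xⱼ - τxᵢ)/(xⱼ - xᵢ)`
(`det_cauchyKernel_submatrix`), which up to a power of `t` are the coefficients of the operators
`D_k`. The elementary symmetric functions of `1, τ, τ², …` are Euler's `τ^{s(s-1)/2}/(τ; τ)_s`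
(`pow_dvd_coeff_prod_sub`), which give the coefficients of the combination `E_r` of the `D_k`. The
resulting identity is `toeplitz_minors_limit`.

Since the residue is defined on the whole Fock space and gives the Macdonald operators for all `n`,
it also proves the existence of `E_r`. The uniqueness of `E_r` holds because a symmetric function of
degree at most `d` is determined by its reduction to `d` variables (`sym_eq_zero`). The map `ι` is
bijective because the power sums generate the symmetric polynomials, by Newton's identities, and are
algebraically independent, a surjective endomorphism of a Noetherian ring being injective
(`injective_aeval_psum`).
-/


noncomputable section

namespace MacdonaldFock

section ToeplitzOperators

open Polynomial

/-! ### Contraction of polynomials by power series -/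

section Contraction

variable {R : Type*} [CommRing R]

/-- The action of a power series `∑ Q_a z^a` on polynomials in `w = z⁻¹`, multiplication followed by
the projection onto nonnegative powers of `w`: `w^p ↦ ∑_{a + k = p} Q_a w^k`. -/
def contract (Q : PowerSeries R) : R[X] →ₗ[R] R[X] :=
  Polynomial.lsum fun p => LinearMap.toSpanSingleton R R[X]
    (∑ a ∈ Finset.HasAntidiagonal.antidiagonal p, monomial a.2 (PowerSeries.coeff a.1 Q))

theorem contract_monomial (Q : PowerSeries R) (p : ℕ) (c : R) :
    contract Q (monomial p c) =
      ∑ a ∈ Finset.HasAntidiagonal.antidiagonal p, monomial a.2 (c * PowerSeries.coeff a.1 Q) := by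
  simp [contract, Polynomial.lsum, Polynomial.sum_monomial_index, Finset.smul_sum, smul_monomial]

theorem contract_mul (P Q : PowerSeries R) (f : R[X]) :
    contract (P * Q) f = contract P (contract Q f) := by
  induction f using Polynomial.induction_on' with
  | add f g hf hg => simp only [map_add, hf, hg]
  | monomial p c =>
    simp only [contract_monomial, map_sum, PowerSeries.coeff_mul, Finset.mul_sum]
    rw [Finset.sum_sigma', Finset.sum_sigma']
    refine Finset.sum_nbij' (fun x => ⟨(x.2.2, x.2.1 + x.1.2), (x.2.1, x.1.2)⟩)
      (fun y => ⟨(y.2.1 + y.1.1, y.2.2), (y.2.1, y.1.1)⟩) ?_ ?_ ?_ ?_ ?_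
    · rintro ⟨⟨s, k⟩, ⟨i, j⟩⟩ h
      simp at h ⊢
      omega
    · rintro ⟨⟨s, k⟩, ⟨i, j⟩⟩ h
      simp at h ⊢
      omega
    · rintro ⟨⟨s, k⟩, ⟨i, j⟩⟩ h
      simp at h ⊢
      exact h.2
    · rintro ⟨⟨s, k⟩, ⟨i, j⟩⟩ h
      simp at h ⊢
      exact h.2
    · rintro ⟨⟨s, k⟩, ⟨i, j⟩⟩ h
      simp only
      congr 1
      ring

theorem contract_one (f : R[X]) : contract 1 f = f := by
  induction f using Polynomial.induction_on' with
  | add f g hf hg => simp only [map_add, hf, hg]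
  | monomial p c =>
    rw [contract_monomial, Finset.sum_eq_single (0, p)]
    · simp
    · rintro ⟨a, b⟩ h hne
      have : a ≠ 0 := by rintro rfl; simp at h; simp [h] at hne
      simp [PowerSeries.coeff_one, this]
    · simp

theorem coeff_contract (Q : PowerSeries R) (f : R[X]) (k : ℕ) :
    (contract Q f).coeff k =
      f.sum fun p c => if k ≤ p then c * PowerSeries.coeff (p - k) Q else 0 := by
  induction f using Polynomial.induction_on' with
  | add f g hf hg =>
    rw [map_add, coeff_add, hf, hg, Polynomial.sum_add_index]
    · simp
    · intros; split_ifs <;> ring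
  | monomial p c =>
    rw [contract_monomial, Polynomial.sum_monomial_index _ _ (by simp), finsetSum_coeff]
    simp only [coeff_monomial]
    split_ifs with h
    · rw [Finset.sum_eq_single (p - k, k)]
      · simp
      · rintro ⟨a, b⟩ hab hne
        rw [if_neg]
        rintro rfl
        simp at hab
        apply hne; ext <;> simp; omega
      · intro h'; simp at h'; omega
    · refine Finset.sum_eq_zero ?_
      rintro ⟨a, b⟩ hab
      simp at hab
      rw [if_neg]; simp; omega

theorem contract_mem_degreeLT (Q : PowerSeries R) {f : R[X]} {N : ℕ} (hf : f ∈ degreeLT R N) :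
    contract Q f ∈ degreeLT R N := by
  rw [mem_degreeLT, degree_lt_iff_coeff_zero] at hf ⊢
  intro k hk
  rw [coeff_contract, Polynomial.sum_def]
  refine Finset.sum_eq_zero fun p _ => ?_
  split_ifs with h
  · rw [hf p (hk.trans h), zero_mul]
  · rfl

theorem map_contract {S : Type*} [CommRing S] (φ : R →+* S) (Q : PowerSeries R) (f : R[X]) :
    (contract Q f).map φ = contract (Q.map φ) (f.map φ) := by
  induction f using Polynomial.induction_on' with
  | add f g hf hg => simp only [map_add, Polynomial.map_add, hf, hg]
  | monomial p c =>
    simp [contract_monomial, Polynomial.map_sum]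

/-- Contraction commutes with the multiplication by `w` up to constants, which come from the
projection. -/
theorem contract_X_mul (Q : PowerSeries R) (f : R[X]) :
    ∃ c, contract Q (X * f) = X * contract Q f + C c := by
  induction f using Polynomial.induction_on' with
  | add f g hf hg =>
    obtain ⟨c, hc⟩ := hf
    obtain ⟨d, hd⟩ := hg
    exact ⟨c + d, by rw [mul_add, map_add, hc, hd, map_add, C_add]; ring⟩
  | monomial p c =>
    refine ⟨c * PowerSeries.coeff (p + 1) Q, ?_⟩
    rw [X_mul_monomial, contract_monomial, contract_monomial, Finset.Nat.antidiagonal_succ',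
      Finset.sum_cons, Finset.sum_map, Finset.mul_sum, add_comm]
    simp [X_mul_monomial]

theorem contract_one_sub_C_mul_X (x : R) (f : R[X]) :
    contract (1 - PowerSeries.C x * PowerSeries.X) (X * f) = (X - C x) * f := by
  induction f using Polynomial.induction_on' with
  | add f g hf hg => simp only [mul_add, map_add, hf, hg]
  | monomial p c =>
    rw [X_mul_monomial, contract_monomial, Finset.Nat.antidiagonal_succ, Finset.sum_cons,
      Finset.sum_map, Finset.sum_eq_single (0, p)]
    · rw [sub_mul, X_mul_monomial, C_mul_monomial]
      simp [sub_eq_add_neg, mul_comm]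
    · rintro ⟨a, b⟩ h hne
      have : a ≠ 0 := by rintro rfl; simp at h; simp [h] at hne
      have h' : PowerSeries.coeff a (PowerSeries.C x) = 0 := by
        rw [PowerSeries.coeff_C, if_neg this]
      simp [PowerSeries.coeff_one, h']
    · simp

theorem contract_prod {ι : Type*} (s : Finset ι) (x : ι → R) (f : R[X]) :
    contract (∏ i ∈ s, (1 - PowerSeries.C (x i) * PowerSeries.X)) (X ^ s.card * f) =
      (∏ i ∈ s, (X - C (x i))) * f := by
  classical
  induction s using Finset.induction_on generalizing f with
  | empty => simp [contract_one]
  | insert i s hi ih =>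
    rw [Finset.prod_insert hi, Finset.prod_insert hi, Finset.card_insert_of_notMem hi, contract_mul,
      pow_succ, mul_assoc, ih, mul_left_comm, contract_one_sub_C_mul_X, mul_assoc]

/-- Contraction by `∏ (1 - τ xᵢ z) / (1 - xᵢ z)` on the ideal generated by `∏ (w - xᵢ)`. Since
`w - x = (1 - x z) w`, both sides are the contraction of `wⁿ f` by `∏ (1 - τ xᵢ z)`. -/
theorem contract_nodal_mul {ι : Type*} [Fintype ι] (x : ι → R) (τ : R) (Q : PowerSeries R)
    (hQ : Q * ∏ i, (1 - PowerSeries.C (x i) * PowerSeries.X) =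
      ∏ i, (1 - PowerSeries.C (τ * x i) * PowerSeries.X)) (f : R[X]) :
    contract Q ((∏ i, (X - C (x i))) * f) = (∏ i, (X - C (τ * x i))) * f := by
  rw [← contract_prod, ← contract_mul, hQ, contract_prod]

/-- The series `∏ (1 - τ xᵢ z) / (1 - xᵢ z)` exists over every ring. -/
theorem exists_quotient {ι : Type*} [Fintype ι] (x : ι → R) (τ : R) :
    ∃ Q : PowerSeries R, Q * ∏ i, (1 - PowerSeries.C (x i) * PowerSeries.X) =
      ∏ i, (1 - PowerSeries.C (τ * x i) * PowerSeries.X) := by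
  have hu : IsUnit (∏ i, (1 - PowerSeries.C (x i) * PowerSeries.X)) := by
    rw [PowerSeries.isUnit_iff_constantCoeff]
    simp
  obtain ⟨u, hu⟩ := hu
  exact ⟨(∏ i, (1 - PowerSeries.C (τ * x i) * PowerSeries.X)) * ↑u⁻¹, by rw [← hu, mul_assoc]; simp⟩

theorem coeff_zero_quotient {ι : Type*} [Fintype ι] (x : ι → R) (τ : R)
    (Q : PowerSeries R) (hQ : Q * ∏ i, (1 - PowerSeries.C (x i) * PowerSeries.X) =
      ∏ i, (1 - PowerSeries.C (τ * x i) * PowerSeries.X)) : PowerSeries.coeff 0 Q = 1 := by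
  have h := congrArg PowerSeries.constantCoeff hQ
  simpa using h

end Contraction

/-! ### The characteristic polynomial of a dilated Toeplitz operator -/

section Toeplitz

variable {K : Type*} [Field K] {ι : Type*} [Fintype ι]

/-- The monic polynomial `w^L ∏ᵢ (w - xᵢ)`. -/
def levelPoly {R : Type*} [CommRing R] (x : ι → R) (L : ℕ) : R[X] := (∏ i, (X - C (x i))) * X ^ L

theorem levelPoly_monic {R : Type*} [CommRing R] (x : ι → R) (L : ℕ) : (levelPoly x L).Monic :=
  (monic_prod_of_monic _ _ fun _ _ => monic_X_sub_C _).mul (monic_X_pow _)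

theorem natDegree_levelPoly {R : Type*} [CommRing R] [Nontrivial R] (x : ι → R) (L : ℕ) :
    (levelPoly x L).natDegree = Fintype.card ι + L := by
  rw [levelPoly, (monic_prod_of_monic _ _ fun _ _ => monic_X_sub_C _).natDegree_mul (monic_X_pow _),
    natDegree_X_pow, natDegree_prod_of_monic _ _ fun _ _ => monic_X_sub_C _]
  simp

/-- Multiplication by `g` modulo `w^L ∏ᵢ (w - xᵢ)`, followed by contraction by `Q` and by the
dilation `w ↦ τ w`. -/
def toeplitz {R : Type*} [CommRing R] (x : ι → R) (τ : R) (Q : PowerSeries R) (g : R[X]) (L : ℕ) :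
    R[X] →ₗ[R] R[X] :=
  (aeval (C τ * X : R[X])).toLinearMap ∘ₗ contract Q ∘ₗ modByMonicHom (levelPoly x L) ∘ₗ
    LinearMap.mulLeft R g

theorem toeplitz_apply {R : Type*} [CommRing R] (x : ι → R) (τ : R) (Q : PowerSeries R) (g : R[X])
    (L : ℕ) (f : R[X]) :
    toeplitz x τ Q g L f = (contract Q ((g * f) %ₘ levelPoly x L)).comp (C τ * X) := by
  simp only [toeplitz, LinearMap.comp_apply, LinearMap.mulLeft_apply, AlgHom.toLinearMap_apply,
    ← Polynomial.comp_eq_aeval]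
  rfl

theorem toeplitz_mem_degreeLT (x : ι → K) (τ : K) (Q : PowerSeries K) (g : K[X]) (L : ℕ) (f : K[X]) :
    toeplitz x τ Q g L f ∈ degreeLT K (Fintype.card ι + L) := by
  have h : (g * f) %ₘ levelPoly x L ∈ degreeLT K (Fintype.card ι + L) := by
    rw [mem_degreeLT]
    refine (degree_modByMonic_lt _ (levelPoly_monic x L)).trans_le ?_
    rw [degree_eq_natDegree (levelPoly_monic x L).ne_zero, natDegree_levelPoly]
  have h' := contract_mem_degreeLT Q h
  rw [mem_degreeLT, degree_lt_iff_coeff_zero] at h' ⊢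
  intro k hk
  rw [toeplitz_apply, comp_C_mul_X_coeff, h' k hk, zero_mul]

/-- Dilation multiplies the nodal polynomial of `τ xᵢ` by `τ^n`. -/
theorem prod_comp_C_mul_X (x : ι → K) (τ : K) :
    (∏ i, (X - C (τ * x i))).comp (C τ * X) = C (τ ^ Fintype.card ι) * ∏ i, (X - C (x i)) := by
  rw [prod_comp, C_pow, ← Finset.card_univ, ← Finset.prod_const, ← Finset.prod_mul_distrib]
  refine Finset.prod_congr rfl fun i _ => ?_
  simp only [sub_comp, X_comp, C_comp]
  rw [C_mul]
  ring

theorem toeplitz_nodal_mul (x : ι → K) (τ : K) (Q : PowerSeries K)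
    (hQ : Q * ∏ i, (1 - PowerSeries.C (x i) * PowerSeries.X) =
      ∏ i, (1 - PowerSeries.C (τ * x i) * PowerSeries.X)) (g : K[X]) (L : ℕ) (f : K[X]) :
    toeplitz x τ Q g L ((∏ i, (X - C (x i))) * f) =
      C (τ ^ Fintype.card ι) * (∏ i, (X - C (x i))) * ((g * f) %ₘ X ^ L).comp (C τ * X) := by
  have h : (g * ((∏ i, (X - C (x i))) * f)) %ₘ levelPoly x L =
      (∏ i, (X - C (x i))) * ((g * f) %ₘ X ^ L) := by
    rw [mul_left_comm, levelPoly]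
    have hm : (∏ i, (X - C (x i))).Monic := monic_prod_of_monic _ _ fun _ _ => monic_X_sub_C _
    refine (div_modByMonic_unique ((g * f) /ₘ X ^ L) _ (levelPoly_monic x L) ⟨?_, ?_⟩).2
    · conv_rhs => rw [← modByMonic_add_div (g * f) (X ^ L : K[X])]
      rw [levelPoly]; ring
    · rw [levelPoly, degree_mul, degree_mul]
      refine WithBot.add_lt_add_left ?_ (degree_modByMonic_lt _ (monic_X_pow L))
      rw [degree_ne_bot]; exact hm.ne_zero
  rw [toeplitz_apply, h, contract_nodal_mul x τ Q hQ, mul_comp, prod_comp_C_mul_X]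

/-- The matrix of the dilated Toeplitz operator `w^p ↦ ∑ Q_a (τ w)^{p-a}` on values at the points
`xᵢ`. -/
def cauchyKernel [DecidableEq ι] (x : ι → K) (τ : K) : Matrix ι ι K :=
  .of fun i j => (∏ k, (x j - τ * x k)) / (∏ k ∈ Finset.univ.erase j, (x j - x k)) /
    (x j - τ * x i)

/-- The product of `w - xⱼ` and a Lagrange polynomial is a multiple of `∏ (w - xᵢ)`, on which the
contraction is known; evaluation at `xⱼ` determines the constant in `contract_X_mul`. -/
theorem eval_contract_basis [DecidableEq ι] (x : ι → K) (τ : K)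
    (hτ : ∀ i j, x j - τ * x i ≠ 0) (Q : PowerSeries K)
    (hQ : Q * ∏ i, (1 - PowerSeries.C (x i) * PowerSeries.X) =
      ∏ i, (1 - PowerSeries.C (τ * x i) * PowerSeries.X)) (i j : ι) :
    (contract Q (Lagrange.basis Finset.univ x j)).eval (τ * x i) = cauchyKernel x τ i j := by
  have h1 : (X - C (x j)) * Lagrange.basis Finset.univ x j =
      C (∏ k ∈ Finset.univ.erase j, (x j - x k))⁻¹ * ∏ i, (X - C (x i)) := by
    rw [Lagrange.basis, ← Finset.mul_prod_erase Finset.univ _ (Finset.mem_univ j), mul_left_comm]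
    congr 1
    simp only [Lagrange.basisDivisor, Finset.prod_mul_distrib]
    rw [← Finset.prod_inv_distrib, map_prod]
  obtain ⟨c, hc⟩ := contract_X_mul Q (Lagrange.basis Finset.univ x j)
  have h2 := congrArg (contract Q) h1
  rw [sub_mul, map_sub, hc, ← smul_eq_C_mul, ← smul_eq_C_mul, map_smul, map_smul,
    show (∏ i, (X - C (x i))) = (∏ i, (X - C (x i))) * 1 by rw [mul_one],
    contract_nodal_mul x τ Q hQ, mul_one] at h2
  have h3 := congrArg (eval (x j)) h2
  have h4 := congrArg (eval (τ * x i)) h2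
  simp only [eval_sub, eval_add, eval_mul, eval_X, eval_C, eval_smul, smul_eq_mul, eval_prod] at h3 h4
  rw [Finset.prod_eq_zero (Finset.mem_univ i) (sub_self _), mul_zero] at h4
  rw [cauchyKernel, Matrix.of_apply, eq_div_iff (hτ i j), div_eq_inv_mul, ← h3]
  linear_combination -h4

end Toeplitz

end ToeplitzOperators

section Fredholm

open Polynomial

/-! ### Fredholm determinants -/

/-- The polynomial `det (1 + u M)`; its coefficients are the sums of principal minors of `M`. -/
def fredholm {R ι : Type*} [CommRing R] [Fintype ι] [DecidableEq ι] (M : Matrix ι ι R) : R[X] :=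
  (1 + (X : R[X]) • M.map C).det

section Toeplitz

variable {K : Type*} [Field K]

theorem fredholm_eq_charpolyRev {R ι : Type*} [CommRing R] [Fintype ι] [DecidableEq ι]
    (M : Matrix ι ι R) : fredholm M = (-M).charpolyRev := by
  rw [fredholm, Matrix.charpolyRev]
  congr 1
  ext i j : 2
  simp [sub_eq_add_neg]

theorem fredholm_toMatrix_eq {V ι₁ ι₂ : Type*} [AddCommGroup V] [Module K V] [Fintype ι₁]
    [DecidableEq ι₁] [Fintype ι₂] [DecidableEq ι₂] (b₁ : Module.Basis ι₁ K V)
    (b₂ : Module.Basis ι₂ K V) (f : V →ₗ[K] V) :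
    fredholm (LinearMap.toMatrix b₁ b₁ f) = fredholm (LinearMap.toMatrix b₂ b₂ f) := by
  have := Module.Finite.of_basis b₁
  rw [fredholm_eq_charpolyRev, fredholm_eq_charpolyRev, ← Matrix.reverse_charpoly,
    ← Matrix.reverse_charpoly, ← map_neg, ← map_neg, LinearMap.charpoly_toMatrix,
    LinearMap.charpoly_toMatrix]

theorem fredholm_fromBlocks {R ι κ : Type*} [CommRing R] [Fintype ι] [DecidableEq ι] [Fintype κ]
    [DecidableEq κ] (A : Matrix ι ι R) (B : Matrix κ ι R) (D : Matrix κ κ R) :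
    fredholm (Matrix.fromBlocks A 0 B D) = fredholm A * fredholm D := by
  have h : (1 + (X : R[X]) • (Matrix.fromBlocks A 0 B D).map C) =
      Matrix.fromBlocks (1 + (X : R[X]) • A.map C) 0 ((X : R[X]) • B.map C)
        (1 + (X : R[X]) • D.map C) := by
    ext i j : 2
    rcases i with i | i <;> rcases j with j | j <;> simp [Matrix.one_apply]
  rw [fredholm, h, Matrix.det_fromBlocks_zero₁₂]
  rfl

theorem fredholm_of_lowerTriangular {R : Type*} [CommRing R] {n : ℕ} (M : Matrix (Fin n) (Fin n) R)
    (h : ∀ i j, i < j → M i j = 0) : fredholm M = ∏ i, (1 + C (M i i) * X) := by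
  rw [fredholm, Matrix.det_of_isLowerTriangular]
  · refine Finset.prod_congr rfl fun i _ => ?_
    rw [Matrix.add_apply, Matrix.one_apply_eq, Matrix.smul_apply, Matrix.map_apply, smul_eq_mul,
      mul_comm]
  · intro i j hij
    have hij' : i < j := hij
    simp [h i j hij', hij'.ne]

theorem fredholm_coeff {R ι : Type*} [CommRing R] [Fintype ι] [DecidableEq ι] (M : Matrix ι ι R)
    (k : ℕ) : (fredholm M).coeff k = ∑ s ∈ Finset.univ.powersetCard k,
      (M.submatrix (Subtype.val : s → ι) (Subtype.val : s → ι)).det :=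
  Matrix.coeff_det_one_add_X_smul_eq_sum_minors M k

variable {ι : Type*} [Fintype ι]

theorem nodal_dvd_of_eval_eq_zero (x : ι → K) (hx : Function.Injective x) (f : K[X])
    (hf : ∀ i, f.eval (x i) = 0) : (∏ i, (X - C (x i))) ∣ f := by
  refine Finset.prod_dvd_of_coprime ?_ fun i _ => dvd_iff_isRoot.2 (hf i)
  intro i _ j _ hij
  exact pairwise_coprime_X_sub_C hx hij

/-- Lagrange interpolation with remainder. -/
theorem exists_eq_interpolate_add [DecidableEq ι] (x : ι → K) (hx : Function.Injective x) (f : K[X]) :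
    ∃ φ, f = ∑ i, C (f.eval (x i)) * Lagrange.basis Finset.univ x i +
      (∏ i, (X - C (x i))) * φ := by
  obtain ⟨φ, hφ⟩ := nodal_dvd_of_eval_eq_zero x hx
    (f - Lagrange.interpolate Finset.univ x fun i => f.eval (x i)) fun i => by
      rw [eval_sub, Lagrange.eval_interpolate_at_node _ hx.injOn (Finset.mem_univ i), sub_self]
  refine ⟨φ, ?_⟩
  rw [← hφ, Lagrange.interpolate_apply]
  ring

/-- Modulo multiples of `∏ (w - xᵢ)`, which the operator preserves, the product of `g` and the `j`-th
Lagrange polynomial is `g(xⱼ)` times the latter. -/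
theorem eval_toeplitz_basis [DecidableEq ι] (x : ι → K) (hx : Function.Injective x) (τ : K)
    (hτ : ∀ i j, x j - τ * x i ≠ 0) (Q : PowerSeries K)
    (hQ : Q * ∏ i, (1 - PowerSeries.C (x i) * PowerSeries.X) =
      ∏ i, (1 - PowerSeries.C (τ * x i) * PowerSeries.X)) (g : K[X]) (L : ℕ) (i j : ι) :
    (toeplitz x τ Q g L (Lagrange.basis Finset.univ x j)).eval (x i) =
      cauchyKernel x τ i j * g.eval (x j) := by
  obtain ⟨φ, hφ⟩ := nodal_dvd_of_eval_eq_zero x hx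
    ((g * Lagrange.basis Finset.univ x j) %ₘ levelPoly x L -
      C (g.eval (x j)) * Lagrange.basis Finset.univ x j) fun k => by
      rw [modByMonic_eq_sub_mul_div, eval_sub, eval_sub, eval_mul, eval_mul, eval_mul,
        levelPoly, eval_mul, eval_prod, Finset.prod_eq_zero (Finset.mem_univ k) (by simp), eval_C]
      by_cases hk : j = k
      · subst hk; ring
      · rw [Lagrange.eval_basis_of_ne hk (Finset.mem_univ k)]; ring
  rw [toeplitz_apply, ← sub_add_cancel ((g * Lagrange.basis Finset.univ x j) %ₘ levelPoly x L)
    (C (g.eval (x j)) * Lagrange.basis Finset.univ x j), hφ, map_add, contract_nodal_mul x τ Q hQ,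
    ← smul_eq_C_mul, map_smul, eval_comp]
  simp only [eval_mul, eval_C, eval_X, eval_add, eval_smul, eval_prod, eval_sub]
  rw [Finset.prod_eq_zero (Finset.mem_univ i) (sub_self _), zero_mul, zero_add,
    eval_contract_basis x τ hτ Q hQ, smul_eq_mul, mul_comm]

/-- The basis of the polynomials of degree less than `n + L` formed by the Lagrange basis of the
points `xᵢ` and by the multiples `w^k ∏ᵢ (w - xᵢ)`. -/
def nodalFamily [DecidableEq ι] (x : ι → K) (L : ℕ) : ι ⊕ Fin L → K[X] :=
  Sum.elim (fun i => Lagrange.basis Finset.univ x i) fun k => (∏ i, (X - C (x i))) * X ^ (k : ℕ)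

variable [DecidableEq ι]

theorem nodalFamily_mem (x : ι → K) (hx : Function.Injective x) (L : ℕ) (s : ι ⊕ Fin L) :
    nodalFamily x L s ∈ degreeLT K (Fintype.card ι + L) := by
  rw [mem_degreeLT]
  rcases s with i | k
  · have := Fintype.card_pos_iff.2 ⟨i⟩
    simp only [nodalFamily, Sum.elim_inl]
    rw [Lagrange.degree_basis hx.injOn (Finset.mem_univ i), Finset.card_univ]
    exact_mod_cast (by omega : Fintype.card ι - 1 < Fintype.card ι + L)
  · simp only [nodalFamily, Sum.elim_inr]
    have hm : (∏ i, (X - C (x i))).Monic := monic_prod_of_monic _ _ fun _ _ => monic_X_sub_C _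
    rw [degree_eq_natDegree (hm.mul (monic_X_pow _)).ne_zero, hm.natDegree_mul (monic_X_pow _),
      natDegree_finsetProd_X_sub_C_eq_card, Finset.card_univ, natDegree_X_pow]
    exact_mod_cast (by omega : Fintype.card ι + k < Fintype.card ι + L)

theorem nodalFamily_linearIndependent (x : ι → K) (hx : Function.Injective x) (L : ℕ) :
    LinearIndependent K (nodalFamily x L) := by
  rw [Fintype.linearIndependent_iff]
  intro c hc
  rw [Fintype.sum_sum_type] at hc
  simp only [nodalFamily, Sum.elim_inl, Sum.elim_inr] at hc
  have h1 : ∀ i, c (.inl i) = 0 := by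
    intro i
    have h := congrArg (eval (x i)) hc
    rw [eval_add, eval_finsetSum, eval_finsetSum, Finset.sum_eq_single i, Finset.sum_eq_zero] at h
    · simpa [eval_smul, Lagrange.eval_basis_self hx.injOn (Finset.mem_univ i)] using h
    · intro k _
      rw [eval_smul, eval_mul, eval_prod, Finset.prod_eq_zero (Finset.mem_univ i) (by simp)]
      simp
    · intro j _ hj
      rw [eval_smul, Lagrange.eval_basis_of_ne hj (Finset.mem_univ i), smul_zero]
    · simp
  have hm : (∏ i, (X - C (x i))).Monic := monic_prod_of_monic _ _ fun _ _ => monic_X_sub_C _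
  simp only [h1, zero_smul, Finset.sum_const_zero, zero_add, ← mul_smul_comm, ← Finset.mul_sum] at hc
  have h2 := (mul_eq_zero.1 hc).resolve_left hm.ne_zero
  rintro (i | k)
  · exact h1 i
  · have h := congrArg (fun p => coeff p k) h2
    simpa [finsetSum_coeff, coeff_X_pow, Fin.val_inj] using h

/-- The family `nodalFamily` as a basis. -/
def nodalBasis (x : ι → K) (hx : Function.Injective x) (L : ℕ) :
    Module.Basis (ι ⊕ Fin L) K (degreeLT K (Fintype.card ι + L)) :=
  basisOfLinearIndependentOfCardEqFinrank'
    (fun s => (⟨nodalFamily x L s, nodalFamily_mem x hx L s⟩ : degreeLT K (Fintype.card ι + L)))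
    (LinearIndependent.of_comp (degreeLT K _).subtype (nodalFamily_linearIndependent x hx L))
    (by rw [Module.finrank_eq_card_basis (degreeLT.basis K (Fintype.card ι + L))]; simp)

theorem coe_nodalBasis (x : ι → K) (hx : Function.Injective x) (L : ℕ) (s : ι ⊕ Fin L) :
    (nodalBasis x hx L s : K[X]) = nodalFamily x L s := by
  simp [nodalBasis]

/-- The restriction of the dilated Toeplitz operator to polynomials of degree less than `n + L`. -/
def toeplitzRestrict (x : ι → K) (τ : K) (Q : PowerSeries K) (g : K[X]) (L : ℕ) :
    degreeLT K (Fintype.card ι + L) →ₗ[K] degreeLT K (Fintype.card ι + L) :=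
  ((toeplitz x τ Q g L).comp (degreeLT K _).subtype).codRestrict _
    fun _ => toeplitz_mem_degreeLT x τ Q g L _

theorem eq_sum_coeff_mul_X_pow {R : Type*} [CommRing R] {f : R[X]} {L : ℕ} (hf : f.degree < L) :
    f = ∑ k : Fin L, f.coeff k • X ^ (k : ℕ) := by
  rw [Fin.sum_univ_eq_sum_range (fun k => f.coeff k • X ^ k)]
  ext k
  simp only [finsetSum_coeff, coeff_smul, coeff_X_pow, smul_eq_mul, mul_ite, mul_one, mul_zero,
    Finset.sum_ite_eq, Finset.mem_range]
  split_ifs with h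
  · rfl
  · exact coeff_eq_zero_of_degree_lt (hf.trans_le (by exact_mod_cast not_lt.1 h))

theorem coeff_modByMonic_X_pow {R : Type*} [CommRing R] (f : R[X]) {k L : ℕ} (hk : k < L) :
    (f %ₘ X ^ L).coeff k = f.coeff k := by
  rw [modByMonic_eq_sub_mul_div, coeff_sub, coeff_X_pow_mul', if_neg (by omega), sub_zero]

theorem degree_comp_C_mul_X_lt {R : Type*} [CommRing R] {f : R[X]} {L : ℕ} (hf : f.degree < L)
    (a b : R) : (C a * f.comp (C b * X)).degree < L := by
  rw [degree_lt_iff_coeff_zero] at hf ⊢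
  intro k hk
  rw [coeff_C_mul, comp_C_mul_X_coeff, hf k hk, zero_mul, mul_zero]

/-- Multiples of `∏ᵢ (w - xᵢ)` form an invariant subspace of the dilated Toeplitz operator. In a
basis adapted to it, the operator is block triangular: the values at the points `xᵢ` give the Cauchy
kernel, and the complementary block is triangular. -/
theorem fredholm_toeplitz (x : ι → K) (hx : Function.Injective x) (τ : K)
    (hτ : ∀ i j, x j - τ * x i ≠ 0) (Q : PowerSeries K)
    (hQ : Q * ∏ i, (1 - PowerSeries.C (x i) * PowerSeries.X) =
      ∏ i, (1 - PowerSeries.C (τ * x i) * PowerSeries.X)) (g : K[X]) (L : ℕ) :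
    fredholm (Matrix.of fun k l : Fin (Fintype.card ι + L) =>
        (toeplitz x τ Q g L (X ^ (l : ℕ))).coeff k) =
      fredholm (Matrix.of fun i j => cauchyKernel x τ i j * g.eval (x j)) *
        ∏ k ∈ Finset.range L, (1 + C (τ ^ (Fintype.card ι + k) * g.coeff 0) * X) := by
  have hm : (∏ i, (X - C (x i))).Monic := monic_prod_of_monic _ _ fun _ _ => monic_X_sub_C _
  set b₁ := degreeLT.basis K (Fintype.card ι + L)
  set b₂ := nodalBasis x hx L
  set f := toeplitzRestrict x τ Q g L
  set Lm : Matrix (Fin L) (Fin L) K := .of fun k l =>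
    (C (τ ^ Fintype.card ι) * ((g * X ^ (l : ℕ)) %ₘ X ^ L).comp (C τ * X)).coeff k
  -- the components of the images of the Lagrange polynomials along the ideal
  choose φ hφ using fun j => exists_eq_interpolate_add x hx
    (toeplitz x τ Q g L (Lagrange.basis Finset.univ x j))
  have hφd : ∀ j, (φ j).degree < L := by
    intro j
    have h1 : (∏ i, (X - C (x i))) * φ j ∈ degreeLT K (Fintype.card ι + L) := by
      rw [← sub_eq_iff_eq_add'.2 (hφ j)]
      refine Submodule.sub_mem _ (toeplitz_mem_degreeLT x τ Q g L _)
        (Submodule.sum_mem _ fun i _ => ?_)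
      rw [← smul_eq_C_mul]
      exact Submodule.smul_mem _ _ (nodalFamily_mem x hx L (.inl i))
    rw [mem_degreeLT, degree_mul, degree_eq_natDegree hm.ne_zero, natDegree_finsetProd_X_sub_C_eq_card, Finset.card_univ,
      Nat.cast_add] at h1
    exact lt_of_add_lt_add_left h1
  -- the matrix in the adapted basis
  set Z : Matrix (ι ⊕ Fin L) (ι ⊕ Fin L) K := Matrix.fromBlocks
    (Matrix.of fun i j => cauchyKernel x τ i j * g.eval (x j)) 0
    (Matrix.of fun (k : Fin L) j => (φ j).coeff k) Lm
  have hZ : f = Matrix.toLin b₂ b₂ Z := by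
    refine b₂.ext fun s => Subtype.ext ?_
    have hcoe : ((f (b₂ s) : degreeLT K (Fintype.card ι + L)) : K[X]) =
      toeplitz x τ Q g L (nodalFamily x L s) := by
      rw [← coe_nodalBasis x hx L s]; rfl
    rw [hcoe, Matrix.toLin_self, Fintype.sum_sum_type, Submodule.coe_add,
      AddSubmonoidClass.coe_finsetSum, AddSubmonoidClass.coe_finsetSum]
    simp only [Submodule.coe_smul]
    simp only [b₂, coe_nodalBasis]
    rcases s with j | l
    · simp only [nodalFamily, Sum.elim_inl, Sum.elim_inr, Z, Matrix.fromBlocks_apply₁₁,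
        Matrix.fromBlocks_apply₂₁, Matrix.of_apply, ← mul_smul_comm, ← Finset.mul_sum]
      rw [← eq_sum_coeff_mul_X_pow (hφd j)]
      conv_lhs => rw [hφ j]
      simp only [eval_toeplitz_basis x hx τ hτ Q hQ, smul_eq_C_mul]
    · simp only [nodalFamily, Sum.elim_inl, Sum.elim_inr, Z, Matrix.fromBlocks_apply₁₂,
        Matrix.fromBlocks_apply₂₂, Matrix.of_apply, ← mul_smul_comm, ← Finset.mul_sum,
        Matrix.zero_apply, zero_smul, Finset.sum_const_zero, zero_add, Lm]
      rw [toeplitz_nodal_mul x τ Q hQ, ← eq_sum_coeff_mul_X_pow]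
      · ring
      · apply degree_comp_C_mul_X_lt
        simpa using degree_modByMonic_lt (g * X ^ (l : ℕ)) (monic_X_pow (R := K) L)
  have hY : (Matrix.of fun k l : Fin (Fintype.card ι + L) =>
      (toeplitz x τ Q g L (X ^ (l : ℕ))).coeff k) = LinearMap.toMatrix b₁ b₁ f := by
    ext k l
    rw [Matrix.of_apply, LinearMap.toMatrix_apply, degreeLT.basis_repr, ← degreeLT.basis_val]
    rfl
  rw [hY, fredholm_toMatrix_eq b₁ b₂, hZ, LinearMap.toMatrix_toLin, fredholm_fromBlocks]
  congr 1
  rw [fredholm_of_lowerTriangular, ← Fin.prod_univ_eq_prod_range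
    (fun k => (1 + C (τ ^ (Fintype.card ι + k) * g.coeff 0) * X))]
  · refine Finset.prod_congr rfl fun k _ => ?_
    simp only [Lm, Matrix.of_apply]
    rw [coeff_C_mul, comp_C_mul_X_coeff, coeff_modByMonic_X_pow _ k.2, coeff_mul_X_pow', if_pos le_rfl,
      Nat.sub_self, pow_add]
    congr 3
    ring
  · intro i j hij
    simp only [Lm, Matrix.of_apply]
    rw [coeff_C_mul, comp_C_mul_X_coeff, coeff_modByMonic_X_pow _ i.2, coeff_mul_X_pow',
      if_neg (not_le.2 (Fin.lt_def.1 hij)), zero_mul, mul_zero]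

end Toeplitz

end Fredholm

section CauchyMinors

open Polynomial

/-! ### Minors of the Cauchy kernel -/

section Minors

variable {K : Type*} [Field K] {ι : Type*} [Fintype ι] [DecidableEq ι]

theorem fredholm_coeff_card {R : Type*} [CommRing R] (M : Matrix ι ι R) :
    (fredholm M).coeff (Fintype.card ι) = M.det := by
  rw [fredholm_coeff, ← Finset.card_univ, Finset.powersetCard_self, Finset.sum_singleton]
  exact Matrix.det_submatrix_equiv_self (Equiv.subtypeUnivEquiv Finset.mem_univ) M

theorem fredholm_map {R S : Type*} [CommRing R] [CommRing S] (φ : R →+* S) (M : Matrix ι ι R) :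
    fredholm (M.map φ) = (fredholm M).map φ := by
  rw [fredholm, fredholm, ← coe_mapRingHom, RingHom.map_det]
  congr 1
  ext i j : 2
  by_cases h : i = j <;> simp [Matrix.one_apply, h]

theorem fredholm_submatrix_equiv {R κ : Type*} [CommRing R] [Fintype κ] [DecidableEq κ]
    (e : κ ≃ ι) (M : Matrix ι ι R) : fredholm (M.submatrix e e) = fredholm M := by
  rw [fredholm, fredholm, ← Matrix.det_submatrix_equiv_self e]
  congr 1
  ext i j : 2
  simp [Matrix.one_apply]

/-- The Cauchy kernel represents, on polynomials of degree less than `n`, an operator which is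
triangular in the monomial basis with diagonal entries `τ^k`: the case `g = 1`, `L = 0` of
`fredholm_toeplitz`. -/
theorem det_cauchyKernel (x : ι → K) (hx : Function.Injective x) (τ : K)
    (hτ : ∀ i j, x j - τ * x i ≠ 0) :
    (cauchyKernel x τ).det = τ ^ (Fintype.card ι).choose 2 := by
  obtain ⟨Q, hQ⟩ := exists_quotient x τ
  have h := congrArg (fun p => p.coeff (Fintype.card ι)) (fredholm_toeplitz x hx τ hτ Q hQ 1 0)
  simp only [eval_one, mul_one, Finset.range_zero, Finset.prod_empty] at h
  have h' : (Matrix.of fun i j => cauchyKernel x τ i j) = cauchyKernel x τ := rfl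
  rw [h', fredholm_coeff_card] at h
  rw [← h]
  have h2 := fredholm_coeff_card (Matrix.of fun k l : Fin (Fintype.card ι + 0) =>
        (toeplitz x τ Q 1 0 (X ^ (l : ℕ))).coeff k)
  have hc : Fintype.card (Fin (Fintype.card ι + 0)) = Fintype.card ι := by simp
  rw [hc] at h2
  rw [h2]
  have hent : ∀ k l : Fin (Fintype.card ι + 0), (toeplitz x τ Q 1 0 (X ^ (l : ℕ))).coeff k =
      if (k : ℕ) ≤ l then PowerSeries.coeff (l - k : ℕ) Q * τ ^ (k : ℕ) else 0 := by
    intro k l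
    have hl : (1 * X ^ (l : ℕ) : K[X]) %ₘ levelPoly x 0 = X ^ (l : ℕ) := by
      rw [one_mul, modByMonic_eq_self_iff (levelPoly_monic x 0),
        degree_eq_natDegree (levelPoly_monic x 0).ne_zero, natDegree_levelPoly, degree_X_pow]
      exact_mod_cast l.2
    rw [toeplitz_apply, hl, comp_C_mul_X_coeff, coeff_contract, ← monomial_one_right_eq_X_pow,
      sum_monomial_index _ _ (by simp), one_mul]
    split_ifs <;> simp
  rw [Matrix.det_of_isUpperTriangular]
  · simp only [Matrix.of_apply, hent, le_refl, if_true, Nat.sub_self,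
      coeff_zero_quotient x τ Q hQ, one_mul]
    rw [Fin.prod_univ_eq_prod_range (fun k => τ ^ k), Finset.prod_pow_eq_pow_sum,
      Finset.sum_range_id, Nat.add_zero, Nat.choose_two_right]
  · intro k l hkl
    have hkl' : l < k := hkl
    rw [Matrix.of_apply, hent, if_neg (not_le.2 (Fin.lt_def.1 hkl'))]

theorem prod_eq_prod_subtype_mul {M : Type*} [CommMonoid M] (s : Finset ι) (f : ι → M) :
    ∏ i, f i = (∏ i : s, f i) * ∏ i ∈ sᶜ, f i := by
  rw [← Finset.prod_mul_prod_compl s f, Finset.prod_coe_sort s f]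

/-- The principal minors of the Cauchy kernel are the coefficients of Macdonald's operators, because
a principal submatrix is again a Cauchy kernel with rescaled columns. -/
theorem det_cauchyKernel_submatrix (x : ι → K) (hx : Function.Injective x) (τ : K)
    (hτ : ∀ i j, x j - τ * x i ≠ 0) (s : Finset ι) :
    ((cauchyKernel x τ).submatrix (Subtype.val : s → ι) (Subtype.val : s → ι)).det =
      τ ^ s.card.choose 2 * ∏ j ∈ s, ∏ i ∈ sᶜ, (x j - τ * x i) / (x j - x i) := by
  have h : (cauchyKernel x τ).submatrix (Subtype.val : s → ι) (Subtype.val : s → ι) =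
      Matrix.of fun i j : s => (∏ i ∈ sᶜ, (x j - τ * x i) / (x j - x i)) *
        cauchyKernel (fun i : s => x i) τ i j := by
    ext i j
    simp only [Matrix.submatrix_apply, cauchyKernel, Matrix.of_apply, Finset.prod_div_distrib]
    rw [prod_eq_prod_subtype_mul s (fun k => x j - τ * x k)]
    have h2 : ∏ k ∈ Finset.univ.erase (j : ι), (x j - x k) =
        (∏ k ∈ (Finset.univ : Finset s).erase j, (x j - x k)) * ∏ k ∈ sᶜ, (x j - x k) := by
      have hd : Finset.univ.erase (j : ι) = s.erase j ∪ sᶜ := by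
        ext k
        by_cases hk : k ∈ s
        · simp [hk]
        · simp [hk]; rintro rfl; exact hk j.2
      rw [hd, Finset.prod_union]
      · congr 1
        refine (Finset.prod_nbij (Subtype.val) ?_ ?_ ?_ fun _ _ => rfl).symm
        · intro k hk
          exact Finset.mem_erase.2 ⟨fun h => Finset.ne_of_mem_erase hk (Subtype.ext h), k.2⟩
        · exact Subtype.val_injective.injOn
        · intro k hk
          simp only [Finset.coe_erase, Set.mem_diff, Finset.mem_coe, Set.mem_singleton_iff] at hk
          exact ⟨⟨k, hk.1⟩, by simpa [Subtype.ext_iff] using hk.2, rfl⟩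
      · exact Finset.disjoint_of_subset_left (Finset.erase_subset _ _) disjoint_compl_right
    rw [h2, mul_div_mul_comm]
    ring
  rw [h, Matrix.det_mul_row, det_cauchyKernel (fun i : s => x i)
    (hx.comp Subtype.val_injective) τ fun i j => hτ i j, Fintype.card_coe, mul_comm]
  congr 1
  exact Finset.prod_coe_sort s fun j => ∏ i ∈ sᶜ, (x j - τ * x i) / (x j - x i)

theorem fredholm_cauchyKernel_coeff (x : ι → K) (hx : Function.Injective x) (τ : K)
    (hτ : ∀ i j, x j - τ * x i ≠ 0) (y : ι → K) (k : ℕ) :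
    (fredholm (Matrix.of fun i j => cauchyKernel x τ i j * y j)).coeff k =
      ∑ s ∈ Finset.univ.powersetCard k, τ ^ k.choose 2 *
        (∏ j ∈ s, ∏ i ∈ sᶜ, (x j - τ * x i) / (x j - x i)) * ∏ j ∈ s, y j := by
  rw [fredholm_coeff]
  refine Finset.sum_congr rfl fun s hs => ?_
  have h : (Matrix.of fun i j => cauchyKernel x τ i j * y j).submatrix (Subtype.val : s → ι)
      (Subtype.val : s → ι) = Matrix.of fun i j : s => y j *
        ((cauchyKernel x τ).submatrix (Subtype.val : s → ι) (Subtype.val : s → ι)) i j := by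
    ext i j
    exact mul_comm _ _
  rw [h, Matrix.det_mul_row, det_cauchyKernel_submatrix x hx τ hτ, (Finset.mem_powersetCard.1 hs).2,
    mul_comm, Finset.prod_coe_sort s y]

end Minors

/-! ### Limits of sums of minors -/

section Limit

variable {R : Type*} [CommRing R]

/-- The elementary symmetric functions of `1, τ, …, τ^{L-1}` converge to Euler's coefficients
`τ^{s(s-1)/2} / (τ; τ)_s`. -/
theorem pow_dvd_coeff_prod_sub (τ : R) (L s : ℕ) :
    τ ^ L ∣ (∏ k ∈ Finset.range L, (1 + C (τ ^ k) * X)).coeff s *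
      (∏ i ∈ Finset.range s, (1 - τ ^ (i + 1))) - τ ^ s.choose 2 := by
  set P : R[X] := ∏ k ∈ Finset.range L, (1 + C (τ ^ k) * X) with hP
  -- the functional equation of the product, which gives a recursion for its coefficients
  have h1 : (1 + X) * P.comp (C τ * X) = P * (1 + C (τ ^ L) * X) := by
    rw [hP, ← Finset.prod_range_succ, Finset.prod_range_succ', prod_comp, mul_comm]
    simp only [pow_zero, C_1, one_mul, add_comp, mul_comp, C_comp, X_comp, one_comp, pow_succ, C_mul,
      mul_assoc]
  have h2 : ∀ s, P.coeff (s + 1) * (1 - τ ^ (s + 1)) = P.coeff s * (τ ^ s - τ ^ L) := by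
    intro s
    have h := congrArg (fun p => p.coeff (s + 1)) h1
    simp only [add_mul, mul_add, one_mul, mul_one, coeff_add, coeff_X_mul, comp_C_mul_X_coeff] at h
    rw [← mul_assoc, coeff_mul_X, mul_comm P, coeff_C_mul] at h
    linear_combination -h
  induction s with
  | zero =>
    have : P.coeff 0 = 1 := by
      rw [hP, coeff_zero_eq_eval_zero, eval_prod]
      simp
    simp [this]
  | succ s ih =>
    obtain ⟨c, hc⟩ := ih
    rw [Finset.prod_range_succ, Nat.choose_succ_succ' s 1, Nat.choose_one_right, pow_add]
    refine ⟨c * (τ ^ s - τ ^ L) - τ ^ s.choose 2, ?_⟩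
    linear_combination (∏ i ∈ Finset.range s, (1 - τ ^ (i + 1))) * h2 s + (τ ^ s - τ ^ L) * hc

/-- The matrix coefficients `τ^k [w^k] (Q · g w^l)` of the dilated Toeplitz operator. -/
def toeplitzCoeff (τ : R) (Q : PowerSeries R) (g : R[X]) (k l : ℕ) : R :=
  τ ^ k * (contract Q (g * X ^ l)).coeff k

/-- The sum of all `r × r` minors with equal families of row and column indices counts each principal
minor `r!` times, and vanishes on families with a repetition. -/
theorem sum_det_eq_factorial_mul {ι : Type*} [Fintype ι] [DecidableEq ι] (M : Matrix ι ι R)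
    (r : ℕ) : ∑ m : Fin r → ι, (M.submatrix m m).det = r.factorial * (fredholm M).coeff r := by
  rw [fredholm_coeff, Finset.mul_sum, ← Finset.sum_filter_of_ne (p := Function.Injective)]
  swap
  · intro m _ hm i j hij
    by_contra hne
    refine hm (Matrix.det_zero_of_row_eq hne ?_)
    ext k; simp [hij]
  rw [← Finset.sum_fiberwise_of_maps_to (g := fun m : Fin r → ι => Finset.univ.image m)
    (t := Finset.univ.powersetCard r)]
  swap
  · intro m hm
    rw [Finset.mem_powersetCard]
    refine ⟨Finset.subset_univ _, ?_⟩
    rw [Finset.card_image_of_injective _ (Finset.mem_filter.1 hm).2, Finset.card_fin]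
  refine Finset.sum_congr rfl fun s hs => ?_
  have hs' : s.card = r := (Finset.mem_powersetCard.1 hs).2
  have key : ∀ F : (Fin r → ι) → R, ∑ m ∈ (Finset.univ.filter Function.Injective).filter
      (fun m : Fin r → ι => Finset.univ.image m = s), F m =
        ∑ e : Fin r ≃ s, F (Subtype.val ∘ e) := by
    intro F
    refine (Finset.sum_nbij (fun e : Fin r ≃ s => (Subtype.val ∘ e : Fin r → ι)) ?_ ?_ ?_
      fun _ _ => rfl).symm
    · intro e _
      simp only [Finset.mem_filter, Finset.mem_univ, true_and]
      refine ⟨Subtype.val_injective.comp e.injective, ?_⟩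
      ext i
      simp only [Finset.mem_image, Finset.mem_univ, true_and, Function.comp_apply]
      constructor
      · rintro ⟨a, rfl⟩; exact (e a).2
      · intro hi; exact ⟨e.symm ⟨i, hi⟩, by simp⟩
    · intro e _ e' _ h
      ext a
      exact congrFun h a
    · intro m hm
      simp only [Finset.coe_filter, Finset.mem_filter, Finset.mem_univ, true_and,
        Set.mem_ofPred_eq] at hm
      obtain ⟨hm1, hm2⟩ := hm
      have hmem : ∀ a, m a ∈ s := fun a => hm2 ▸ Finset.mem_image_of_mem m (Finset.mem_univ a)
      refine ⟨Equiv.ofBijective (fun a => ⟨m a, hmem a⟩) ⟨?_, ?_⟩, Finset.mem_coe.2 (Finset.mem_univ _), rfl⟩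
      · intro a b hab
        exact hm1 (congrArg Subtype.val hab)
      · rintro ⟨i, hi⟩
        rw [← hm2] at hi
        obtain ⟨a, -, ha⟩ := Finset.mem_image.1 hi
        exact ⟨a, Subtype.ext ha⟩
  rw [key, Finset.sum_congr rfl (g := fun _ => (M.submatrix (Subtype.val : s → ι) Subtype.val).det)]
  · rw [Finset.sum_const, Finset.card_univ, Fintype.card_equiv (Fintype.equivFinOfCardEq
      (by rw [Fintype.card_coe, hs'])).symm, Fintype.card_fin, nsmul_eq_mul]
  · intro e _
    rw [← Matrix.submatrix_submatrix, Matrix.det_submatrix_equiv_self]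

theorem fredholm_fromBlocks_zero {ι κ : Type*} [Fintype ι] [DecidableEq ι] [Fintype κ]
    [DecidableEq κ] (A : Matrix ι ι R) (B : Matrix ι κ R) :
    fredholm (Matrix.fromBlocks A B 0 0) = fredholm A := by
  have h : (1 + (X : R[X]) • (Matrix.fromBlocks A B 0 (0 : Matrix κ κ R)).map C) =
      Matrix.fromBlocks (1 + (X : R[X]) • A.map C) ((X : R[X]) • B.map C) 0 1 := by
    ext i j : 2
    rcases i with i | i <;> rcases j with j | j <;> simp [Matrix.one_apply]
  rw [fredholm, h, Matrix.det_fromBlocks_zero₂₁, Matrix.det_one, mul_one]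
  rfl

/-- The Fredholm determinant of the Toeplitz operator modulo `w^L ∏ (w - xᵢ)` agrees modulo `τ^M`
with the one of the `M × M` truncation, because row `k` is divisible by `τ^k`. -/
theorem pow_dvd_fredholm_sub {ι : Type*} [Fintype ι] [Nontrivial R] (x : ι → R) (τ : R)
    (Q : PowerSeries R) (g : R[X]) (M L r : ℕ) (hL : M + g.natDegree ≤ L) :
    τ ^ M ∣ (fredholm (Matrix.of fun k l : Fin (Fintype.card ι + L) =>
        (toeplitz x τ Q g L (X ^ (l : ℕ))).coeff k)).coeff r -
      (fredholm (Matrix.of fun k l : Fin M => toeplitzCoeff τ Q g k l)).coeff r := by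
  rw [← Ideal.mem_span_singleton, ← Ideal.Quotient.mk_eq_mk_iff_sub_mem, ← coeff_map, ← coeff_map,
    ← fredholm_map, ← fredholm_map]
  set φ := Ideal.Quotient.mk (Ideal.span {τ ^ M})
  have hφ : ∀ k, M ≤ k → φ (τ ^ k) = 0 := by
    intro k hk
    rw [Ideal.Quotient.eq_zero_iff_mem, Ideal.mem_span_singleton]
    exact pow_dvd_pow _ hk
  obtain ⟨N, hN⟩ : ∃ N, M + N = Fintype.card ι + L :=
    ⟨Fintype.card ι + L - M, by omega⟩
  let e : Fin M ⊕ Fin N ≃ Fin (Fintype.card ι + L) := finSumFinEquiv.trans (finCongr hN)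
  have h1 : ∀ k l : Fin (Fintype.card ι + L), M ≤ (k : ℕ) →
      φ ((toeplitz x τ Q g L (X ^ (l : ℕ))).coeff k) = 0 := by
    intro k l hk
    rw [toeplitz_apply, comp_C_mul_X_coeff, map_mul, hφ _ hk, mul_zero]
  have h2 : ∀ i : Fin N, M ≤ (e (.inr i) : ℕ) := by
    intro i; simp [e]
  have h3 : ∀ i : Fin M, (e (.inl i) : ℕ) = i := by
    intro i; simp [e]
  have hm := congrArg (fun p => p.coeff r) (fredholm_fromBlocks_zero
    ((Matrix.of fun k l : Fin M => toeplitzCoeff τ Q g k l).map φ)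
    (Matrix.of fun (k : Fin M) (l : Fin N) =>
      φ ((toeplitz x τ Q g L (X ^ (e (.inr l) : ℕ))).coeff k)))
  rw [← fredholm_submatrix_equiv e]
  refine Eq.trans ?_ hm
  congr 2
  ext i j
  rcases i with i | i
  · rcases j with j | j
    · have hj : (g * X ^ (j : ℕ)) %ₘ levelPoly x L = g * X ^ (j : ℕ) := by
        rw [modByMonic_eq_self_iff (levelPoly_monic x L)]
        refine degree_le_natDegree.trans_lt ?_
        rw [degree_eq_natDegree (levelPoly_monic x L).ne_zero, natDegree_levelPoly]
        have := natDegree_mul_le (p := g) (q := X ^ (j : ℕ))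
        rw [natDegree_X_pow] at this
        have hj := j.2
        exact_mod_cast (by omega : (g * X ^ (j : ℕ)).natDegree < Fintype.card ι + L)
      simp only [Matrix.submatrix_apply, Matrix.map_apply, Matrix.of_apply,
        Matrix.fromBlocks_apply₁₁, h3]
      rw [toeplitz_apply, hj, comp_C_mul_X_coeff, toeplitzCoeff, mul_comm]
    · simp only [Matrix.submatrix_apply, Matrix.map_apply, Matrix.of_apply,
        Matrix.fromBlocks_apply₁₂, h3]
  · rw [Matrix.submatrix_apply, Matrix.map_apply, Matrix.of_apply, h1 _ _ (h2 i)]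
    rcases j with j | j <;> simp

/-- Euler's coefficient `τ^{s(s-1)/2} / (τ; τ)_s`, the elementary symmetric function of degree `s`
in `1, τ, τ², …`. -/
def eulerCoeff {K : Type*} [Field K] (τ : K) (s : ℕ) : K :=
  τ ^ s.choose 2 / ∏ i ∈ Finset.range s, (1 - τ ^ (i + 1))

theorem coeff_prod_one_add_C_mul (L s : ℕ) (τ a : R) :
    (∏ k ∈ Finset.range L, (1 + C (τ ^ k * a) * X)).coeff s =
      a ^ s * (∏ k ∈ Finset.range L, (1 + C (τ ^ k) * X)).coeff s := by
  have h : (∏ k ∈ Finset.range L, (1 + C (τ ^ k * a) * X)) =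
      (∏ k ∈ Finset.range L, (1 + C (τ ^ k) * X)).comp (C a * X) := by
    rw [prod_comp]
    refine Finset.prod_congr rfl fun k _ => ?_
    simp only [add_comp, one_comp, mul_comp, C_comp, X_comp]
    rw [C_mul, mul_assoc]
  rw [h, comp_C_mul_X_coeff, mul_comm]

variable [IsDomain R] {K : Type*} [Field K] [Algebra R K]

/-- The `r`-th Fredholm coefficient of the dilated Toeplitz operator with symbol `Q(z) g(1/z)`, as a
limit of the sums of principal minors of its truncations.

The formula for the Fredholm determinant holds over the field `K`, whereas the limit is taken in the
subring `R`, in which `0` is the only element divisible by all powers of `τ`. The two are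
reconciled by multiplying by the common denominator of the minors of the Cauchy kernel. -/
theorem toeplitz_minors_limit (hinj : Function.Injective (algebraMap R K)) {ι : Type*} [Fintype ι]
    [DecidableEq ι] (τ : R) (hsep : ∀ d : R, (∀ M, τ ^ M ∣ d) → d = 0)
    (hunit : ∀ i, IsUnit (1 - τ ^ (i + 1))) (x : ι → R) (hx : Function.Injective x)
    (hτ : ∀ i j, x j - τ * x i ≠ 0) (Q : PowerSeries R)
    (hQ : Q * ∏ i, (1 - PowerSeries.C (x i) * PowerSeries.X) =
      ∏ i, (1 - PowerSeries.C (τ * x i) * PowerSeries.X)) (g : R[X]) (r : ℕ) (S : R)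
    (hS : ∀ M, τ ^ M ∣ S - ∑ m : Fin r → Fin M,
      (Matrix.of fun i j => toeplitzCoeff τ Q g (m i) (m j)).det) :
    algebraMap R K S = r.factorial * ∑ k ∈ Finset.range (r + 1),
      (∑ s ∈ Finset.univ.powersetCard k, algebraMap R K τ ^ k.choose 2 *
        (∏ j ∈ s, ∏ i ∈ sᶜ, (algebraMap R K (x j) - algebraMap R K τ * algebraMap R K (x i)) /
          (algebraMap R K (x j) - algebraMap R K (x i))) * ∏ j ∈ s, algebraMap R K (g.eval (x j))) *
        ((algebraMap R K τ ^ Fintype.card ι * algebraMap R K (g.coeff 0)) ^ (r - k) *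
          eulerCoeff (algebraMap R K τ) (r - k)) := by
  set φ := algebraMap R K
  have hxK : Function.Injective fun i => φ (x i) := hinj.comp hx
  have hτK : ∀ i j, φ (x j) - φ τ * φ (x i) ≠ 0 := by
    intro i j h
    rw [← map_mul, ← map_sub] at h
    exact hτ i j (hinj (h.trans (map_zero φ).symm))
  have hQK : Q.map φ * ∏ i, (1 - PowerSeries.C (φ (x i)) * PowerSeries.X) =
      ∏ i, (1 - PowerSeries.C (φ τ * φ (x i)) * PowerSeries.X) := by
    have h := congrArg (PowerSeries.map φ) hQ
    simpa only [map_mul, map_prod, map_sub, map_one, PowerSeries.map_C, PowerSeries.map_X] using h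
  -- a common denominator of the principal minors
  set Δ : R := ∏ p ∈ (Finset.univ : Finset ι).offDiag, (x p.1 - x p.2) with hΔ
  have hΔ0 : Δ ≠ 0 := by
    rw [hΔ, Finset.prod_ne_zero_iff]
    intro p hp
    exact sub_ne_zero.2 fun h => (Finset.mem_offDiag.1 hp).2.2 (hx h)
  set f : ℕ → K := fun k => ∑ s ∈ Finset.univ.powersetCard k, φ τ ^ k.choose 2 *
        (∏ j ∈ s, ∏ i ∈ sᶜ, (φ (x j) - φ τ * φ (x i)) / (φ (x j) - φ (x i))) *
          ∏ j ∈ s, φ (g.eval (x j)) with hf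
  have hden : ∀ k, ∃ b : R, φ b = φ Δ * f k := by
    intro k
    have hs : ∀ s : Finset ι, ∃ b : R, φ b = φ Δ *
        ∏ j ∈ s, ∏ i ∈ sᶜ, (φ (x j) - φ τ * φ (x i)) / (φ (x j) - φ (x i)) := by
      intro s
      have hsub : s ×ˢ sᶜ ⊆ (Finset.univ : Finset ι).offDiag := by
        intro p hp
        rw [Finset.mem_product, Finset.mem_compl] at hp
        rw [Finset.mem_offDiag]
        exact ⟨Finset.mem_univ _, Finset.mem_univ _, fun h => hp.2 (h ▸ hp.1)⟩
      refine ⟨(∏ p ∈ (Finset.univ : Finset ι).offDiag \ s ×ˢ sᶜ, (x p.1 - x p.2)) *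
        ∏ p ∈ s ×ˢ sᶜ, (x p.1 - τ * x p.2), ?_⟩
      rw [hΔ, ← Finset.prod_sdiff hsub, ← Finset.prod_product' (f := fun j i =>
        (φ (x j) - φ τ * φ (x i)) / (φ (x j) - φ (x i))), Finset.prod_div_distrib, map_mul, map_mul,
        mul_assoc, map_prod φ _ (s ×ˢ sᶜ), map_prod φ _ (s ×ˢ sᶜ)]
      simp only [map_sub, map_mul]
      rw [mul_div_cancel₀]
      rw [Finset.prod_ne_zero_iff]
      intro p hp
      exact sub_ne_zero.2 fun h => (Finset.mem_offDiag.1 (hsub hp)).2.2 (hxK h)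
    choose b hb using hs
    refine ⟨∑ s ∈ Finset.univ.powersetCard k, τ ^ k.choose 2 * b s * ∏ j ∈ s, g.eval (x j), ?_⟩
    rw [hf, Finset.mul_sum, map_sum]
    refine Finset.sum_congr rfl fun s _ => ?_
    rw [map_mul, map_mul, hb, map_pow, map_prod φ _ s]
    ring
  choose b hb using hden
  have hu : ∀ s, ∃ v : R, (∏ i ∈ Finset.range s, (1 - τ ^ (i + 1))) * v = 1 := by
    intro s
    have : IsUnit (∏ i ∈ Finset.range s, (1 - τ ^ (i + 1))) := by
      rw [IsUnit.prod_iff]; exact fun i _ => hunit i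
    exact this.exists_right_inv
  -- the element `v s` is the inverse of `(τ; τ)_s`
  choose v hv using hu
  have hε : ∀ s, eulerCoeff (φ τ) s = φ (τ ^ s.choose 2 * v s) := by
    intro s
    have h := congrArg φ (hv s)
    rw [map_mul, map_prod, map_one] at h
    simp only [map_sub, map_one, map_pow] at h
    rw [eulerCoeff, div_eq_iff (left_ne_zero_of_mul_eq_one h), map_mul, map_pow]
    linear_combination -φ τ ^ s.choose 2 * h
  set d : R := Δ * S - r.factorial * ∑ k ∈ Finset.range (r + 1),
    b k * ((τ ^ Fintype.card ι * g.coeff 0) ^ (r - k) * (τ ^ (r - k).choose 2 * v (r - k))) with hd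
  have hd0 : d = 0 := by
    refine hsep d fun M => ?_
    -- the level at which the Fredholm determinant agrees with its truncation modulo `τ ^ M`
    set L := M + g.natDegree
    have h1 := pow_dvd_fredholm_sub x τ Q g M L r le_rfl
    set y := (fredholm (Matrix.of fun k l : Fin (Fintype.card ι + L) =>
        (toeplitz x τ Q g L (X ^ (l : ℕ))).coeff k)).coeff r with hy
    have h2 : Δ * y = ∑ k ∈ Finset.range (r + 1), b k *
        ((τ ^ Fintype.card ι * g.coeff 0) ^ (r - k) *
          (∏ j ∈ Finset.range L, (1 + C (τ ^ j) * X)).coeff (r - k)) := by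
      apply hinj
      have hyK : φ y = ∑ k ∈ Finset.range (r + 1), f k * φ ((τ ^ Fintype.card ι * g.coeff 0) ^ (r - k) *
          (∏ j ∈ Finset.range L, (1 + C (τ ^ j) * X)).coeff (r - k)) := by
        have h3 := fredholm_toeplitz (fun i => φ (x i)) hxK (φ τ) hτK (Q.map φ) hQK (g.map φ) L
        have h4 : (Matrix.of fun k l : Fin (Fintype.card ι + L) =>
            (toeplitz (fun i => φ (x i)) (φ τ) (Q.map φ) (g.map φ) L (X ^ (l : ℕ))).coeff k) =
            (Matrix.of fun k l : Fin (Fintype.card ι + L) =>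
              (toeplitz x τ Q g L (X ^ (l : ℕ))).coeff k).map φ := by
          ext k l
          simp only [Matrix.of_apply, Matrix.map_apply]
          rw [toeplitz_apply, toeplitz_apply, comp_C_mul_X_coeff, comp_C_mul_X_coeff, map_mul,
            map_pow, ← coeff_map, map_contract, map_modByMonic _ (levelPoly_monic x L)]
          simp [levelPoly, Polynomial.map_prod]
        rw [h4, fredholm_map] at h3
        have h5 := congrArg (fun p => p.coeff r) h3
        rw [coeff_map, coeff_mul, Finset.Nat.sum_antidiagonal_eq_sum_range_succ_mk] at h5
        rw [hy, h5]
        refine Finset.sum_congr rfl fun k _ => ?_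
        rw [fredholm_cauchyKernel_coeff _ hxK _ hτK]
        congr 1
        · refine Finset.sum_congr rfl fun s _ => ?_
          congr 1
          refine Finset.prod_congr rfl fun j _ => ?_
          rw [eval_map, eval₂_at_apply]
        · have h6 : (∏ k ∈ Finset.range L, (1 + C (φ τ ^ (Fintype.card ι + k) * (g.map φ).coeff 0) * X))
              = (∏ k ∈ Finset.range L, (1 + C (τ ^ k * (τ ^ Fintype.card ι * g.coeff 0)) * X)).map φ := by
            rw [Polynomial.map_prod]
            refine Finset.prod_congr rfl fun k _ => ?_
            simp [pow_add]
            ring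
          rw [h6, coeff_map, coeff_prod_one_add_C_mul]
      rw [map_mul, hyK, Finset.mul_sum, map_sum]
      refine Finset.sum_congr rfl fun k _ => ?_
      rw [map_mul φ (b k), hb, mul_assoc]
    have h3 : ∀ k, τ ^ M ∣ (∏ j ∈ Finset.range L, (1 + C (τ ^ j) * X)).coeff (r - k) -
        τ ^ (r - k).choose 2 * v (r - k) := by
      intro k
      refine (pow_dvd_pow τ (Nat.le_add_right M g.natDegree)).trans ?_
      obtain ⟨c, hc⟩ := pow_dvd_coeff_prod_sub τ L (r - k)
      refine ⟨c * v (r - k), ?_⟩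
      have := hv (r - k)
      linear_combination v (r - k) * hc - (∏ j ∈ Finset.range L, (1 + C (τ ^ j) * X)).coeff (r - k) * this
    have h4 : τ ^ M ∣ S - r.factorial * y := by
      have h5 := hS M
      have h6 := sum_det_eq_factorial_mul
        (Matrix.of fun k l : Fin M => toeplitzCoeff τ Q g k l) r
      have h7 : ∀ m : Fin r → Fin M, (Matrix.of fun k l : Fin M => toeplitzCoeff τ Q g k l).submatrix m m
        = Matrix.of fun i j => toeplitzCoeff τ Q g (m i) (m j) := fun m => rfl
      simp only [h7] at h6
      rw [h6] at h5
      have := dvd_sub h5 (h1.mul_left (r.factorial : R))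
      convert this using 1
      ring
    have h5 : d = Δ * (S - r.factorial * y) + r.factorial * ∑ k ∈ Finset.range (r + 1),
        b k * (τ ^ Fintype.card ι * g.coeff 0) ^ (r - k) *
          ((∏ j ∈ Finset.range L, (1 + C (τ ^ j) * X)).coeff (r - k) -
            τ ^ (r - k).choose 2 * v (r - k)) := by
      have h6 : Δ * (r.factorial * y) = r.factorial * (Δ * y) := by ring
      rw [hd, mul_sub Δ, h6, h2]
      simp only [mul_sub, Finset.sum_sub_distrib, mul_assoc]
      ring
    rw [h5]
    exact dvd_add (h4.mul_left _) ((Finset.dvd_sum fun k _ => (h3 k).mul_left _).mul_left _)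
  have hΔK : φ Δ ≠ 0 := fun h => hΔ0 (hinj (h.trans (map_zero φ).symm))
  apply mul_left_cancel₀ hΔK
  have h := congrArg φ (sub_eq_zero.1 (hd.symm.trans hd0))
  rw [map_mul] at h
  rw [h, map_mul, map_natCast, mul_left_comm (φ Δ), map_sum]
  congr 1
  rw [Finset.mul_sum]
  refine Finset.sum_congr rfl fun k _ => ?_
  rw [map_mul, hb, map_mul, ← hε, mul_assoc]
  simp only [map_pow, map_mul, hf]

end Limit

end CauchyMinors

/-! ### Sums over the solutions of a cyclic difference equation -/

section Solutions

theorem hasSum_pi_fin {F κ : Type} [CommRing F] [UniformSpace F] [IsUniformAddGroup F]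
    [NonarchimedeanRing F] : ∀ {n : ℕ} {f : Fin n → κ → F} {a : Fin n → F}
    (_ : ∀ i, HasSum (f i) (a i)), HasSum (fun m : Fin n → κ => ∏ i, f i (m i)) (∏ i, a i)
  | 0, f, a, h => by
    have := hasSum_unique (fun m : Fin 0 → κ => ∏ i, f i (m i))
    simpa using this
  | n + 1, f, a, h => by
    have h1 := (h 0).mul_of_nonarchimedean (hasSum_pi_fin fun i : Fin n => h i.succ)
    rw [Fin.prod_univ_succ, ← (Fin.consEquiv fun _ : Fin (n + 1) => κ).hasSum_iff]
    convert h1 using 2 with x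
    simp [Fin.prod_univ_succ, Fin.consEquiv]

/-- In a nonarchimedean ring, finite products of sums may be expanded. -/
theorem hasSum_pi {F κ ι : Type} [CommRing F] [UniformSpace F] [IsUniformAddGroup F]
    [NonarchimedeanRing F] [Fintype ι] {f : ι → κ → F} {a : ι → F}
    (h : ∀ i, HasSum (f i) (a i)) : HasSum (fun m : ι → κ => ∏ i, f i (m i)) (∏ i, a i) := by
  let e := Fintype.equivFin ι
  have h1 := hasSum_pi_fin fun i : Fin (Fintype.card ι) => h (e.symm i)
  rw [e.symm.prod_comp a] at h1
  rw [← (Equiv.arrowCongr e (Equiv.refl κ)).symm.hasSum_iff]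
  convert h1 using 2 with m
  rw [Function.comp_apply, ← e.symm.prod_comp]
  simp [Equiv.arrowCongr]

/-- The equations `m_j - m_{σ⁻¹ j} = c_j`. -/
def IsSolution {r : ℕ} (σ : Equiv.Perm (Fin r)) (c : Fin r → ℤ) (m : Fin r → ℕ) : Prop :=
  ∀ j, (m j : ℤ) - m (σ⁻¹ j) = c j

theorem eq_of_sameCycle {ι β : Type*} {σ : Equiv.Perm ι} {f : ι → β} (h : ∀ j, f (σ⁻¹ j) = f j)
    {i j : ι} (hij : σ.SameCycle i j) : f i = f j := by
  obtain ⟨k, rfl⟩ := hij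
  have h' : ∀ i, f (σ i) = f i := fun i => by rw [← h (σ i)]; simp
  induction k using Int.induction_on generalizing i with
  | zero => simp
  | succ k ih => rw [zpow_add_one, Equiv.Perm.mul_apply, ← ih, h']
  | pred k ih => rw [zpow_sub_one, Equiv.Perm.mul_apply, ← ih, h]

/-- The smallest value of `m` on the cycle of `i`. -/
def cycleMin {r : ℕ} (σ : Equiv.Perm (Fin r)) (m : Fin r → ℕ) (i : Fin r) : ℕ :=
  sInf {n | ∃ j, σ.SameCycle i j ∧ m j = n}

theorem cycleMin_le {r : ℕ} (σ : Equiv.Perm (Fin r)) (m : Fin r → ℕ) (i : Fin r) :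
    cycleMin σ m i ≤ m i := Nat.sInf_le ⟨i, .refl _ _, rfl⟩

theorem exists_eq_cycleMin {r : ℕ} (σ : Equiv.Perm (Fin r)) (m : Fin r → ℕ) (i : Fin r) :
    ∃ j, σ.SameCycle i j ∧ m j = cycleMin σ m i :=
  Nat.sInf_mem (s := {n | ∃ j, σ.SameCycle i j ∧ m j = n}) ⟨m i, i, .refl _ _, rfl⟩

theorem cycleMin_congr {r : ℕ} (σ : Equiv.Perm (Fin r)) (m : Fin r → ℕ) {i j : Fin r}
    (h : σ.SameCycle i j) : cycleMin σ m i = cycleMin σ m j := by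
  unfold cycleMin
  congr 1
  ext n
  exact ⟨fun ⟨k, hk, e⟩ => ⟨k, h.symm.trans hk, e⟩, fun ⟨k, hk, e⟩ => ⟨k, h.trans hk, e⟩⟩

theorem sameCycle_inv_apply {ι : Type*} (σ : Equiv.Perm ι) (j : ι) : σ.SameCycle (σ⁻¹ j) j :=
  ⟨1, by simp⟩

/-- The solutions differ by functions which are constant on the cycles of `σ`; subtracting the
minimum on each cycle from one solution leaves the smallest solution. -/
theorem exists_solution_param {r : ℕ} (σ : Equiv.Perm (Fin r)) (c : Fin r → ℤ) (m₁ : Fin r → ℕ)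
    (h₁ : IsSolution σ c m₁) :
    ∃ (m₀ : Fin r → ℕ) (e : (Quotient (Equiv.Perm.SameCycle.setoid σ) → ℕ) ≃ {m // IsSolution σ c m}),
      ∀ n i, (e n).1 i = m₀ i + n (Quotient.mk _ i) := by
  set m₀ : Fin r → ℕ := fun i => m₁ i - cycleMin σ m₁ i with hm₀
  have h₀ : ∀ i, (m₀ i : ℤ) = m₁ i - cycleMin σ m₁ i := fun i => Nat.cast_sub (cycleMin_le σ m₁ i)
  have hmk : ∀ j, (Quotient.mk (Equiv.Perm.SameCycle.setoid σ) (σ⁻¹ j)) = Quotient.mk _ j :=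
    fun j => Quotient.sound (sameCycle_inv_apply σ j)
  have hsol : ∀ n : Quotient (Equiv.Perm.SameCycle.setoid σ) → ℕ,
      IsSolution σ c fun i => m₀ i + n (Quotient.mk _ i) := by
    intro n j
    have := h₁ j
    simp only [Nat.cast_add, h₀, hmk, cycleMin_congr σ m₁ (sameCycle_inv_apply σ j)]
    linarith
  refine ⟨m₀, Equiv.ofBijective (fun n => ⟨_, hsol n⟩) ⟨?_, ?_⟩, fun n i => rfl⟩
  · intro n n' h
    ext o
    induction o using Quotient.ind with
    | _ i =>
      have := congrFun (congrArg Subtype.val h) i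
      simpa using this
  · rintro ⟨m, hm⟩
    have hD : ∀ i j, σ.SameCycle i j → (m i : ℤ) - m₀ i = m j - m₀ j := by
      intro i j hij
      refine eq_of_sameCycle (f := fun i => (m i : ℤ) - m₀ i) (fun j => ?_) hij
      have h2 := hm j
      have h3 := h₁ j
      simp only [h₀, cycleMin_congr σ m₁ (sameCycle_inv_apply σ j)]
      linarith
    have hge : ∀ i, m₀ i ≤ m i := by
      intro i
      obtain ⟨j, hj, e⟩ := exists_eq_cycleMin σ m₁ i
      have h2 := hD i j hj
      have h3 : m₀ j = 0 := by simp [hm₀, e, cycleMin_congr σ m₁ hj]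
      rw [h3] at h2
      have : (0 : ℤ) ≤ m j := by positivity
      push_cast at h2
      omega
    refine ⟨Quotient.lift (fun i => m i - m₀ i) fun i j hij => ?_, Subtype.ext ?_⟩
    · have h2 := hD i j hij
      have h3 := hge i
      have h4 := hge j
      omega
    · ext i
      have h3 := hge i
      simp only [Quotient.lift_mk]
      omega

/-- A family of geometric series, one for each cycle of `σ`. -/
theorem summable_solutions {F : Type} [Field F] [UniformSpace F] [IsUniformAddGroup F]
    [NonarchimedeanRing F] (τ : F) (hτ : ∀ a, 1 ≤ a → HasSum (fun n : ℕ => (τ ^ a) ^ n) (1 - τ ^ a)⁻¹)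
    {r : ℕ} (σ : Equiv.Perm (Fin r)) (c : Fin r → ℤ) :
    Summable fun m : {m // IsSolution σ c m} => τ ^ ∑ i, m.1 i := by
  classical
  by_cases h : ∃ m, IsSolution σ c m
  · obtain ⟨m₁, h₁⟩ := h
    obtain ⟨m₀, e, he⟩ := exists_solution_param σ c m₁ h₁
    rw [← e.summable_iff]
    have h2 := hasSum_pi (ι := Quotient (Equiv.Perm.SameCycle.setoid σ))
      fun o => hτ (Finset.univ.filter fun i => Quotient.mk _ i = o).card (by
        induction o using Quotient.ind with
        | _ i => exact Finset.card_pos.2 ⟨i, by simp⟩)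
    refine (h2.mul_left (τ ^ ∑ i, m₀ i)).summable.congr fun n => ?_
    simp only [Function.comp_apply, he, Finset.sum_add_distrib, pow_add]
    congr 1
    rw [← Finset.prod_pow_eq_pow_sum, ← Finset.prod_fiberwise Finset.univ
      (fun i => Quotient.mk (Equiv.Perm.SameCycle.setoid σ) i)]
    refine Finset.prod_congr rfl fun o _ => ?_
    rw [Finset.prod_congr rfl (g := fun _ => τ ^ n o), Finset.prod_const, ← pow_mul, ← pow_mul,
      mul_comm]
    intro i hi
    rw [(Finset.mem_filter.1 hi).2]
  · have : IsEmpty {m // IsSolution σ c m} := ⟨fun m => h ⟨m.1, m.2⟩⟩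
    exact summable_empty

end Solutions

/-! ### The entries of the determinant -/

section Entries

variable {r : ℕ}

/-- The exponent of `z_i^m z_{σ i}^{-m-1}`. -/
def entryExponent (σ : Equiv.Perm (Fin r)) (i : Fin r) (m : ℕ) : Fin r → ℤ :=
  Pi.single i (m : ℤ) - Pi.single (σ i) ((m : ℤ) + 1)

theorem sum_entryExponent (σ : Equiv.Perm (Fin r)) (m : Fin r → ℕ) (j : Fin r) :
    (∑ i, entryExponent σ i (m i)) j = m j - m (σ⁻¹ j) - 1 := by
  simp only [entryExponent, Finset.sum_apply, Pi.sub_apply, Finset.sum_sub_distrib, Pi.single_apply]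
  rw [Finset.sum_ite_eq, if_pos (Finset.mem_univ _)]
  have : ∀ i, (j = σ i) = (i = σ⁻¹ j) := fun i => by
    rw [eq_iff_iff, Equiv.Perm.eq_inv_iff_eq, eq_comm]
  simp only [this]
  rw [Finset.sum_ite_eq', if_pos (Finset.mem_univ _)]
  ring

/-- The coefficients of the matrix entry at `(σ i, i)`, with the diagonal entries expanded as the
geometric series `∑ t⁻ⁿ zᵢ⁻¹`. -/
def entryWeight (σ : Equiv.Perm (Fin r)) (i : Fin r) (k : Fin r → ℤ) (n : ℕ) : 𝔽 :=
  open Classical in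
  if σ i = i then if k = Pi.single i (-1) then (t⁻¹) ^ n else 0
  else if n = 0 then entryCoeff (σ i) i k else 0

theorem entryCoeff_entryExponent (σ : Equiv.Perm (Fin r)) (i : Fin r) (h : σ i ≠ i) (m : ℕ) :
    entryCoeff (σ i) i (entryExponent σ i m) = (t⁻¹) ^ m := by
  have h1 : entryExponent σ i m i = m := by
    simp [entryExponent, Pi.single_apply, h.symm]
  rw [entryCoeff, if_neg h, h1, if_pos ⟨by positivity, rfl⟩]
  simp

theorem eq_entryExponent (σ : Equiv.Perm (Fin r)) (i : Fin r) (h : σ i ≠ i) (k : Fin r → ℤ)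
    (hk : entryCoeff (σ i) i k ≠ 0) : k = entryExponent σ i (k i).toNat := by
  rw [entryCoeff, if_neg h] at hk
  split_ifs at hk with h'
  · rw [entryExponent, Int.toNat_of_nonneg h'.1]
    exact h'.2
  · exact absurd rfl hk

theorem entryExponent_fixed (σ : Equiv.Perm (Fin r)) (i : Fin r) (h : σ i = i) (m : ℕ) :
    entryExponent σ i m = Pi.single i (-1) := by
  rw [entryExponent, h, ← Pi.single_sub]
  congr 1
  ring

theorem sum_entryExponent_of_isSolution (σ : Equiv.Perm (Fin r)) (e : Fin r → ℤ) (m : Fin r → ℕ)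
    (hm : IsSolution σ (fun j => e j + 1) m) : ∑ i, entryExponent σ i (m i) = e := by
  ext j
  rw [sum_entryExponent, hm j]
  ring

/-- A solution of the equations `m_j - m_{σ⁻¹ j} = e_j + 1`, as a family of exponents together with
the summation indices of the expanded diagonal entries. -/
def solutionFamily (σ : Equiv.Perm (Fin r)) (e : Fin r → ℤ)
    (m : {m // IsSolution σ (fun j => e j + 1) m}) : ExponentFamily e × (Fin r → ℕ) :=
  (⟨fun i => entryExponent σ i (m.1 i), sum_entryExponent_of_isSolution σ e m.1 m.2⟩,
    fun i => if σ i = i then m.1 i else 0)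

theorem solutionFamily_injective (σ : Equiv.Perm (Fin r)) (e : Fin r → ℤ) :
    Function.Injective (solutionFamily σ e) := by
  intro m m' hm
  ext i
  by_cases hσ : σ i = i
  · have := congrFun (congrArg Prod.snd hm) i
    simpa only [solutionFamily, if_pos hσ] using this
  · have := congrFun (congrFun (congrArg (fun p => p.1.1) hm) i) i
    simpa [solutionFamily, entryExponent, Pi.single_apply, Ne.symm hσ] using this

theorem prod_entryWeight_solutionFamily (σ : Equiv.Perm (Fin r)) (e : Fin r → ℤ)
    (m : {m // IsSolution σ (fun j => e j + 1) m}) :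
    ∏ i, entryWeight σ i ((solutionFamily σ e m).1.1 i) ((solutionFamily σ e m).2 i) =
      (t⁻¹ : 𝔽) ^ ∑ i, m.1 i := by
  rw [← Finset.prod_pow_eq_pow_sum]
  refine Finset.prod_congr rfl fun i _ => ?_
  by_cases hσ : σ i = i
  · simp only [entryWeight, solutionFamily, if_pos hσ, entryExponent_fixed σ i hσ, if_true]
  · simp only [entryWeight, solutionFamily, if_neg hσ, if_true, entryCoeff_entryExponent σ i hσ]

theorem mem_range_solutionFamily (σ : Equiv.Perm (Fin r)) (e : Fin r → ℤ)
    (p : ExponentFamily e × (Fin r → ℕ)) (hp : ∀ i, entryWeight σ i (p.1.1 i) (p.2 i) ≠ 0) :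
    p ∈ Set.range (solutionFamily σ e) := by
  obtain ⟨⟨k, hk⟩, n⟩ := p
  set m : Fin r → ℕ := fun i => if σ i = i then n i else (k i i).toNat with hm
  have h1 : ∀ i, k i = entryExponent σ i (m i) := by
    intro i
    have := hp i
    by_cases hσ : σ i = i
    · rw [entryExponent_fixed σ i hσ]
      by_contra hk
      exact this (by simp only [entryWeight, if_pos hσ, if_neg hk])
    · simp only [hm, if_neg hσ]
      refine eq_entryExponent σ i hσ _ fun h0 => this ?_
      simp only [entryWeight, if_neg hσ, h0, ite_self]
  have h2 : ∀ i, n i = if σ i = i then m i else 0 := by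
    intro i
    have := hp i
    by_cases hσ : σ i = i
    · simp only [hm, if_pos hσ]
    · rw [if_neg hσ]
      by_contra hk
      exact this (by simp only [entryWeight, if_neg hσ, if_neg hk])
  have h3 : IsSolution σ (fun j => e j + 1) m := by
    intro j
    have h4 := congrFun hk j
    simp only [h1] at h4
    rw [sum_entryExponent] at h4
    linarith
  exact ⟨⟨m, h3⟩, Prod.ext (Subtype.ext (funext fun i => (h1 i).symm)) (funext fun i => (h2 i).symm)⟩

variable [UniformSpace 𝔽] [IsUniformAddGroup 𝔽] [NonarchimedeanRing 𝔽]

theorem hasSum_entryWeight (h : HasSum (fun n : ℕ => (t⁻¹ : 𝔽) ^ n) (1 - t⁻¹)⁻¹)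
    (σ : Equiv.Perm (Fin r)) (i : Fin r) (k : Fin r → ℤ) :
    HasSum (entryWeight σ i k) (entryCoeff (σ i) i k) := by
  by_cases hσ : σ i = i
  · have h1 : entryCoeff (σ i) i k = if k = Pi.single i (-1) then (1 - t⁻¹)⁻¹ else 0 := by
      rw [entryCoeff, if_pos hσ, hσ]
    rw [h1]
    by_cases hk : k = Pi.single i (-1)
    · have h2 : entryWeight σ i k = fun n : ℕ => (t⁻¹ : 𝔽) ^ n := by
        ext n
        simp only [entryWeight, if_pos hσ, if_pos hk]
      rwa [if_pos hk, h2]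
    · have h2 : entryWeight σ i k = fun _ : ℕ => (0 : 𝔽) := by
        ext n
        simp only [entryWeight, if_pos hσ, if_neg hk]
      rw [if_neg hk, h2]
      exact hasSum_zero
  · convert hasSum_ite_eq 0 (entryCoeff (σ i) i k) using 2 with n
    simp [entryWeight, hσ]

/-- The coefficients of the products in the Leibniz formula, as sums over the solutions of the
equations `m_j - m_{σ⁻¹ j} = e_j + 1`. -/
theorem hasSum_permTerm [T2Space 𝔽] (h : HasSum (fun n : ℕ => (t⁻¹ : 𝔽) ^ n) (1 - t⁻¹)⁻¹)
    (σ : Equiv.Perm (Fin r)) (e : Fin r → ℤ) (a : 𝔽)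
    (ha : HasSum (fun m : {m // IsSolution σ (fun j => e j + 1) m} => (t⁻¹ : 𝔽) ^ ∑ i, m.1 i) a) :
    HasSum (permTerm σ e) a := by
  have hWa : HasSum (fun p : ExponentFamily e × (Fin r → ℕ) =>
      ∏ i, entryWeight σ i (p.1.1 i) (p.2 i)) a := by
    rw [← (solutionFamily_injective σ e).hasSum_iff]
    · have h1 := funext (prod_entryWeight_solutionFamily σ e)
      rw [← h1] at ha
      exact ha
    · intro p hp
      by_contra hne
      exact hp (mem_range_solutionFamily σ e p fun i h0 =>
        hne (Finset.prod_eq_zero (Finset.mem_univ i) h0))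
  have hfib : ∀ k : ExponentFamily e, HasSum (fun n : Fin r → ℕ =>
      ∏ i, entryWeight σ i (k.1 i) (n i)) (permTerm σ e k) := by
    intro k
    exact hasSum_pi fun i => hasSum_entryWeight h σ i (k.1 i)
  exact HasSum.prod_fiberwise hWa hfib

end Entries

section PlaceAtInfinity

open WithZero

/-! ### The place `t = ∞` -/

/-- `ℂ(q)(t)` as a valued field, for the place `t = ∞`. -/
@[reducible] def tInvValued : Valued 𝔽 ℤᵐ⁰ :=
  open Classical in RatFunc.inftyValued (RatFunc ℂ)

/-- The valuation of `ℂ(q)(t)` at `t = ∞`. -/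
def vInf : Valuation 𝔽 ℤᵐ⁰ := tInvValued.v

/-- The additive subgroup `t^{-M} O`, where `O` is the valuation ring of the place `t = ∞`. -/
def tInvPow (M : ℕ) : AddSubgroup 𝔽 where
  carrier := {y | vInf y ≤ exp (-(M : ℤ))}
  zero_mem' := by simp
  add_mem' := fun ha hb => vInf.map_add_le ha hb
  neg_mem' := fun {a} ha => by simpa [Valuation.map_neg] using ha

theorem mem_tInvPow {M : ℕ} {y : 𝔽} : y ∈ tInvPow M ↔ vInf y ≤ exp (-(M : ℤ)) := Iff.rfl

theorem vInf_t_inv : vInf (t⁻¹ : 𝔽) = exp (-1 : ℤ) := by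
  classical
  have h : vInf t = exp (1 : ℤ) := by
    change RatFunc.inftyValuation (RatFunc ℂ) RatFunc.X = exp 1
    exact RatFunc.inftyValuation.X _
  exact (map_inv₀ vInf t).trans (by rw [h, exp_neg])

theorem vInf_t_inv_pow (M : ℕ) : vInf ((t⁻¹ : 𝔽) ^ M) = exp (-(M : ℤ)) := by
  rw [map_pow, vInf_t_inv, ← exp_nsmul]
  simp

theorem mem_nhds_tInv {s : Set 𝔽} {x : 𝔽} :
    s ∈ @nhds 𝔽 tInvTopology x ↔ ∃ M : ℕ, {y | y - x ∈ tInvPow M} ⊆ s := by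
  refine (@Valued.mem_nhds 𝔽 _ _ _ tInvValued s x).trans ?_
  constructor
  · rintro ⟨γ, hγ⟩
    have hγ0 : (MonoidWithZeroHom.ValueGroup₀.embedding γ.1 : ℤᵐ⁰) ≠ 0 := by
      simp
    refine ⟨(1 - log (MonoidWithZeroHom.ValueGroup₀.embedding γ.1 : ℤᵐ⁰)).toNat, fun y hy => hγ ?_⟩
    rw [Set.mem_ofPred_eq, Valuation.restrict_lt_iff_lt_embedding]
    refine lt_of_le_of_lt (mem_tInvPow.1 hy) ?_
    rw [← exp_log hγ0, exp_lt_exp, log_exp]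
    omega
  · rintro ⟨M, hM⟩
    have h0 : tInvValued.v.restrict ((t⁻¹ : 𝔽) ^ M) ≠ 0 := by
      rw [map_pow]
      refine pow_ne_zero _ ((Valuation.ne_zero_iff _).2 fun h => ?_)
      exact absurd ((inv_eq_zero (a := (RatFunc.X : 𝔽))).1 h) RatFunc.X_ne_zero
    refine ⟨Units.mk0 _ h0, fun y hy => hM ?_⟩
    rw [Set.mem_ofPred_eq, Units.val_mk0, Valuation.restrict_lt_iff] at hy
    exact (hy.trans_eq (vInf_t_inv_pow M)).le

theorem t_inv_pow_mem_tInvPow {M k : ℕ} (h : M ≤ k) : (t⁻¹ : 𝔽) ^ k ∈ tInvPow M := by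
  rw [mem_tInvPow, vInf_t_inv_pow, exp_le_exp]
  omega

theorem mul_mem_tInvPow {M : ℕ} {a b : 𝔽} (ha : a ∈ tInvPow M) (hb : b ∈ tInvPow 0) :
    a * b ∈ tInvPow M := by
  rw [mem_tInvPow] at *
  rw [map_mul]
  simpa using mul_le_mul' ha hb

theorem vInf_one_sub {a : ℕ} (ha : 1 ≤ a) : vInf (1 - (t⁻¹ : 𝔽) ^ a) = 1 := by
  refine vInf.map_one_sub_of_lt ?_
  rw [vInf_t_inv_pow, ← exp_zero, exp_lt_exp]
  omega

theorem inv_one_sub_sub_geom_sum {F : Type*} [Field F] {x : F} (h : 1 - x ≠ 0) (M : ℕ) :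
    (1 - x)⁻¹ - ∑ i ∈ Finset.range M, x ^ i = x ^ M * (1 - x)⁻¹ := by
  have h1 := mul_neg_geom_sum x M
  rw [eq_mul_inv_iff_mul_eq₀ h, sub_mul, inv_mul_cancel₀ h, mul_comm, h1]
  ring

section Topology

attribute [local instance] tInvValued

instance nonarchimedeanRing_tInv : NonarchimedeanRing 𝔽 where
  is_nonarchimedean U hU := by
    obtain ⟨M, hM⟩ := mem_nhds_tInv.1 hU
    have hM' : (tInvPow M : Set 𝔽) ⊆ U := fun y hy => hM (by simpa using hy)
    refine ⟨⟨tInvPow M, AddSubgroup.isOpen_of_mem_nhds (g := 0) _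
      (mem_nhds_tInv.2 ⟨M, fun y hy => ?_⟩)⟩, hM'⟩
    simpa using hy

/-- The subgroups `tInvPow M` are closed. -/
theorem sub_sum_mem_tInvPow {ι : Type*} {f : ι → 𝔽} {a : 𝔽} (h : HasSum f a) {M : ℕ}
    (T : Finset ι) (hT : ∀ i ∉ T, f i ∈ tInvPow M) : a - ∑ i ∈ T, f i ∈ tInvPow M := by
  classical
  have h1 : {y | y - a ∈ tInvPow M} ∈ nhds a := mem_nhds_tInv.2 ⟨M, subset_rfl⟩
  have h0 : Filter.Tendsto (fun s : Finset ι => ∑ i ∈ s, f i) Filter.atTop (nhds a) := by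
    simpa [HasSum] using h
  obtain ⟨S, hS⟩ := Filter.mem_atTop_sets.1 (Filter.mem_map.1 (h0 h1))
  have h2 := hS (S ∪ T) Finset.subset_union_left
  have h3 : ∑ i ∈ (S ∪ T) \ T, f i ∈ tInvPow M :=
    sum_mem fun i hi => hT i (Finset.mem_sdiff.1 hi).2
  have h4 := Finset.sum_sdiff (f := f) (Finset.subset_union_right : T ⊆ S ∪ T)
  have h5 : a - ∑ i ∈ T, f i = -(∑ i ∈ S ∪ T, f i - a) + ∑ i ∈ (S ∪ T) \ T, f i := by
    rw [← h4]; ring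
  rw [h5]
  exact add_mem (neg_mem h2) h3

theorem hasSum_of_forall_tInvPow {ι : Type*} {f : ι → 𝔽} {a : 𝔽}
    (h : ∀ M, ∃ T : Finset ι, (∀ i ∉ T, f i ∈ tInvPow M) ∧ a - ∑ i ∈ T, f i ∈ tInvPow M) :
    HasSum f a := by
  classical
  rw [HasSum]
  simp only [SummationFilter.unconditional_filter]
  intro s hs
  obtain ⟨M, hM⟩ := mem_nhds_tInv.1 hs
  obtain ⟨T, hT, hT'⟩ := h M
  refine Filter.mem_map.2 (Filter.mem_atTop_sets.2 ⟨T, fun S hS => hM ?_⟩)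
  have h4 := Finset.sum_sdiff (f := f) hS
  have h5 : ∑ i ∈ S, f i - a = -(a - ∑ i ∈ T, f i) + ∑ i ∈ S \ T, f i := by
    rw [← h4]; ring
  change ∑ i ∈ S, f i - a ∈ tInvPow M
  rw [h5]
  exact add_mem (neg_mem hT') (sum_mem fun i hi => hT i (Finset.mem_sdiff.1 hi).2)

theorem hasSum_geometric_t_inv {a : ℕ} (ha : 1 ≤ a) :
    HasSum (fun n : ℕ => ((t⁻¹ : 𝔽) ^ a) ^ n) (1 - (t⁻¹) ^ a)⁻¹ := by
  have hv := vInf_one_sub ha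
  have h0 : 1 - (t⁻¹ : 𝔽) ^ a ≠ 0 := fun h => by rw [h, map_zero] at hv; exact zero_ne_one hv
  refine hasSum_of_forall_tInvPow fun M => ⟨Finset.range M, fun n hn => ?_, ?_⟩
  · rw [← pow_mul]
    refine t_inv_pow_mem_tInvPow ?_
    rw [Finset.mem_range, not_lt] at hn
    nlinarith
  · have h2 : (1 - (t⁻¹ : 𝔽) ^ a)⁻¹ - ∑ i ∈ Finset.range M, ((t⁻¹ : 𝔽) ^ a) ^ i =
        (t⁻¹ : 𝔽) ^ (a * M) * (1 - (t⁻¹ : 𝔽) ^ a)⁻¹ := by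
      rw [pow_mul]
      exact inv_one_sub_sub_geom_sum (F := 𝔽) h0 M
    rw [h2]
    refine mul_mem_tInvPow (t_inv_pow_mem_tInvPow (by nlinarith)) ?_
    rw [mem_tInvPow]
    have h3 := map_inv₀ vInf (1 - (t⁻¹ : 𝔽) ^ a)
    rw [hv, inv_one] at h3
    exact h3.le.trans (by simp)

variable {r : ℕ}

/-- The truncation of a coefficient of the product attached to `σ` in the Leibniz formula. -/
def permTrunc (M : ℕ) (σ : Equiv.Perm (Fin r)) (e : Fin r → ℤ) : 𝔽 :=
  open Classical in
  ∑ m : Fin r → Fin M, if IsSolution σ (fun j => e j + 1) fun i => m i then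
    (t⁻¹) ^ ∑ i, (m i : ℕ) else 0

theorem hasSum_permTerm_tInv (σ : Equiv.Perm (Fin r)) (e : Fin r → ℤ) :
    ∃ a, HasSum (permTerm σ e) a ∧ ∀ M, a - permTrunc M σ e ∈ tInvPow M := by
  classical
  obtain ⟨a, ha⟩ := summable_solutions (t⁻¹ : 𝔽) (fun a ha => hasSum_geometric_t_inv ha) σ
    fun j => e j + 1
  refine ⟨a, hasSum_permTerm ?_ σ e a ha, fun M => ?_⟩
  · simpa using hasSum_geometric_t_inv le_rfl
  · let T : Finset {m // IsSolution σ (fun j => e j + 1) m} :=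
      Finset.subtype _ ((Finset.univ : Finset (Fin r → Fin M)).image fun m i => (m i : ℕ))
    have h1 := sub_sum_mem_tInvPow ha (M := M) T ?_
    · convert h1 using 2
      have h2 := Finset.sum_subtype_eq_sum_filter
        (s := (Finset.univ : Finset (Fin r → Fin M)).image fun m i => (m i : ℕ))
        (p := IsSolution σ fun j => e j + 1) fun m : Fin r → ℕ => (t⁻¹ : 𝔽) ^ ∑ i, m i
      rw [permTrunc, h2, Finset.sum_filter, Finset.sum_image]
      intro m _ m' _ h
      ext i
      exact congrFun h i
    · intro m hm
      refine t_inv_pow_mem_tInvPow ?_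
      by_contra hlt
      have h2 : ∀ i, m.1 i < M := fun i =>
        lt_of_le_of_lt (Finset.single_le_sum (fun i _ => Nat.zero_le _) (Finset.mem_univ i))
          (not_le.1 hlt)
      exact hm (Finset.mem_subtype.2 (Finset.mem_image.2
        ⟨fun i => ⟨m.1 i, h2 i⟩, Finset.mem_univ _, rfl⟩))

theorem tInvSummable_permTerm (σ : Equiv.Perm (Fin r)) (e : Fin r → ℤ) :
    TInvSummable (permTerm σ e) := by
  obtain ⟨a, ha, -⟩ := hasSum_permTerm_tInv σ e
  exact ha.summable

theorem tInvSum_permTerm_sub_mem (σ : Equiv.Perm (Fin r)) (e : Fin r → ℤ) (M : ℕ) :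
    tInvSum (permTerm σ e) - permTrunc M σ e ∈ tInvPow M := by
  obtain ⟨a, ha, h⟩ := hasSum_permTerm_tInv σ e
  have h1 : tInvSum (permTerm σ e) = a := ha.tsum_eq
  rw [h1]
  exact h M

end Topology

theorem intCast_mem_tInvPow (z : ℤ) : (z : 𝔽) ∈ tInvPow 0 := by
  have h : (1 : 𝔽) ∈ tInvPow 0 := by rw [mem_tInvPow]; simp
  simpa using zsmul_mem h z

/-- The coefficients of the determinant modulo powers of `t⁻¹`. -/
theorem detCoeff_sub_mem {r : ℕ} (e : Fin r → ℤ) (M : ℕ) :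
    detCoeff e - ∑ σ : Equiv.Perm (Fin r), ((Equiv.Perm.sign σ : ℤ) : 𝔽) * permTrunc M σ e ∈
      tInvPow M := by
  rw [detCoeff, ← Finset.sum_sub_distrib]
  refine sum_mem fun σ _ => ?_
  rw [← mul_sub, mul_comm]
  exact mul_mem_tInvPow (tInvSum_permTerm_sub_mem σ e M) (intCast_mem_tInvPow _)

theorem permTrunc_mem {r : ℕ} (M : ℕ) (σ : Equiv.Perm (Fin r)) (e : Fin r → ℤ) :
    permTrunc M σ e ∈ tInvPow 0 := by
  classical
  refine sum_mem fun m _ => ?_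
  split_ifs
  · exact t_inv_pow_mem_tInvPow (Nat.zero_le _)
  · exact zero_mem _

theorem detCoeff_mem {r : ℕ} (e : Fin r → ℤ) : detCoeff e ∈ tInvPow 0 := by
  have h1 : ∑ σ : Equiv.Perm (Fin r), ((Equiv.Perm.sign σ : ℤ) : 𝔽) * permTrunc 0 σ e ∈ tInvPow 0 :=
    sum_mem fun σ _ => mul_mem_tInvPow (intCast_mem_tInvPow _) (permTrunc_mem 0 σ e)
  have h := add_mem (detCoeff_sub_mem e 0) h1
  simpa using h

theorem eq_zero_of_mem_tInvPow {y : 𝔽} (h : ∀ M, y ∈ tInvPow M) : y = 0 := by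
  by_contra hy
  have h0 : vInf y ≠ 0 := (Valuation.ne_zero_iff _).2 hy
  have h1 := mem_tInvPow.1 (h (1 - log (vInf y)).toNat)
  rw [← exp_log h0, exp_le_exp, log_exp] at h1
  omega

/-- The determinant is homogeneous of degree `-r`. -/
theorem detCoeff_eq_zero {r : ℕ} (e : Fin r → ℤ) (he : ∑ i, e i ≠ -r) : detCoeff e = 0 := by
  classical
  refine eq_zero_of_mem_tInvPow fun M => ?_
  have h := detCoeff_sub_mem e M
  rwa [Finset.sum_eq_zero, sub_zero] at h
  intro σ _
  rw [permTrunc, Finset.sum_eq_zero, mul_zero]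
  intro m _
  refine if_neg fun hm => he ?_
  have h1 : ∑ j, (((m j : ℕ) : ℤ) - (m (σ⁻¹ j) : ℕ)) = ∑ j, (e j + 1) :=
    Finset.sum_congr rfl fun j _ => hm j
  rw [Finset.sum_sub_distrib, Equiv.sum_comp σ⁻¹ fun j => ((m j : ℕ) : ℤ), sub_self,
    Finset.sum_add_distrib] at h1
  simp at h1
  linarith

/-! ### The valuation ring -/

/-- The valuation ring of the place `t = ∞`. -/
abbrev TInvInt : Type := vInf.integer

/-- The uniformizer `t⁻¹`. -/
def tau : TInvInt := ⟨t⁻¹, by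
  have := t_inv_pow_mem_tInvPow (Nat.zero_le 1)
  rw [mem_tInvPow] at this
  simpa [Valuation.mem_integer_iff] using this⟩

theorem tau_pow_dvd_iff {M : ℕ} {y : TInvInt} : tau ^ M ∣ y ↔ (y : 𝔽) ∈ tInvPow M := by
  have h : tau ^ M ∣ y ↔ vInf (y : 𝔽) ≤ vInf ((tau ^ M : TInvInt) : 𝔽) :=
    (Valuation.integer.integers vInf).dvd_iff_le
  rw [h, mem_tInvPow, ← vInf_t_inv_pow]
  rfl

theorem isUnit_one_sub_tau_pow {a : ℕ} (ha : 1 ≤ a) : IsUnit (1 - tau ^ a) := by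
  refine (Valuation.integer.integers vInf).isUnit_iff_valuation_eq_one.2 ?_
  exact vInf_one_sub ha

theorem eq_zero_of_tau_pow_dvd {y : TInvInt} (h : ∀ M, tau ^ M ∣ y) : y = 0 :=
  Subtype.ext (eq_zero_of_mem_tInvPow fun M => tau_pow_dvd_iff.1 (h M))

/-- The coefficients of the determinant lie in the valuation ring of the place `t = ∞`. -/
def detCoeffInt {r : ℕ} (e : Fin r → ℤ) : TInvInt := ⟨detCoeff e, by
  have := detCoeff_mem e
  rw [mem_tInvPow] at this
  simpa [Valuation.mem_integer_iff] using this⟩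

theorem tau_pow_dvd_detCoeffInt_sub {r : ℕ} (e : Fin r → ℤ) (M : ℕ) :
    tau ^ M ∣ detCoeffInt e - open Classical in ∑ σ : Equiv.Perm (Fin r),
      ((Equiv.Perm.sign σ : ℤ) : TInvInt) * ∑ m : Fin r → Fin M,
        if IsSolution σ (fun j => e j + 1) fun i => m i then tau ^ ∑ i, (m i : ℕ) else 0 := by
  classical
  rw [tau_pow_dvd_iff]
  convert detCoeff_sub_mem e M using 1
  push_cast
  rw [detCoeffInt]
  congr 1
  refine Finset.sum_congr rfl fun σ _ => ?_
  congr 1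
  rw [permTrunc]
  refine Finset.sum_congr rfl fun m _ => ?_
  split_ifs <;> simp [tau]

end PlaceAtInfinity

section VertexOperators

open Finset.HasAntidiagonal

/-! ### Exponentials of commuting families of operators -/

section Euler

variable {W : Type*} [Ring W]

/-- The Euler operator `u d/du` on power series. -/
def eulerOp (P : PowerSeries W) : PowerSeries W := PowerSeries.mk fun n => n • PowerSeries.coeff n P

theorem coeff_eulerOp (P : PowerSeries W) (n : ℕ) :
    PowerSeries.coeff n (eulerOp P) = n • PowerSeries.coeff n P := PowerSeries.coeff_mk _ _

theorem eulerOp_mul (P Q : PowerSeries W) : eulerOp (P * Q) = eulerOp P * Q + P * eulerOp Q := by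
  ext n
  rw [coeff_eulerOp, map_add, PowerSeries.coeff_mul, PowerSeries.coeff_mul, PowerSeries.coeff_mul,
    Finset.smul_sum, ← Finset.sum_add_distrib]
  refine Finset.sum_congr rfl fun p hp => ?_
  rw [coeff_eulerOp, coeff_eulerOp, ← Finset.HasAntidiagonal.mem_antidiagonal.1 hp, add_smul, smul_mul_assoc,
    mul_smul_comm]

theorem eulerOp_one : eulerOp (1 : PowerSeries W) = 0 := by
  ext n
  rw [coeff_eulerOp, PowerSeries.coeff_one]
  split_ifs with h <;> simp [h]

theorem eulerOp_pow_succ (S : PowerSeries W)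
    (hS : ∀ a b, Commute (PowerSeries.coeff a S) (PowerSeries.coeff b S)) (k : ℕ) :
    eulerOp (S ^ (k + 1)) = (k + 1) • (eulerOp S * S ^ k) := by
  have hc : Commute (eulerOp S) S := by
    ext n
    rw [PowerSeries.coeff_mul, PowerSeries.coeff_mul, ← Finset.Nat.sum_antidiagonal_swap]
    refine Finset.sum_congr rfl fun p _ => ?_
    simp only [coeff_eulerOp, Prod.fst_swap, Prod.snd_swap, smul_mul_assoc, mul_smul_comm]
    rw [(hS _ _).eq]
  induction k with
  | zero => simp
  | succ k ih =>
    rw [pow_succ, eulerOp_mul, ih, ← (hc.symm.pow_left (k + 1)).eq, smul_mul_assoc, mul_assoc,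
      ← pow_succ, (hc.symm.pow_left (k + 1)).eq, ← succ_nsmul]

theorem coeff_pow_eq_zero (S : PowerSeries W) (hS : PowerSeries.coeff 0 S = 0) :
    ∀ {k m : ℕ}, m < k → PowerSeries.coeff m (S ^ k) = 0
  | 0, _, h => absurd h (Nat.not_lt_zero _)
  | k + 1, m, h => by
    rw [pow_succ, PowerSeries.coeff_mul]
    refine Finset.sum_eq_zero fun p hp => ?_
    rcases Nat.eq_zero_or_pos p.2 with h0 | h0
    · rw [h0, hS, mul_zero]
    · have := Finset.HasAntidiagonal.mem_antidiagonal.1 hp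
      rw [coeff_pow_eq_zero S hS (by omega), zero_mul]

end Euler

/-- The exponent of a vertex operator. -/
def expSeries (A : ℕ → Module.End 𝔽 Fock) : PowerSeries (Module.End 𝔽 Fock) :=
  PowerSeries.mk fun n => if n = 0 then 0 else A n

theorem expCoeff_eq_sum (A : ℕ → Module.End 𝔽 Fock) {m N : ℕ} (h : m < N) :
    expCoeff A m = ∑ k ∈ Finset.range N, ((k.factorial : 𝔽)⁻¹) •
      PowerSeries.coeff m (expSeries A ^ k) := by
  refine Finset.sum_subset (fun k hk => ?_) fun k _ hk => ?_
  · simp only [Finset.mem_range] at *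
    omega
  · rw [coeff_pow_eq_zero, smul_zero]
    · simp
    · simpa only [Finset.mem_range, not_lt, Nat.succ_le_iff] using hk

theorem inv_mul_mul_cancel {F : Type*} [Field F] {a : F} (ha : a ≠ 0) (b : F) :
    (a * b)⁻¹ * a = b⁻¹ := by
  rw [mul_inv_rev, mul_assoc, inv_mul_cancel₀ ha, mul_one]

/-- The differential equation of the exponential of a series with commuting coefficients. -/
theorem nsmul_expCoeff (A : ℕ → Module.End 𝔽 Fock) (hA : ∀ a b, Commute (A a) (A b)) (m : ℕ) :
    m • expCoeff A m =
      ∑ p ∈ antidiagonal m, (p.1 • A p.1) * expCoeff A p.2 := by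
  have hS : ∀ a b, Commute (PowerSeries.coeff a (expSeries A)) (PowerSeries.coeff b (expSeries A)) := by
    intro a b
    simp only [expSeries, PowerSeries.coeff_mk]
    split_ifs
    · exact Commute.zero_left _
    · exact Commute.zero_left _
    · exact Commute.zero_right _
    · exact hA a b
  have h1 : ∀ p ∈ antidiagonal m, (p.1 • A p.1) * expCoeff A p.2 =
      ∑ k ∈ Finset.range (m + 1), ((k.factorial : 𝔽)⁻¹) •
        (PowerSeries.coeff p.1 (eulerOp (expSeries A)) * PowerSeries.coeff p.2 (expSeries A ^ k)) := by
    intro p hp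
    have := Finset.HasAntidiagonal.mem_antidiagonal.1 hp
    rw [expCoeff_eq_sum A (show p.2 < m + 1 by omega), Finset.mul_sum]
    refine Finset.sum_congr rfl fun k _ => ?_
    rw [mul_smul_comm, coeff_eulerOp, expSeries, PowerSeries.coeff_mk]
    split_ifs with h0
    · simp [h0]
    · rfl
  rw [Finset.sum_congr rfl h1, Finset.sum_comm, expCoeff_eq_sum A (show m < m + 2 by omega),
    Finset.sum_range_succ', smul_add, Finset.smul_sum]
  have h2 : m • (((Nat.factorial 0 : 𝔽)⁻¹) • PowerSeries.coeff m (expSeries A ^ 0)) = 0 := by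
    rw [smul_comm, ← coeff_eulerOp, pow_zero, eulerOp_one]
    simp
  rw [h2, add_zero]
  refine Finset.sum_congr rfl fun k _ => ?_
  rw [← Finset.smul_sum, ← PowerSeries.coeff_mul, smul_comm, ← coeff_eulerOp,
    eulerOp_pow_succ _ hS, map_nsmul, ← Nat.cast_smul_eq_nsmul 𝔽, smul_smul, Nat.factorial_succ]
  congr 1
  have : ((k : 𝔽) + 1) ≠ 0 := by exact_mod_cast Nat.succ_ne_zero k
  push_cast
  exact inv_mul_mul_cancel (F := 𝔽) this _

theorem expCoeff_zero (A : ℕ → Module.End 𝔽 Fock) : expCoeff A 0 = 1 := by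
  have h : ((1 : 𝔽)⁻¹) = 1 := @inv_one 𝔽 _
  simp [expCoeff, h]

theorem commute_expCoeff (A : ℕ → Module.End 𝔽 Fock) (hA : ∀ a b, Commute (A a) (A b)) (a m : ℕ) :
    Commute (A a) (expCoeff A m) := by
  refine Commute.sum_right _ _ _ fun k _ => Commute.smul_right ?_ _
  have h1 : Commute (PowerSeries.C (A a)) (expSeries A) := by
    ext n : 1
    rw [PowerSeries.coeff_C_mul, PowerSeries.coeff_mul_C, expSeries, PowerSeries.coeff_mk]
    split_ifs
    · simp
    · exact hA a n
  have h2 := congrArg (PowerSeries.coeff m) (h1.pow_right k).eq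
  rwa [PowerSeries.coeff_C_mul, PowerSeries.coeff_mul_C] at h2

theorem eq_of_nsmul_eq {F N : Type*} [Field F] [CharZero F] [AddCommGroup N] [Module F N] {m : ℕ}
    (hm : m ≠ 0) {x y : N} (h : m • x = m • y) : x = y := by
  rw [← Nat.cast_smul_eq_nsmul F, ← Nat.cast_smul_eq_nsmul F] at h
  exact smul_right_injective N (Nat.cast_ne_zero.2 hm : (m : F) ≠ 0) h

/-- A solution of the differential equation of an exponential is determined by its constant
term. -/
theorem eq_of_nsmul_eq_sum {N : Type*} [AddCommGroup N] [Module 𝔽 N] {V : Type*}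
    (B B' : ℕ → V → N) (c : ℕ → V → V) (h0 : B 0 = B' 0)
    (hB : ∀ m v, m • B m v = ∑ p ∈ antidiagonal m, p.1 • B p.2 (c p.1 v))
    (hB' : ∀ m v, m • B' m v = ∑ p ∈ antidiagonal m, p.1 • B' p.2 (c p.1 v)) (m : ℕ) :
    B m = B' m := by
  induction m using Nat.strong_induction_on with
  | _ m ih =>
    rcases Nat.eq_zero_or_pos m with rfl | hm
    · exact h0
    · funext v
      refine eq_of_nsmul_eq (F := 𝔽) hm.ne' ?_
      rw [hB, hB']
      refine Finset.sum_congr rfl fun p hp => ?_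
      have h2 := Finset.HasAntidiagonal.mem_antidiagonal.1 hp
      rcases Nat.eq_zero_or_pos p.1 with h3 | h3
      · rw [h3, zero_smul, zero_smul]
      · rw [ih p.2 (by omega)]

theorem nsmul_expCoeff_apply (A : ℕ → Module.End 𝔽 Fock) (hA : ∀ a b, Commute (A a) (A b)) (m : ℕ)
    (v : Fock) :
    m • expCoeff A m v = ∑ p ∈ antidiagonal m, p.1 • expCoeff A p.2 (A p.1 v) := by
  rw [← LinearMap.smul_apply, nsmul_expCoeff A hA, LinearMap.sum_apply]
  refine Finset.sum_congr rfl fun p _ => ?_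
  rw [smul_mul_assoc, (commute_expCoeff A hA _ _).eq, LinearMap.smul_apply, Module.End.mul_apply]

/-! ### The two halves of the vertex operator -/

theorem heis_zero : heis 0 = 0 := rfl

theorem heis_natCast (n : ℕ+) (v : Fock) :
    heis ((n : ℕ) : ℤ) v =
      (((n : ℕ) : 𝔽) * ((1 - q ^ (n : ℕ)) / (1 - t ^ (n : ℕ)))) • MvPolynomial.pderiv n v := by
  obtain ⟨k, rfl⟩ : ∃ k : ℕ, n = k.succPNat := ⟨n.natPred, by simp⟩
  rfl

theorem heis_neg_natCast (n : ℕ+) (v : Fock) :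
    heis (-((n : ℕ) : ℤ)) v = MvPolynomial.X n * v := by
  obtain ⟨k, rfl⟩ : ∃ k : ℕ, n = k.succPNat := ⟨n.natPred, by simp⟩
  rfl

theorem heis_commute {m n : ℤ} (h : m + n ≠ 0 ∨ m = 0) : Commute (heis m) (heis n) := by
  rcases h with h | rfl
  · have h1 := heis_comm m n
    rw [if_neg h, zero_smul, sub_eq_zero] at h1
    exact h1
  · rw [heis_zero]
    exact Commute.zero_left _

theorem etaMinus_commute (a b : ℕ) :
    Commute (((1 - (t⁻¹) ^ a) / (a : 𝔽)) • heis (-(a : ℤ)))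
      (((1 - (t⁻¹) ^ b) / (b : 𝔽)) • heis (-(b : ℤ))) :=
  ((heis_commute (by omega)).smul_left _).smul_right _

theorem etaPlus_commute (a b : ℕ) :
    Commute ((-((1 - t ^ a) / (a : 𝔽))) • heis (a : ℤ))
      ((-((1 - t ^ b) / (b : 𝔽))) • heis (b : ℤ)) :=
  ((heis_commute (by omega)).smul_left _).smul_right _

theorem inv_pow_mul_pow_self {F : Type*} [Field F] {a : F} (ha : a ≠ 0) (n : ℕ) :
    a⁻¹ ^ n * a ^ n = 1 := by
  rw [← mul_pow, inv_mul_cancel₀ ha, one_pow]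

theorem t_ne_zero : t ≠ 0 := RatFunc.X_ne_zero

theorem one_sub_t_pow_ne_zero {n : ℕ} (hn : n ≠ 0) : (1 : 𝔽) - t ^ n ≠ 0 := by
  intro h
  have h2 : vInf ((t⁻¹ : 𝔽) ^ n * t ^ n) = 1 := by
    have h4 : (t⁻¹ : 𝔽) ^ n * t ^ n = 1 := inv_pow_mul_pow_self (F := 𝔽) t_ne_zero n
    rw [h4, map_one]
  rw [map_mul, ← sub_eq_zero.1 h, map_one, mul_one, vInf_t_inv_pow, ← WithZero.exp_zero,
    WithZero.exp_inj] at h2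
  omega

theorem div_mul_self_cancel {F : Type*} [Field F] {a n : F} (hn : n ≠ 0) : n * (a / n) = a := by
  field_simp

theorem neg_div_mul_mul_div {F : Type*} [Field F] {a b n : F} (hn : n ≠ 0) (hb : b ≠ 0) :
    -(b / n) * (n * (a / b)) = -a := by
  field_simp

/-- The exponent of `η(z)₊`, as a differential operator. -/
theorem etaPlus_mode (n : ℕ+) (v : Fock) :
    ((-((1 - t ^ (n : ℕ)) / ((n : ℕ) : 𝔽))) • heis ((n : ℕ) : ℤ)) v =
      (q ^ (n : ℕ) - 1) • MvPolynomial.pderiv n v := by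
  rw [LinearMap.smul_apply, heis_natCast, smul_smul]
  congr 1
  have h1 : ((n : ℕ) : 𝔽) ≠ 0 := Nat.cast_ne_zero.2 n.ne_zero
  exact (neg_div_mul_mul_div (F := 𝔽) h1 (one_sub_t_pow_ne_zero n.ne_zero)).trans (by ring)

/-- The algebra homomorphism `a₋ₙ ↦ a₋ₙ + (qⁿ - 1) wⁿ`; it is the action of `η(z)₊`, `w = 1/z`. -/
def shiftHom : Fock →ₐ[𝔽] Polynomial Fock :=
  MvPolynomial.aeval fun n : ℕ+ => Polynomial.C (MvPolynomial.X n) +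
    Polynomial.C (MvPolynomial.C (q ^ (n : ℕ) - 1)) * Polynomial.X ^ (n : ℕ)

/-- The differential equation of `shiftHom` in `w`. The sum over all `n > 0` has finitely many nonzero
terms; it is taken over any finite set which contains the indices of the variables of `v`. -/
theorem exists_derivative_shiftHom (v : Fock) : ∃ s₀ : Finset ℕ+, ∀ s, s₀ ⊆ s →
    Polynomial.X * Polynomial.derivative (shiftHom v) =
      ∑ n ∈ s, (n : ℕ) • (Polynomial.X ^ (n : ℕ) *
        shiftHom ((q ^ (n : ℕ) - 1) • MvPolynomial.pderiv n v)) := by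
  classical
  induction v using MvPolynomial.induction_on with
  | C a =>
    refine ⟨∅, fun s _ => ?_⟩
    have h : shiftHom (MvPolynomial.C a) = Polynomial.C (MvPolynomial.C a) := by
      rw [shiftHom, MvPolynomial.aeval_C]
      rfl
    simp [h]
  | add u v hu hv =>
    obtain ⟨s₁, h₁⟩ := hu
    obtain ⟨s₂, h₂⟩ := hv
    refine ⟨s₁ ∪ s₂, fun s hs => ?_⟩
    rw [map_add, Polynomial.derivative_add, mul_add, h₁ s (Finset.union_subset_left hs),
      h₂ s (Finset.union_subset_right hs), ← Finset.sum_add_distrib]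
    refine Finset.sum_congr rfl fun n _ => ?_
    simp only [map_add, smul_add, mul_add]
  | mul_X v k hv =>
    obtain ⟨s₁, h₁⟩ := hv
    refine ⟨insert k s₁, fun s hs => ?_⟩
    have hk : k ∈ s := hs (Finset.mem_insert_self _ _)
    have h2 : ∀ n ∈ s, (n : ℕ) • (Polynomial.X ^ (n : ℕ) *
        shiftHom ((q ^ (n : ℕ) - 1) • MvPolynomial.pderiv n (v * MvPolynomial.X k))) =
        (n : ℕ) • (Polynomial.X ^ (n : ℕ) *
          shiftHom ((q ^ (n : ℕ) - 1) • MvPolynomial.pderiv n v)) * shiftHom (MvPolynomial.X k) +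
        if k = n then (k : ℕ) • (Polynomial.X ^ (k : ℕ) *
          shiftHom ((q ^ (k : ℕ) - 1) • v)) else 0 := by
      intro n _
      rw [Derivation.leibniz, MvPolynomial.pderiv_X, Pi.single_apply]
      split_ifs with h
      · subst h
        simp only [smul_eq_mul, mul_one, map_add, map_mul, nsmul_eq_mul, Algebra.smul_def]
        ring
      · simp only [smul_eq_mul, mul_zero, zero_add, add_zero, map_mul, nsmul_eq_mul,
          Algebra.smul_def]
        ring
    rw [Finset.sum_congr rfl h2, Finset.sum_add_distrib, ← Finset.sum_mul,
      ← h₁ s ((Finset.subset_insert _ _).trans hs), Finset.sum_ite_eq, if_pos hk, map_mul,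
      Polynomial.derivative_mul]
    have h3 : Polynomial.X * Polynomial.derivative (shiftHom (MvPolynomial.X k)) =
        (k : ℕ) • (Polynomial.X ^ (k : ℕ) * Polynomial.C (MvPolynomial.C (q ^ (k : ℕ) - 1))) := by
      rw [shiftHom, MvPolynomial.aeval_X, Polynomial.derivative_add, Polynomial.derivative_C,
        zero_add, Polynomial.derivative_C_mul_X_pow]
      generalize q ^ (k : ℕ) - 1 = c
      obtain ⟨j, hj⟩ := Nat.exists_eq_succ_of_ne_zero k.ne_zero
      simp only [hj, Nat.succ_eq_add_one, Nat.add_sub_cancel, nsmul_eq_mul, map_mul, map_natCast]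
      ring
    rw [mul_add, ← mul_assoc, mul_left_comm, h3, map_smul, Algebra.smul_def]
    change _ = _ + (k : ℕ) • (Polynomial.X ^ (k : ℕ) *
      (Polynomial.C (MvPolynomial.C (q ^ (k : ℕ) - 1)) * shiftHom v))
    simp only [nsmul_eq_mul]
    ring

/-- Both sides satisfy the differential equation of the exponential, as `η(z)₊` is the exponential of
`∑ (qⁿ - 1) wⁿ ∂/∂a₋ₙ`. -/
theorem etaPlus_apply (m : ℕ) (v : Fock) : etaPlus m v = (shiftHom v).coeff m := by
  refine congrFun (eq_of_nsmul_eq_sum (fun m v => etaPlus m v) (fun m v => (shiftHom v).coeff m)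
    (fun n v => ((-((1 - t ^ n) / (n : 𝔽))) • heis (n : ℤ)) v) ?_ ?_ ?_ m) v
  · funext v
    have h := congrArg (fun f : Fock →ₐ[𝔽] Fock => f v)
      (MvPolynomial.algHom_ext (A := Fock) (f := (Polynomial.aeval (R := Fock) (0 : Fock)).restrictScalars 𝔽 |>.comp
        shiftHom) (g := AlgHom.id 𝔽 Fock) fun n => by simp [shiftHom])
    change expCoeff _ 0 v = (shiftHom v).coeff 0
    rw [expCoeff_zero, Polynomial.coeff_zero_eq_aeval_zero]
    exact h.symm
  · intro m v
    exact nsmul_expCoeff_apply _ etaPlus_commute m v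
  · intro m v
    obtain ⟨s₀, h⟩ := exists_derivative_shiftHom v
    have h1 := congrArg (fun P => Polynomial.coeff P m)
      (h (s₀ ∪ (Finset.range m).image Nat.succPNat) Finset.subset_union_left)
    have h2 : (Polynomial.X * Polynomial.derivative (shiftHom v)).coeff m =
        m • (shiftHom v).coeff m := by
      cases m with
      | zero => simp
      | succ m => rw [Polynomial.coeff_X_mul, Polynomial.coeff_derivative, nsmul_eq_mul]; push_cast; ring
    rw [h2] at h1
    refine h1.trans ?_
    rw [Finset.Nat.sum_antidiagonal_eq_sum_range_succ_mk, Finset.sum_range_succ', zero_smul, add_zero,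
      Polynomial.finsetSum_coeff, ← Finset.sum_subset Finset.subset_union_right,
      Finset.sum_image Nat.succPNat_injective.injOn]
    · refine Finset.sum_congr rfl fun i hi => ?_
      have h3 := etaPlus_mode i.succPNat v
      simp only [Nat.succPNat_coe, Nat.succ_eq_add_one] at h3
      rw [h3, Polynomial.coeff_smul, Polynomial.coeff_X_pow_mul', if_pos]
      · rfl
      · exact Finset.mem_range.1 hi
    · intro n _ hn
      rw [Polynomial.coeff_smul, Polynomial.coeff_X_pow_mul', if_neg, smul_zero]
      intro hle
      have h3 := n.pos
      exact hn (Finset.mem_image.2 ⟨n.natPred, Finset.mem_range.2 (by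
        have := n.natPred_add_one; omega), by simp⟩)

end VertexOperators

section VertexProducts

open Finset.HasAntidiagonal

/-! ### Products of vertex operators -/

/-- The algebra homomorphism `a₋ₙ ↦ a₋ₙ + (qⁿ - 1) ∑ᵢ wᵢⁿ`; it is the action of
`η(z₁)₊⋯η(z_r)₊`, `wᵢ = 1/zᵢ`. -/
def multiShiftHom (r : ℕ) : Fock →ₐ[𝔽] MvPolynomial (Fin r) Fock :=
  MvPolynomial.aeval fun n : ℕ+ => MvPolynomial.C (MvPolynomial.X n) +
    MvPolynomial.C (MvPolynomial.C (q ^ (n : ℕ) - 1)) * MvPolynomial.psum (Fin r) Fock n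

/-- Separate the first variable, as the variable of the coefficients. -/
def splitFirst (R : Type*) [CommRing R] (r : ℕ) :
    MvPolynomial (Fin (r + 1)) R →ₐ[R] MvPolynomial (Fin r) (Polynomial R) :=
  MvPolynomial.aeval (Fin.cons (MvPolynomial.C Polynomial.X) MvPolynomial.X)

theorem splitFirst_monomial {R : Type*} [CommRing R] {r : ℕ} (m : Fin (r + 1) →₀ ℕ) (c : R) :
    splitFirst R r (MvPolynomial.monomial m c) =
      MvPolynomial.monomial m.tail (Polynomial.monomial (m 0) c) := by
  rw [splitFirst, MvPolynomial.aeval_monomial, Finsupp.prod_fintype _ _ fun _ => pow_zero _,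
    Fin.prod_univ_succ, MvPolynomial.monomial_eq, Finsupp.prod_fintype _ _ fun _ => pow_zero _,
    ← Polynomial.C_mul_X_pow_eq_monomial, map_mul, map_pow]
  simp only [Fin.cons_zero, Fin.cons_succ, Finsupp.tail_apply, mul_assoc]
  rfl

theorem coeff_splitFirst {R : Type*} [CommRing R] {r : ℕ} (f : MvPolynomial (Fin (r + 1)) R)
    (s : Fin r →₀ ℕ) (n : ℕ) :
    ((splitFirst R r f).coeff s).coeff n = f.coeff (s.cons n) := by
  classical
  induction f using MvPolynomial.induction_on' with
  | monomial m c =>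
    rw [splitFirst_monomial, MvPolynomial.coeff_monomial, MvPolynomial.coeff_monomial]
    by_cases h : m = s.cons n
    · rw [h]
      simp
    · rw [if_neg h]
      split_ifs with h1
      · rw [Polynomial.coeff_monomial, if_neg]
        rintro rfl
        exact h (by rw [← h1, Finsupp.cons_tail])
      · simp
  | add p q hp hq => simp [hp, hq]

/-- The passage from `r` to `r + 1` factors, the additional variable coming from `shiftHom`. -/
theorem map_shiftHom_multiShiftHom (r : ℕ) (v : Fock) :
    MvPolynomial.map (shiftHom : Fock →+* Polynomial Fock) (multiShiftHom r v) =
      splitFirst Fock r (multiShiftHom (r + 1) v) := by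
  refine congrArg (fun f : Fock →ₐ[𝔽] MvPolynomial (Fin r) (Polynomial Fock) => f v)
    (MvPolynomial.algHom_ext (f := (MvPolynomial.mapAlgHom shiftHom).comp (multiShiftHom r))
      (g := ((splitFirst Fock r).restrictScalars 𝔽).comp (multiShiftHom (r + 1))) fun n => ?_)
  have h1 : ∀ a : Fock, splitFirst Fock r (MvPolynomial.C a) = MvPolynomial.C (Polynomial.C a) :=
    fun a => (splitFirst Fock r).commutes a
  have h2 : shiftHom (MvPolynomial.C (q ^ (n : ℕ) - 1)) =
      Polynomial.C (MvPolynomial.C (q ^ (n : ℕ) - 1)) := shiftHom.commutes _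
  have h3 : shiftHom (MvPolynomial.X n) = Polynomial.C (MvPolynomial.X n) +
      Polynomial.C (MvPolynomial.C (q ^ (n : ℕ) - 1)) * Polynomial.X ^ (n : ℕ) :=
    MvPolynomial.aeval_X _ _
  change MvPolynomial.map (shiftHom : Fock →+* Polynomial Fock) (multiShiftHom r _) =
    splitFirst Fock r (multiShiftHom (r + 1) _)
  rw [multiShiftHom, multiShiftHom, MvPolynomial.aeval_X, MvPolynomial.aeval_X, map_add, map_add,
    map_mul, map_mul, MvPolynomial.map_C, MvPolynomial.map_C, h1, h1, RingHom.coe_coe, h2, h3,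
    MvPolynomial.psum, MvPolynomial.psum, Fin.sum_univ_succ]
  have h4 : splitFirst Fock r (MvPolynomial.X 0) = MvPolynomial.C Polynomial.X := by
    simp [splitFirst]
  have h5 : ∀ i : Fin r, splitFirst Fock r (MvPolynomial.X i.succ) = MvPolynomial.X i := by
    simp [splitFirst]
  simp only [map_sum, map_pow, MvPolynomial.map_X, h4, h5, map_add, map_mul]
  ring

/-- The action of the annihilating half of a normally ordered product. -/
theorem prod_etaPlus_apply {r : ℕ} (b : Fin r → ℕ) (v : Fock) :
    (List.ofFn fun i => etaPlus (b i)).prod v =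
      (multiShiftHom r v).coeff (Finsupp.equivFunOnFinite.symm b) := by
  induction r with
  | zero =>
    have h : multiShiftHom 0 v = MvPolynomial.C v :=
      congrArg (fun f : Fock →ₐ[𝔽] MvPolynomial (Fin 0) Fock => f v)
        (MvPolynomial.algHom_ext (f := multiShiftHom 0)
          (g := IsScalarTower.toAlgHom 𝔽 Fock (MvPolynomial (Fin 0) Fock)) fun n => by
          simp [multiShiftHom, MvPolynomial.psum, MvPolynomial.algebraMap_eq])
    have h1 : Finsupp.equivFunOnFinite.symm b = 0 := Subsingleton.elim _ _
    rw [h, h1]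
    simp
  | succ r ih =>
    have h1 : Finsupp.equivFunOnFinite.symm b =
        (Finsupp.equivFunOnFinite.symm fun i : Fin r => b i.succ).cons (b 0) := by
      ext i
      refine Fin.cases ?_ (fun i => ?_) i <;> simp
    rw [List.ofFn_succ, List.prod_cons, Module.End.mul_apply, ih, etaPlus_apply, h1,
      ← coeff_splitFirst, ← map_shiftHom_multiShiftHom, MvPolynomial.coeff_map]
    rfl

theorem rename_multiShiftHom {r : ℕ} (σ : Equiv.Perm (Fin r)) (v : Fock) :
    MvPolynomial.rename σ (multiShiftHom r v) = multiShiftHom r v := by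
  refine congrArg (fun f : Fock →ₐ[𝔽] MvPolynomial (Fin r) Fock => f v)
    (MvPolynomial.algHom_ext
      (f := ((MvPolynomial.rename σ).restrictScalars 𝔽).comp (multiShiftHom r))
      (g := multiShiftHom r) fun n => ?_)
  change MvPolynomial.rename σ (multiShiftHom r _) = multiShiftHom r _
  rw [multiShiftHom, MvPolynomial.aeval_X, map_add, map_mul, MvPolynomial.rename_C,
    MvPolynomial.rename_C, MvPolynomial.psum_isSymmetric]

/-! ### The sums over exponents are finite -/

theorem normalTerm_support_finite {r : ℕ} (e : Fin r → ℤ) (v : Fock) :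
    (Function.support (normalTerm e v)).Finite := by
  refine Set.Finite.of_finite_image (f := fun p : Splitting e => Finsupp.equivFunOnFinite.symm p.1.2)
    ((multiShiftHom r v).support.finite_toSet.subset ?_) ?_
  · rintro _ ⟨p, hp, rfl⟩
    rw [Finset.mem_coe, MvPolynomial.mem_support_iff, ← prod_etaPlus_apply]
    intro h
    exact hp (by rw [normalTerm, h, map_zero])
  · intro p _ p' _ h
    have h2 : p.1.2 = p'.1.2 := Finsupp.equivFunOnFinite.symm.injective h
    refine Subtype.ext (Prod.ext (funext fun i => ?_) h2)
    have h3 := p.2 i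
    have h4 := p'.2 i
    have h5 := congrFun h2 i
    omega

/-- A summand of the formal residue, `a` and `b` being the exponents of `z` in the creating half
and of `1/z` in the annihilating half. -/
def residueSummand {r : ℕ} (v : Fock) (a b : Fin r → ℕ) : Fock :=
  detCoeff (fun i => (b i : ℤ) - a i - 1) •
    (List.ofFn fun i => etaMinus (a i)).prod ((List.ofFn fun i => etaPlus (b i)).prod v)

/-- The exponents which contribute to the formal residue. -/
def residueIndex {r : ℕ} (v : Fock) : Finset ((Fin r → ℕ) × (Fin r → ℕ)) :=
  (multiShiftHom r v).support.biUnion fun b =>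
    (Finset.piAntidiag Finset.univ (∑ i, b i)).image fun a => (a, b)

theorem mem_residueIndex {r : ℕ} {v : Fock} {a b : Fin r → ℕ} :
    (a, b) ∈ residueIndex v ↔ (List.ofFn fun i => etaPlus (b i)).prod v ≠ 0 ∧
      ∑ i, a i = ∑ i, b i := by
  rw [prod_etaPlus_apply, ← MvPolynomial.mem_support_iff, residueIndex]
  simp only [Finset.mem_biUnion, Finset.mem_image, Prod.mk.injEq, Finset.mem_piAntidiag]
  constructor
  · rintro ⟨b', hb', a', ⟨h1, -⟩, rfl, rfl⟩
    exact ⟨by convert hb'; ext i; rfl, h1⟩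
  · rintro ⟨h1, h2⟩
    exact ⟨_, h1, a, ⟨h2, fun i _ => Finset.mem_univ i⟩, rfl, rfl⟩

/-- The homogeneity of the determinant bounds the exponents of the creating half by those of the
annihilating half. -/
theorem residueTerm_eq {r : ℕ} (v : Fock) (e : Fin r → ℤ) :
    residueTerm v e = ∑ p ∈ residueIndex v,
      if (fun i => (p.2 i : ℤ) - p.1 i - 1) = e then residueSummand v p.1 p.2 else 0 := by
  classical
  by_cases he : detCoeff e = 0
  · rw [residueTerm, he, zero_smul, Finset.sum_eq_zero]
    intro p _
    split_ifs with h
    · rw [residueSummand, h, he, zero_smul]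
    · rfl
  · have he' : ∑ i, e i = -r := by
      by_contra h
      exact he (detCoeff_eq_zero e h)
    rw [residueTerm, normalCoeff, finsum_eq_sum_of_support_subset _
      (s := (normalTerm_support_finite _ v).toFinset) (by simp), Finset.smul_sum,
      ← Finset.sum_filter]
    refine Finset.sum_bij_ne_zero (fun p _ _ => p.1) ?_ ?_ ?_ ?_
    · intro p hp h0
      rw [Set.Finite.mem_toFinset, Function.mem_support] at hp
      have hp2 := p.2
      rw [Finset.mem_filter]
      refine ⟨mem_residueIndex.2 ⟨fun h => hp (by rw [normalTerm, h, map_zero]), ?_⟩, ?_⟩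
      · have h1 : ∑ i, ((p.1.1 i : ℤ) - p.1.2 i) = ∑ i, (-1 - e i) :=
          Finset.sum_congr rfl fun i _ => hp2 i
        rw [Finset.sum_sub_distrib, Finset.sum_sub_distrib, he'] at h1
        simp at h1
        have h2 : ((∑ i, p.1.1 i : ℕ) : ℤ) = (∑ i, p.1.2 i : ℕ) := by
          push_cast
          linarith
        exact_mod_cast h2
      · funext i
        have := hp2 i
        linarith
    · intro p _ _ p' _ _ h
      exact Subtype.ext h
    · rintro ⟨a, b⟩ hp h0
      rw [Finset.mem_filter] at hp
      refine ⟨⟨(a, b), fun i => ?_⟩, ?_, ?_, rfl⟩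
      · have := congrFun hp.2 i
        simp only at this
        simp only
        linarith
      · rw [Set.Finite.mem_toFinset, Function.mem_support]
        intro h
        rw [residueSummand] at h0
        rw [normalTerm] at h
        exact h0 (by simp only at h ⊢; rw [h, smul_zero])
      · intro h
        refine h0 ?_
        rw [residueSummand, hp.2]
        exact h
    · intro p hp h0
      rw [residueSummand, normalTerm]
      congr 2
      funext i
      have := p.2 i
      linarith

theorem residueTerm_support_subset {r : ℕ} (v : Fock) :
    Function.support (residueTerm (r := r) v) ⊆
      ((residueIndex v).image fun p i => (p.2 i : ℤ) - p.1 i - 1 : Finset (Fin r → ℤ)) := by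
  classical
  intro e he
  rw [Function.mem_support, residueTerm_eq] at he
  obtain ⟨p, hp, h⟩ := Finset.exists_ne_zero_of_sum_ne_zero he
  rw [Finset.mem_coe, Finset.mem_image]
  refine ⟨p, hp, ?_⟩
  by_contra hne
  exact h (if_neg hne)

theorem residueTerm_support_finite {r : ℕ} (v : Fock) :
    (Function.support (residueTerm (r := r) v)).Finite :=
  (Finset.finite_toSet _).subset (residueTerm_support_subset v)

theorem detResidue_eq (r : ℕ) (v : Fock) :
    detResidue r v = ∑ p ∈ residueIndex (r := r) v, residueSummand v p.1 p.2 := by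
  classical
  rw [detResidue, finsum_eq_sum_of_support_subset _ (residueTerm_support_subset v),
    Finset.sum_congr rfl fun e _ => residueTerm_eq v e, Finset.sum_comm]
  refine Finset.sum_congr rfl fun p hp => ?_
  rw [Finset.sum_ite_eq, if_pos (Finset.mem_image_of_mem _ hp)]

end VertexProducts

section CreatingHalf

open Finset.HasAntidiagonal

/-! ### The creating half in finitely many variables -/

section LogDerivative

variable {R : Type*} [CommRing R]

/-- The series `∑_{n > 0} xⁿ Xⁿ`. -/
def geomTail (x : R) : PowerSeries R := PowerSeries.mk fun n => if n = 0 then 0 else x ^ n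

theorem eulerOp_one_sub (x : R) :
    eulerOp (1 - PowerSeries.C x * PowerSeries.X) =
      -((1 - PowerSeries.C x * PowerSeries.X) * geomTail x) := by
  ext n
  rw [coeff_eulerOp, sub_mul, one_mul, mul_assoc]
  simp only [map_sub, map_neg, PowerSeries.coeff_C_mul, PowerSeries.coeff_one, PowerSeries.coeff_X,
    geomTail, PowerSeries.coeff_mk]
  rcases n with _ | _ | n
  · simp
  · simp [PowerSeries.coeff_succ_X_mul]
  · simp [PowerSeries.coeff_succ_X_mul]
    ring

theorem eulerOp_prod_one_sub {ι : Type*} (s : Finset ι) (x : ι → R) :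
    eulerOp (∏ i ∈ s, (1 - PowerSeries.C (x i) * PowerSeries.X)) =
      -((∏ i ∈ s, (1 - PowerSeries.C (x i) * PowerSeries.X)) * ∑ i ∈ s, geomTail (x i)) := by
  classical
  induction s using Finset.induction_on with
  | empty => simp [eulerOp_one]
  | insert a s ha ih =>
    rw [Finset.prod_insert ha, Finset.sum_insert ha, eulerOp_mul, ih, eulerOp_one_sub]
    ring

/-- The logarithmic derivative of `∏ (1 - τ xᵢ z)/(1 - xᵢ z)`. -/
theorem nsmul_coeff_quotient {ι : Type*} [Fintype ι] (x : ι → R) (τ : R) (Q : PowerSeries R)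
    (hQ : Q * ∏ i, (1 - PowerSeries.C (x i) * PowerSeries.X) =
      ∏ i, (1 - PowerSeries.C (τ * x i) * PowerSeries.X)) (m : ℕ) :
    m • PowerSeries.coeff m Q = ∑ p ∈ antidiagonal m,
      (if p.1 = 0 then 0 else (1 - τ ^ p.1) * ∑ i, x i ^ p.1) * PowerSeries.coeff p.2 Q := by
  have h1 := congrArg eulerOp hQ
  rw [eulerOp_mul, eulerOp_prod_one_sub, eulerOp_prod_one_sub, ← hQ] at h1
  have hu : IsUnit (∏ i, (1 - PowerSeries.C (x i) * PowerSeries.X)) := by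
    rw [PowerSeries.isUnit_iff_constantCoeff]
    simp
  have h2 : eulerOp Q = (∑ i, geomTail (x i) - ∑ i, geomTail (τ * x i)) * Q := by
    refine hu.mul_right_cancel ?_
    linear_combination h1
  rw [← coeff_eulerOp, h2, PowerSeries.coeff_mul]
  refine Finset.sum_congr rfl fun p _ => ?_
  congr 1
  rw [map_sub, map_sum, map_sum]
  simp only [geomTail, PowerSeries.coeff_mk]
  split_ifs with h
  · simp
  · rw [sub_mul, one_mul, Finset.mul_sum]
    simp only [mul_pow]

end LogDerivative

/-- The identification of the Fock space with symmetric functions, in `n` variables. -/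
def fockToPoly (n : ℕ) : Fock →ₐ[𝔽] MvPolynomial (Fin n) 𝔽 :=
  MvPolynomial.aeval fun k : ℕ+ => MvPolynomial.psum (Fin n) 𝔽 k

/-- In `n` variables, `η(z)₋` is the multiplication by `∏ (1 - t⁻¹ xᵢ z)/(1 - xᵢ z)`, the two having
the same logarithmic derivative. -/
theorem fockToPoly_etaMinus {n : ℕ} (Q : PowerSeries (MvPolynomial (Fin n) 𝔽))
    (hQ : Q * ∏ i, (1 - PowerSeries.C (MvPolynomial.X i) * PowerSeries.X) =
      ∏ i, (1 - PowerSeries.C (MvPolynomial.C t⁻¹ * MvPolynomial.X i) * PowerSeries.X))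
    (m : ℕ) (u : Fock) :
    fockToPoly n (etaMinus m u) = PowerSeries.coeff m Q * fockToPoly n u := by
  refine congrFun (eq_of_nsmul_eq_sum (fun m u => fockToPoly n (etaMinus m u))
    (fun m u => PowerSeries.coeff m Q * fockToPoly n u)
    (fun k u => (((1 - (t⁻¹) ^ k) / (k : 𝔽)) • heis (-(k : ℤ))) u) ?_ ?_ ?_ m) u
  · funext u
    rw [coeff_zero_quotient _ _ Q hQ, one_mul, etaMinus, expCoeff_zero, Module.End.one_apply]
  · intro m u
    change m • fockToPoly n (expCoeff _ m u) = _
    rw [← map_nsmul, nsmul_expCoeff_apply _ etaMinus_commute, map_sum]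
    refine Finset.sum_congr rfl fun p _ => ?_
    rw [map_nsmul]
    rfl
  · intro m u
    rw [← smul_mul_assoc, nsmul_coeff_quotient _ _ Q hQ, Finset.sum_mul]
    refine Finset.sum_congr rfl fun p _ => ?_
    by_cases h0 : p.1 = 0
    · rw [if_pos h0, h0, zero_smul, zero_mul, zero_mul]
    · obtain ⟨k, hk⟩ : ∃ k : ℕ+, (k : ℕ) = p.1 := ⟨⟨p.1, Nat.pos_of_ne_zero h0⟩, rfl⟩
      have hk0 : ((k : ℕ) : 𝔽) ≠ 0 := Nat.cast_ne_zero.2 k.ne_zero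
      have h1 : fockToPoly n (MvPolynomial.X k) = ∑ i, MvPolynomial.X i ^ (k : ℕ) :=
        MvPolynomial.aeval_X _ _
      rw [if_neg h0, ← hk, LinearMap.smul_apply, heis_neg_natCast, map_smul, map_mul, h1,
        ← Nat.cast_smul_eq_nsmul 𝔽, mul_smul_comm, smul_smul,
        div_mul_self_cancel (F := 𝔽) hk0, MvPolynomial.smul_eq_C_mul, map_sub, map_one, map_pow]
      ring

theorem fockToPoly_prod_etaMinus {n : ℕ} (Q : PowerSeries (MvPolynomial (Fin n) 𝔽))
    (hQ : Q * ∏ i, (1 - PowerSeries.C (MvPolynomial.X i) * PowerSeries.X) =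
      ∏ i, (1 - PowerSeries.C (MvPolynomial.C t⁻¹ * MvPolynomial.X i) * PowerSeries.X))
    {r : ℕ} (a : Fin r → ℕ) (u : Fock) :
    fockToPoly n ((List.ofFn fun i => etaMinus (a i)).prod u) =
      (∏ i, PowerSeries.coeff (a i) Q) * fockToPoly n u := by
  induction r with
  | zero => simp
  | succ r ih =>
    rw [List.ofFn_succ, List.prod_cons, Module.End.mul_apply, fockToPoly_etaMinus Q hQ, ih,
      Fin.prod_univ_succ, mul_assoc]

/-! ### The formal residue as a linear functional -/

section ResidueFunctional

variable {R : Type*} [CommRing R] {r : ℕ}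

/-- The residue of the product of a series with coefficients `d`, of `Q(z₁)⋯Q(z_r)` and of a
monomial in `1/z₁, …, 1/z_r`. Only exponents of total degree zero are taken into account. -/
def residueWeight (d : (Fin r → ℤ) → R) (Q : PowerSeries R) (b : Fin r → ℕ) : R :=
  ∑ a ∈ Finset.piAntidiag Finset.univ (∑ i, b i),
    d (fun i => (b i : ℤ) - a i - 1) * ∏ i, PowerSeries.coeff (a i) Q

/-- The residue of the product of a series with coefficients `d`, of `Q(z₁)⋯Q(z_r)` and of a
polynomial in `1/z₁, …, 1/z_r`. -/
def residueFunctional (d : (Fin r → ℤ) → R) (Q : PowerSeries R) :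
    MvPolynomial (Fin r) R →ₗ[R] R :=
  (MvPolynomial.basisMonomials (Fin r) R).constr R fun b => residueWeight d Q b

theorem residueFunctional_monomial (d : (Fin r → ℤ) → R) (Q : PowerSeries R) (b : Fin r →₀ ℕ)
    (c : R) :
    residueFunctional d Q (MvPolynomial.monomial b c) = c * residueWeight d Q b := by
  have h1 := (MvPolynomial.basisMonomials (Fin r) R).constr_basis R
    (fun b : Fin r →₀ ℕ => residueWeight d Q b) b
  rw [MvPolynomial.coe_basisMonomials] at h1
  have h2 : MvPolynomial.monomial b c = c • MvPolynomial.monomial b (1 : R) := by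
    rw [MvPolynomial.smul_monomial, smul_eq_mul, mul_one]
  rw [h2, map_smul, smul_eq_mul]
  exact congrArg (c * ·) h1

theorem residueFunctional_eq_sum (d : (Fin r → ℤ) → R) (Q : PowerSeries R)
    (G : MvPolynomial (Fin r) R) (s : Finset (Fin r →₀ ℕ)) (hs : G.support ⊆ s) :
    residueFunctional d Q G = ∑ b ∈ s, G.coeff b * residueWeight d Q b := by
  conv_lhs => rw [G.as_sum]
  rw [map_sum, Finset.sum_congr rfl fun b _ => residueFunctional_monomial d Q b _]
  refine Finset.sum_subset hs fun b _ hb => ?_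
  rw [MvPolynomial.notMem_support_iff.1 hb, zero_mul]

theorem map_residueFunctional {R' : Type*} [CommRing R'] (φ : R →+* R') (d : (Fin r → ℤ) → R)
    (Q : PowerSeries R) (G : MvPolynomial (Fin r) R) :
    φ (residueFunctional d Q G) =
      residueFunctional (fun e => φ (d e)) (Q.map φ) (MvPolynomial.map φ G) := by
  rw [residueFunctional_eq_sum d Q G _ subset_rfl,
    residueFunctional_eq_sum _ _ _ _ (MvPolynomial.support_map_subset φ G), map_sum]
  refine Finset.sum_congr rfl fun b _ => ?_
  simp [residueWeight, MvPolynomial.coeff_map]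

end ResidueFunctional

/-- In `n` variables, the formal residue is the functional with the coefficients of the determinant,
applied to the image of the vector under the action of the annihilating half. -/
theorem fockToPoly_detResidue {n : ℕ} (Q : PowerSeries (MvPolynomial (Fin n) 𝔽))
    (hQ : Q * ∏ i, (1 - PowerSeries.C (MvPolynomial.X i) * PowerSeries.X) =
      ∏ i, (1 - PowerSeries.C (MvPolynomial.C t⁻¹ * MvPolynomial.X i) * PowerSeries.X))
    (r : ℕ) (v : Fock) :
    fockToPoly n (detResidue r v) = residueFunctional (fun e => MvPolynomial.C (detCoeff e)) Q
      (MvPolynomial.map (fockToPoly n : Fock →+* MvPolynomial (Fin n) 𝔽) (multiShiftHom r v)) := by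
  classical
  rw [residueFunctional_eq_sum _ _ _ _ (MvPolynomial.support_map_subset _ _), detResidue_eq,
    map_sum, residueIndex, Finset.sum_biUnion]
  · refine Finset.sum_congr rfl fun b _ => ?_
    rw [Finset.sum_image (fun a _ a' _ h => congrArg Prod.fst h), residueWeight, Finset.mul_sum]
    refine Finset.sum_congr rfl fun a _ => ?_
    have hb : Finsupp.equivFunOnFinite.symm (b : Fin r → ℕ) = b := by ext i; rfl
    rw [residueSummand, map_smul, fockToPoly_prod_etaMinus Q hQ, prod_etaPlus_apply,
      MvPolynomial.coeff_map, MvPolynomial.smul_eq_C_mul, hb, RingHom.coe_coe]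
    ring
  · intro b _ b' _ hne
    rw [Function.onFun, Finset.disjoint_left]
    rintro _ h h'
    obtain ⟨a, -, rfl⟩ := Finset.mem_image.1 h
    obtain ⟨a', -, h2⟩ := Finset.mem_image.1 h'
    exact hne (DFunLike.coe_injective (congrArg Prod.snd h2).symm)

end CreatingHalf

/-! ### The residue of a product and Toeplitz minors -/

section Minors

variable {R : Type*} [CommRing R] {r : ℕ}

theorem toeplitzCoeff_eq_sum (τ : R) (Q : PowerSeries R) (g : Polynomial R) (k l : ℕ) :
    toeplitzCoeff τ Q g k l = ∑ b ∈ g.support, g.coeff b *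
      (τ ^ k * if k ≤ b + l then PowerSeries.coeff (b + l - k) Q else 0) := by
  have h : g * Polynomial.X ^ l = ∑ b ∈ g.support, Polynomial.monomial (b + l) (g.coeff b) := by
    conv_lhs => rw [g.as_sum_support]
    rw [Finset.sum_mul]
    exact Finset.sum_congr rfl fun b _ => Polynomial.monomial_mul_X_pow _ _ _
  rw [toeplitzCoeff, h, map_sum, Polynomial.finsetSum_coeff, Finset.mul_sum]
  refine Finset.sum_congr rfl fun b _ => ?_
  rw [coeff_contract, Polynomial.sum_monomial_index _ _ (by simp)]
  split_ifs
  · ring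
  · simp

theorem prod_aeval_X (g : Polynomial R) :
    ∏ i : Fin r, Polynomial.aeval (MvPolynomial.X (R := R) i) g =
      ∑ b ∈ Fintype.piFinset fun _ : Fin r => g.support,
        MvPolynomial.monomial (Finsupp.equivFunOnFinite.symm b) (∏ i, g.coeff (b i)) := by
  have h : ∀ i : Fin r, Polynomial.aeval (MvPolynomial.X (R := R) i) g =
      ∑ b ∈ g.support, MvPolynomial.C (g.coeff b) * MvPolynomial.X i ^ b := by
    intro i
    rw [Polynomial.aeval_def, Polynomial.eval₂_eq_sum, Polynomial.sum_def]
    rfl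
  simp only [h]
  rw [Finset.prod_univ_sum]
  refine Finset.sum_congr rfl fun b _ => ?_
  rw [Finset.prod_mul_distrib, MvPolynomial.monomial_eq,
    Finsupp.prod_fintype _ _ fun _ => pow_zero _, map_prod]
  rfl

/-- The truncated Leibniz formula for the determinant, modulo `τ ^ M`. -/
def detTrunc (τ : R) (M : ℕ) (e : Fin r → ℤ) : R :=
  open Classical in ∑ σ : Equiv.Perm (Fin r), ((Equiv.Perm.sign σ : ℤ) : R) *
    ∑ m : Fin r → Fin M, if IsSolution σ (fun j => e j + 1) fun i => m i then
      τ ^ ∑ i, (m i : ℕ) else 0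

/-- For given `m` and `σ`, the exponents of the residue are determined: `aⱼ = bⱼ + m_{σ⁻¹ j} - mⱼ`,
which contributes if it is nonnegative. -/
theorem residueWeight_detTrunc (τ : R) (M : ℕ) (Q : PowerSeries R) (b : Fin r → ℕ) :
    residueWeight (detTrunc τ M) Q b = ∑ m : Fin r → Fin M, ∑ σ : Equiv.Perm (Fin r),
      ((Equiv.Perm.sign σ : ℤ) : R) * ∏ j, (τ ^ (m j : ℕ) *
        if (m j : ℕ) ≤ b j + m (σ⁻¹ j) then PowerSeries.coeff (b j + m (σ⁻¹ j) - m j) Q else 0) := by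
  classical
  simp only [residueWeight, detTrunc]
  simp only [Finset.sum_mul, Finset.mul_sum]
  rw [Finset.sum_comm, Finset.sum_congr rfl fun σ _ => Finset.sum_comm, Finset.sum_comm]
  refine Finset.sum_congr rfl fun m _ => Finset.sum_congr rfl fun σ _ => ?_
  rw [Finset.prod_mul_distrib, Finset.prod_ite_zero, Finset.prod_pow_eq_pow_sum]
  have hiff : ∀ a : Fin r → ℕ, (IsSolution σ (fun j => (b j : ℤ) - a j - 1 + 1) fun i => (m i : ℕ)) ↔
      ∀ j, a j + m j = b j + m (σ⁻¹ j) := by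
    intro a
    refine forall_congr' fun j => ?_
    constructor <;> intro h
    · have h' : (((m j : ℕ) : ℤ)) - ((m (σ⁻¹ j) : ℕ) : ℤ) = b j - a j - 1 + 1 := h
      omega
    · have : ((a j + m j : ℕ) : ℤ) = (b j + m (σ⁻¹ j) : ℕ) := by rw [h]
      push_cast at this
      linarith
  split_ifs with h
  · rw [Finset.sum_eq_single fun j => b j + (m (σ⁻¹ j) : ℕ) - m j]
    · rw [if_pos]
      · ring
      · refine (hiff _).2 fun j => ?_
        have := h j (Finset.mem_univ j)
        omega
    · intro a _ ha
      rw [if_neg, mul_zero, zero_mul]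
      intro h'
      refine ha (funext fun j => ?_)
      have := (hiff a).1 h' j
      omega
    · intro hn
      refine absurd (Finset.mem_piAntidiag.2 ⟨?_, fun i _ => Finset.mem_univ i⟩) hn
      have h1 : ∑ j, (b j + (m (σ⁻¹ j) : ℕ) - m j) + ∑ j, (m j : ℕ) =
          ∑ j, b j + ∑ j, (m (σ⁻¹ j) : ℕ) := by
        rw [← Finset.sum_add_distrib, ← Finset.sum_add_distrib]
        refine Finset.sum_congr rfl fun j hj => ?_
        have := h j hj
        omega
      rw [Equiv.sum_comp σ⁻¹ fun j => (m j : ℕ)] at h1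
      exact Nat.add_right_cancel h1
  · rw [mul_zero, mul_zero]
    refine Finset.sum_eq_zero fun a _ => ?_
    rw [if_neg, mul_zero, zero_mul]
    intro h'
    refine h fun j _ => ?_
    have := (hiff a).1 h' j
    omega

/-- The residue of a product of polynomials in one variable each, for the truncated determinant, is
a sum of minors of a Toeplitz matrix. -/
theorem residueFunctional_detTrunc (τ : R) (M : ℕ) (Q : PowerSeries R) (g : Polynomial R) :
    residueFunctional (detTrunc τ M) Q
        (∏ i : Fin r, Polynomial.aeval (MvPolynomial.X (R := R) i) g) =
      ∑ m : Fin r → Fin M, (Matrix.of fun i j => toeplitzCoeff τ Q g (m i) (m j)).det := by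
  rw [prod_aeval_X, map_sum]
  simp only [residueFunctional_monomial, Finsupp.coe_equivFunOnFinite_symm, residueWeight_detTrunc,
    Finset.mul_sum]
  rw [Finset.sum_comm]
  refine Finset.sum_congr rfl fun m _ => ?_
  rw [Matrix.det_apply', Finset.sum_comm]
  refine Finset.sum_congr rfl fun σ _ => ?_
  simp only [Matrix.of_apply]
  rw [← Equiv.prod_comp σ⁻¹ fun i => toeplitzCoeff τ Q g (m (σ i)) (m i)]
  have hσ : ∀ j, σ (σ⁻¹ j) = j := fun j => by simp
  simp only [hσ, toeplitzCoeff_eq_sum]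
  rw [Finset.prod_univ_sum, Finset.mul_sum]
  refine Finset.sum_congr rfl fun b _ => ?_
  rw [mul_left_comm, ← Finset.prod_mul_distrib]

theorem pow_dvd_residueFunctional_sub (τ : R) (M : ℕ) (d : (Fin r → ℤ) → R)
    (hd : ∀ e, τ ^ M ∣ d e - detTrunc τ M e) (Q : PowerSeries R) (G : MvPolynomial (Fin r) R) :
    τ ^ M ∣ residueFunctional d Q G - residueFunctional (detTrunc τ M) Q G := by
  rw [residueFunctional_eq_sum d Q G _ subset_rfl, residueFunctional_eq_sum _ Q G _ subset_rfl,
    ← Finset.sum_sub_distrib]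
  refine Finset.dvd_sum fun b _ => ?_
  rw [← mul_sub, residueWeight, residueWeight, ← Finset.sum_sub_distrib]
  refine Dvd.dvd.mul_left (Finset.dvd_sum fun a _ => ?_) _
  rw [← sub_mul]
  exact Dvd.dvd.mul_right (hd _) _

end Minors

/-! ### Polarization -/

/-- Ryser's formula for the permanent. -/
theorem sum_perm_prod_eq {R : Type*} [CommRing R] {r : ℕ} (f : Fin r → Fin r → R) :
    ∑ σ : Equiv.Perm (Fin r), ∏ i, f (σ i) i =
      ∑ s : Finset (Fin r), (-1) ^ (r - s.card) * ∏ i, ∑ j ∈ s, f j i := by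
  classical
  have h1 : ∀ s : Finset (Fin r), ∏ i, ∑ j ∈ s, f j i =
      ∑ h : Fin r → Fin r, if Finset.univ.image h ⊆ s then ∏ i, f (h i) i else 0 := by
    intro s
    rw [Finset.prod_univ_sum, ← Finset.sum_filter]
    refine Finset.sum_congr ?_ fun _ _ => rfl
    ext h
    simp [Finset.image_subset_iff]
  simp only [h1, Finset.mul_sum]
  rw [Finset.sum_comm]
  have h2 : ∀ h : Fin r → Fin r, ∑ s : Finset (Fin r), (-1 : R) ^ (r - s.card) *
      (if Finset.univ.image h ⊆ s then ∏ i, f (h i) i else 0) =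
      if Function.Surjective h then ∏ i, f (h i) i else 0 := by
    intro h
    simp only [mul_ite, mul_zero]
    rw [← Finset.sum_filter, ← Finset.sum_mul]
    have h3 : ∑ s with Finset.univ.image h ⊆ s, (-1 : R) ^ (r - s.card) =
        ∑ u ∈ (Finset.univ.image h)ᶜ.powerset, (-1 : R) ^ u.card := by
      refine Finset.sum_bij' (fun s _ => sᶜ) (fun u _ => uᶜ) ?_ ?_ ?_ ?_ ?_
      · intro s hs
        exact Finset.mem_powerset.2 (Finset.compl_subset_compl.2 (Finset.mem_filter.1 hs).2)
      · intro u hu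
        refine Finset.mem_filter.2 ⟨Finset.mem_univ _, ?_⟩
        simpa using Finset.compl_subset_compl.2 (Finset.mem_powerset.1 hu)
      · simp
      · simp
      · intro s _
        rw [Finset.card_compl, Fintype.card_fin]
    have h4 := congrArg (Int.cast : ℤ → R)
      (Finset.sum_powerset_neg_one_pow_card (x := (Finset.univ.image h)ᶜ))
    push_cast at h4
    have h5 : (Finset.univ.image h)ᶜ = ∅ ↔ Function.Surjective h := by
      rw [Finset.compl_eq_empty_iff, Finset.eq_univ_iff_forall]
      simp [Function.Surjective]
    rw [h3, h4]
    simp only [h5, ite_mul, one_mul, zero_mul]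
  rw [Finset.sum_congr rfl fun h _ => h2 h, ← Finset.sum_filter]
  symm
  refine Finset.sum_bij_ne_zero (fun h hh _ => Equiv.ofBijective h
    (Finite.surjective_iff_bijective.1 (Finset.mem_filter.1 hh).2)) ?_ ?_ ?_ ?_
  · intro h hh _
    exact Finset.mem_univ _
  · intro h hh _ h' hh' _ he
    exact congrArg DFunLike.coe he
  · intro σ _ h0
    exact ⟨σ, Finset.mem_filter.2 ⟨Finset.mem_univ _, σ.surjective⟩, h0, by ext; rfl⟩
  · intro h hh _
    rfl

/-- The symmetrization of a monomial is a permanent, which Ryser's formula writes in terms of products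
`g(w₁)⋯g(w_r)`. -/
theorem factorial_nsmul_eq_of_isSymmetric {R : Type*} [CommRing R] {r : ℕ}
    (G : MvPolynomial (Fin r) R) (hG : G.IsSymmetric) :
    r.factorial • G = ∑ b ∈ G.support, G.coeff b • ∑ s : Finset (Fin r),
      ((-1 : R) ^ (r - s.card)) • ∏ i : Fin r,
        Polynomial.aeval (MvPolynomial.X (R := R) i) (∑ j ∈ s, (Polynomial.X : Polynomial R) ^ b j) := by
  have h1 : r.factorial • G = ∑ σ : Equiv.Perm (Fin r), MvPolynomial.rename σ G := by
    rw [Finset.sum_congr rfl fun σ _ => hG σ]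
    simp [Fintype.card_perm]
  have h2 : ∀ σ : Equiv.Perm (Fin r), MvPolynomial.rename (σ⁻¹ : Equiv.Perm (Fin r)) G =
      ∑ b ∈ G.support, G.coeff b • ∏ i, MvPolynomial.X (R := R) i ^ b (σ i) := by
    intro σ
    conv_lhs => rw [G.as_sum]
    rw [map_sum]
    refine Finset.sum_congr rfl fun b _ => ?_
    rw [MvPolynomial.monomial_eq, Finsupp.prod_fintype _ _ fun _ => pow_zero _, map_mul,
      MvPolynomial.rename_C, MvPolynomial.smul_eq_C_mul, map_prod,
      ← Equiv.prod_comp σ fun i => MvPolynomial.rename (σ⁻¹ : Equiv.Perm (Fin r)) (MvPolynomial.X (R := R) i ^ b i)]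
    simp
  rw [h1, ← Equiv.sum_comp (Equiv.inv (Equiv.Perm (Fin r)))]
  simp only [Equiv.inv_apply, h2]
  rw [Finset.sum_comm]
  refine Finset.sum_congr rfl fun b _ => ?_
  rw [← Finset.smul_sum,
    sum_perm_prod_eq fun j i : Fin r => MvPolynomial.X (R := R) i ^ b j]
  congr 1
  refine Finset.sum_congr rfl fun s _ => ?_
  rw [MvPolynomial.smul_eq_C_mul]
  simp

/-- A linear functional on symmetric polynomials is determined by its values on products
`g(w₁)⋯g(w_r)`, where `g` is a sum of monomials. -/
theorem linearMap_eq_of_isSymmetric {R N : Type*} [CommRing R] [AddCommGroup N] [Module R N] {r : ℕ}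
    (hN : ∀ x y : N, r.factorial • x = r.factorial • y → x = y)
    (Λ Ψ : MvPolynomial (Fin r) R →ₗ[R] N)
    (h : ∀ (s : Finset (Fin r)) (c : Fin r → ℕ),
      Λ (∏ i : Fin r, Polynomial.aeval (MvPolynomial.X (R := R) i) (∑ j ∈ s, (Polynomial.X : Polynomial R) ^ c j)) =
      Ψ (∏ i : Fin r, Polynomial.aeval (MvPolynomial.X (R := R) i) (∑ j ∈ s, (Polynomial.X : Polynomial R) ^ c j)))
    (G : MvPolynomial (Fin r) R) (hG : G.IsSymmetric) : Λ G = Ψ G := by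
  refine hN _ _ ?_
  rw [← map_nsmul, ← map_nsmul, factorial_nsmul_eq_of_isSymmetric G hG]
  rw [map_sum, map_sum]
  refine Finset.sum_congr rfl fun b _ => ?_
  rw [map_smul, map_smul, map_sum, map_sum]
  congr 1
  refine Finset.sum_congr rfl fun s _ => ?_
  rw [map_smul, map_smul, h]

/-! ### The functional of the Macdonald operators -/

theorem prod_getD {A N : Type*} [CommMonoid N] (f : A → N) (a : A) : ∀ (l : List A) {r : ℕ},
    l.length ≤ r → ∏ i : Fin r, f (l.getD i a) = (l.map f).prod * f a ^ (r - l.length)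
  | [], r, _ => by simp
  | b :: l, 0, h => by simp at h
  | b :: l, r + 1, h => by
    rw [Fin.prod_univ_succ]
    have := prod_getD f a l (r := r) (by simpa using h)
    simp only [Fin.val_succ, List.getD_cons_succ, this]
    simp [mul_assoc]

theorem sum_getD {A N : Type*} [AddCommMonoid N] (f : A → N) (a : A) (ha : f a = 0) :
    ∀ (l : List A) {r : ℕ}, l.length ≤ r → ∑ i : Fin r, f (l.getD i a) = (l.map f).sum
  | [], r, _ => by simp [ha]
  | b :: l, 0, h => by simp at h
  | b :: l, r + 1, h => by
    rw [Fin.sum_univ_succ]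
    have := sum_getD f a ha l (r := r) (by simpa using h)
    simp only [Fin.val_succ, List.getD_cons_succ, this]
    simp

/-- The point with coordinates `xⱼ`, `j ∈ s`, and zeros. -/
def paddedPoint {n : ℕ} (r : ℕ) (s : Finset (Fin n)) (i : Fin r) : MvPolynomial (Fin n) 𝔽 :=
  (s.toList.map MvPolynomial.X).getD i 0

theorem prod_paddedPoint {n r : ℕ} {N : Type*} [CommMonoid N] (f : MvPolynomial (Fin n) 𝔽 → N)
    (s : Finset (Fin n)) (hs : s.card ≤ r) :
    ∏ i, f (paddedPoint r s i) = (∏ j ∈ s, f (MvPolynomial.X j)) * f 0 ^ (r - s.card) := by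
  refine (prod_getD f 0 (s.toList.map MvPolynomial.X) (r := r) (by simpa using hs)).trans ?_
  rw [List.map_map, Finset.prod_map_toList]
  simp

theorem sum_paddedPoint {n r : ℕ} {N : Type*} [AddCommMonoid N] (f : MvPolynomial (Fin n) 𝔽 → N)
    (hf : f 0 = 0) (s : Finset (Fin n)) (hs : s.card ≤ r) :
    ∑ i, f (paddedPoint r s i) = ∑ j ∈ s, f (MvPolynomial.X j) := by
  refine (sum_getD f 0 hf (s.toList.map MvPolynomial.X) (r := r) (by simpa using hs)).trans ?_
  rw [List.map_map, Finset.sum_map_toList]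
  rfl

/-- The `q`-shifts of the variables with index in `s` are obtained from the action of the annihilating
half by specializing the variables of the latter. -/
theorem aeval_paddedPoint_multiShiftHom {n r : ℕ} (s : Finset (Fin n)) (hs : s.card ≤ r) (v : Fock) :
    MvPolynomial.aeval (paddedPoint r s) (MvPolynomial.map
      (fockToPoly n : Fock →+* MvPolynomial (Fin n) 𝔽) (multiShiftHom r v)) =
      qShift s (fockToPoly n v) := by
  refine congrArg (fun f : Fock →ₐ[𝔽] MvPolynomial (Fin n) 𝔽 => f v)
    (MvPolynomial.algHom_ext
      (f := ((MvPolynomial.aeval (R := MvPolynomial (Fin n) 𝔽) (paddedPoint r s)).restrictScalars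
        𝔽).comp ((MvPolynomial.mapAlgHom (fockToPoly n)).comp (multiShiftHom r)))
      (g := (qShift s).comp (fockToPoly n)) fun k => ?_)
  change MvPolynomial.aeval (paddedPoint r s) (MvPolynomial.map
      (fockToPoly n : Fock →+* MvPolynomial (Fin n) 𝔽) (multiShiftHom r _)) = qShift s (fockToPoly n _)
  have h1 : fockToPoly n (MvPolynomial.C (q ^ (k : ℕ) - 1)) = MvPolynomial.C (q ^ (k : ℕ) - 1) :=
    (fockToPoly n).commutes _
  have h2 : fockToPoly n (MvPolynomial.X k) = ∑ i, MvPolynomial.X i ^ (k : ℕ) :=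
    MvPolynomial.aeval_X _ _
  rw [multiShiftHom, MvPolynomial.aeval_X, map_add, map_mul, MvPolynomial.map_C, MvPolynomial.map_C,
    RingHom.coe_coe, h1, h2, map_add, map_mul, MvPolynomial.psum]
  simp only [map_sum, map_pow, MvPolynomial.map_X, MvPolynomial.aeval_X, MvPolynomial.aeval_C,
    Algebra.algebraMap_self, RingHom.id_apply]
  rw [sum_paddedPoint (fun y => y ^ (k : ℕ)) (zero_pow k.ne_zero) s hs, Finset.mul_sum]
  have h3 : ∀ i : Fin n, qShift s (MvPolynomial.X i) ^ (k : ℕ) = MvPolynomial.X i ^ (k : ℕ) +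
      if i ∈ s then MvPolynomial.C (q ^ (k : ℕ) - 1) * MvPolynomial.X i ^ (k : ℕ) else 0 := by
    intro i
    rw [qShift, MvPolynomial.aeval_X]
    split_ifs
    · rw [MvPolynomial.smul_eq_C_mul, mul_pow, map_sub, map_one, map_pow]
      ring
    · rw [add_zero]
  simp only [h3]
  rw [Finset.sum_add_distrib, Finset.sum_ite_mem, Finset.univ_inter]

/-- The functional on symmetric polynomials which gives the Macdonald operators. Its values are
rational functions a priori. -/
def macdonaldFunctional (n r : ℕ) :
    MvPolynomial (Fin r) (MvPolynomial (Fin n) 𝔽) →ₗ[MvPolynomial (Fin n) 𝔽] RatField n :=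
  ∑ k ∈ Finset.range (r + 1), ∑ s ∈ Finset.univ.powersetCard k,
    ((r.factorial : RatField n) * (algebraMap 𝔽 (RatField n) t⁻¹ ^ k.choose 2 *
      (∏ j ∈ s, ∏ i ∈ sᶜ, (ratX j - algebraMap 𝔽 (RatField n) t⁻¹ * ratX i) / (ratX j - ratX i))) *
      ((algebraMap 𝔽 (RatField n) t⁻¹ ^ n) ^ (r - k) *
        eulerCoeff (algebraMap 𝔽 (RatField n) t⁻¹) (r - k))) •
    ((Algebra.linearMap (MvPolynomial (Fin n) 𝔽) (RatField n)) ∘ₗ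
      (MvPolynomial.aeval (R := MvPolynomial (Fin n) 𝔽) (paddedPoint r s)).toLinearMap)

/-! ### The comparison of the functionals -/

theorem map_detTrunc {R R' : Type*} [CommRing R] [CommRing R'] (φ : R →+* R') {r : ℕ} (τ : R) (M : ℕ)
    (e : Fin r → ℤ) : φ (detTrunc τ M e) = detTrunc (φ τ) M e := by
  classical
  rw [detTrunc, detTrunc, map_sum]
  refine Finset.sum_congr rfl fun σ _ => ?_
  rw [map_mul, map_intCast, map_sum]
  congr 1
  refine Finset.sum_congr rfl fun m _ => ?_
  split_ifs <;> simp

/-- Polynomials with coefficients in the valuation ring of the place `t = ∞`. -/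
def integralToPoly (n : ℕ) : MvPolynomial (Fin n) TInvInt →+* MvPolynomial (Fin n) 𝔽 :=
  MvPolynomial.map vInf.integer.subtype

theorem integralToPoly_injective (n : ℕ) : Function.Injective (integralToPoly n) :=
  MvPolynomial.map_injective _ Subtype.val_injective

theorem X_sub_C_mul_X_ne_zero {n : ℕ} (i j : Fin n) :
    (MvPolynomial.X j - MvPolynomial.C tau * MvPolynomial.X i : MvPolynomial (Fin n) TInvInt) ≠ 0 := by
  intro h
  have h1 := congrArg (MvPolynomial.coeff (Finsupp.single j 1)) h
  rw [MvPolynomial.coeff_sub, MvPolynomial.coeff_C_mul, MvPolynomial.coeff_X,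
    MvPolynomial.coeff_X, MvPolynomial.coeff_zero, if_pos rfl] at h1
  by_cases hij : i = j
  · rw [hij, if_pos rfl, mul_one] at h1
    have h2 := isUnit_one_sub_tau_pow (a := 1) le_rfl
    rw [pow_one, h1] at h2
    exact not_isUnit_zero h2
  · rw [if_neg] at h1
    · simp at h1
    · intro h2
      exact hij (Finsupp.single_left_injective one_ne_zero h2)

theorem map_prod_aeval_X {R R' : Type*} [CommRing R] [CommRing R'] (φ : R →+* R') {r : ℕ}
    (g : Polynomial R) :
    MvPolynomial.map φ (∏ i : Fin r, Polynomial.aeval (MvPolynomial.X (R := R) i) g) =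
      ∏ i : Fin r, Polynomial.aeval (MvPolynomial.X (R := R') i) (g.map φ) := by
  rw [map_prod]
  refine Finset.prod_congr rfl fun i _ => ?_
  rw [Polynomial.aeval_def, Polynomial.aeval_def, Polynomial.eval₂_map, Polynomial.hom_eval₂,
    MvPolynomial.map_X]
  congr 1
  ext
  simp [MvPolynomial.algebraMap_eq]

theorem aeval_prod_aeval_X {R : Type*} [CommRing R] {r : ℕ} (y : Fin r → R) (g : Polynomial R) :
    MvPolynomial.aeval y (∏ i : Fin r, Polynomial.aeval (MvPolynomial.X (R := R) i) g) =
      ∏ i, g.eval (y i) := by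
  rw [map_prod]
  refine Finset.prod_congr rfl fun i _ => ?_
  rw [← Polynomial.aeval_algHom_apply, MvPolynomial.aeval_X, Polynomial.coe_aeval_eq_eval]

/-- The zeros of `paddedPoint` contribute `g(0)^{r-k}`. -/
theorem macdonaldFunctional_prod (n r : ℕ) (g : Polynomial (MvPolynomial (Fin n) 𝔽)) :
    macdonaldFunctional n r
        (∏ i : Fin r, Polynomial.aeval (MvPolynomial.X (R := MvPolynomial (Fin n) 𝔽) i) g) =
      r.factorial * ∑ k ∈ Finset.range (r + 1), (∑ s ∈ Finset.univ.powersetCard k,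
        algebraMap 𝔽 (RatField n) t⁻¹ ^ k.choose 2 *
        (∏ j ∈ s, ∏ i ∈ sᶜ, (ratX j - algebraMap 𝔽 (RatField n) t⁻¹ * ratX i) / (ratX j - ratX i)) *
        ∏ j ∈ s, algebraMap _ (RatField n) (g.eval (MvPolynomial.X j))) *
      ((algebraMap 𝔽 (RatField n) t⁻¹ ^ n * algebraMap _ (RatField n) (g.eval 0)) ^ (r - k) *
        eulerCoeff (algebraMap 𝔽 (RatField n) t⁻¹) (r - k)) := by
  rw [macdonaldFunctional, LinearMap.sum_apply, Finset.mul_sum]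
  refine Finset.sum_congr rfl fun k hk => ?_
  rw [LinearMap.sum_apply, Finset.sum_mul, Finset.mul_sum]
  refine Finset.sum_congr rfl fun s hs => ?_
  rw [LinearMap.smul_apply, LinearMap.comp_apply, AlgHom.toLinearMap_apply, aeval_prod_aeval_X,
    prod_paddedPoint (fun y => g.eval y) s, (Finset.mem_powersetCard.1 hs).2,
    Algebra.linearMap_apply, map_mul, map_pow, map_prod, smul_eq_mul, mul_pow]
  · ring
  · rw [(Finset.mem_powersetCard.1 hs).2]
    exact Nat.lt_succ_iff.1 (Finset.mem_range.1 hk)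

/-- The functionals agree on products `g(w₁)⋯g(w_r)` with coefficients in the valuation ring of the
place `t = ∞`, where `toeplitz_minors_limit` applies: the residue is congruent modulo `τ ^ M` to the
one for the truncated determinant. -/
theorem residueFunctional_prod (n r : ℕ) (Q : PowerSeries (MvPolynomial (Fin n) TInvInt))
    (hQ : Q * ∏ i, (1 - PowerSeries.C (MvPolynomial.X i) * PowerSeries.X) =
      ∏ i, (1 - PowerSeries.C (MvPolynomial.C tau * MvPolynomial.X i) * PowerSeries.X))
    (g : Polynomial (MvPolynomial (Fin n) TInvInt)) :
    algebraMap _ (RatField n) (residueFunctional (fun e => MvPolynomial.C (detCoeff e))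
      (Q.map (integralToPoly n)) (∏ i : Fin r, Polynomial.aeval
        (MvPolynomial.X (R := MvPolynomial (Fin n) 𝔽) i) (g.map (integralToPoly n)))) =
    macdonaldFunctional n r (∏ i : Fin r, Polynomial.aeval
        (MvPolynomial.X (R := MvPolynomial (Fin n) 𝔽) i) (g.map (integralToPoly n))) := by
  let : Algebra (MvPolynomial (Fin n) TInvInt) (RatField n) :=
    ((algebraMap (MvPolynomial (Fin n) 𝔽) (RatField n)).comp (integralToPoly n)).toAlgebra
  have halg : ∀ y, algebraMap (MvPolynomial (Fin n) TInvInt) (RatField n) y =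
      algebraMap (MvPolynomial (Fin n) 𝔽) (RatField n) (integralToPoly n y) := fun y => rfl
  have h1 := toeplitz_minors_limit (R := MvPolynomial (Fin n) TInvInt) (K := RatField n)
    ((IsFractionRing.injective (MvPolynomial (Fin n) 𝔽) (RatField n)).comp
      (integralToPoly_injective n)) (MvPolynomial.C tau) ?_ ?_ MvPolynomial.X
    (MvPolynomial.X_injective) (fun i j => X_sub_C_mul_X_ne_zero i j) Q hQ g r
    (residueFunctional (fun e => MvPolynomial.C (detCoeffInt e)) Q
      (∏ i : Fin r, Polynomial.aeval (MvPolynomial.X (R := MvPolynomial (Fin n) TInvInt) i) g)) ?_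
  · have hC : ∀ y : TInvInt, integralToPoly n (MvPolynomial.C y) = MvPolynomial.C (y : 𝔽) :=
      fun y => MvPolynomial.map_C _ _
    have hX : ∀ i, integralToPoly n (MvPolynomial.X i) = MvPolynomial.X i :=
      fun i => MvPolynomial.map_X _ _
    have hτ : algebraMap (MvPolynomial (Fin n) 𝔽) (RatField n) (MvPolynomial.C t⁻¹) =
      algebraMap 𝔽 (RatField n) t⁻¹ := rfl
    rw [halg, map_residueFunctional, map_prod_aeval_X] at h1
    simp only [hC] at h1
    refine h1.trans ?_
    rw [macdonaldFunctional_prod]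
    simp only [halg, hC, hX, Fintype.card_fin]
    have htau : ((tau : TInvInt) : 𝔽) = t⁻¹ := rfl
    have he : ∀ j, (g.map (integralToPoly n)).eval (MvPolynomial.X j) =
        integralToPoly n (g.eval (MvPolynomial.X j)) := fun j => by
      rw [← hX, Polynomial.eval_map, Polynomial.eval₂_at_apply]
    have he0 : (g.map (integralToPoly n)).eval 0 = integralToPoly n (g.coeff 0) := by
      rw [← Polynomial.coeff_zero_eq_eval_zero, Polynomial.coeff_map]
    simp only [htau, hτ, he, he0]
    rfl
  · intro d hd
    ext m
    rw [MvPolynomial.coeff_zero]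
    refine congrArg Subtype.val (eq_zero_of_tau_pow_dvd fun M => ?_)
    have h2 := hd M
    rw [← map_pow, MvPolynomial.C_dvd_iff_dvd_coeff] at h2
    exact h2 m
  · intro i
    have h2 := (isUnit_one_sub_tau_pow (Nat.succ_pos i)).map (MvPolynomial.C (σ := Fin n))
    simpa using h2
  · intro M
    rw [← residueFunctional_detTrunc]
    refine pow_dvd_residueFunctional_sub _ M _ (fun e => ?_) _ _
    rw [← map_detTrunc, ← map_sub, ← map_pow]
    exact map_dvd _ (tau_pow_dvd_detCoeffInt_sub e M)

/-- The formal residue agrees with the functional of the Macdonald operators on symmetric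
polynomials. -/
theorem residueFunctional_eq_macdonaldFunctional (n r : ℕ)
    (Q : PowerSeries (MvPolynomial (Fin n) 𝔽))
    (hQ : Q * ∏ i, (1 - PowerSeries.C (MvPolynomial.X i) * PowerSeries.X) =
      ∏ i, (1 - PowerSeries.C (MvPolynomial.C t⁻¹ * MvPolynomial.X i) * PowerSeries.X))
    (G : MvPolynomial (Fin r) (MvPolynomial (Fin n) 𝔽)) (hG : G.IsSymmetric) :
    algebraMap _ (RatField n) (residueFunctional (fun e => MvPolynomial.C (detCoeff e)) Q G) =
      macdonaldFunctional n r G := by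
  obtain ⟨Q', hQ'⟩ := exists_quotient (fun i : Fin n => MvPolynomial.X (R := TInvInt) i)
    (MvPolynomial.C tau)
  have hmap : ∀ (f : Fin n → MvPolynomial (Fin n) TInvInt),
      (∏ i, (1 - PowerSeries.C (f i) * PowerSeries.X)).map (integralToPoly n) =
        ∏ i, (1 - PowerSeries.C (integralToPoly n (f i)) * PowerSeries.X) := fun f => by
    simp [map_prod]
  have hQQ : Q'.map (integralToPoly n) = Q := by
    have hu : IsUnit (∏ i : Fin n, (1 - PowerSeries.C (MvPolynomial.X (R := 𝔽) i) *
        PowerSeries.X)) := by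
      rw [PowerSeries.isUnit_iff_constantCoeff]
      simp
    refine hu.mul_right_cancel ?_
    have h := congrArg (PowerSeries.map (integralToPoly n)) hQ'
    rw [map_mul, hmap, hmap] at h
    simp only [map_mul, integralToPoly, MvPolynomial.map_X, MvPolynomial.map_C] at h
    rw [hQ]
    simp only [map_mul]
    exact h
  subst hQQ
  refine linearMap_eq_of_isSymmetric (R := MvPolynomial (Fin n) 𝔽) (N := RatField n)
    (fun x y h => eq_of_nsmul_eq (F := 𝔽) r.factorial_ne_zero h)
    ((Algebra.linearMap _ (RatField n)) ∘ₗ residueFunctional (fun e => MvPolynomial.C (detCoeff e))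
      (Q'.map (integralToPoly n))) (macdonaldFunctional n r) (fun s c => ?_) G hG
  have h := residueFunctional_prod n r Q' hQ' (∑ j ∈ s, Polynomial.X ^ c j)
  simp only [Polynomial.map_sum, Polynomial.map_pow, Polynomial.map_X] at h
  exact h

theorem two_mul_choose_two_add (k : ℕ) : 2 * k.choose 2 + k = k * k := by
  induction k with
  | zero => simp
  | succ k ih =>
    rw [Nat.choose_succ_succ' k 1, Nat.choose_one_right]
    linarith

/-- The powers of `t⁻¹` in a summand of the residue: `t^{-r}`, the minor of the Cauchy kernel, the
factors `t⁻¹` taken out of it, the complementary block, and Euler's coefficient; they amount to the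
power of `t⁻¹` in `E_r` times `t^{k(k-1)/2}`, the power of `t` in `D_k`. -/
theorem exponent_identity {n r k : ℕ} (hk : k ≤ r) (hn : k ≤ n) :
    r + k.choose 2 + k * (n - k) + n * (r - k) + (r - k).choose 2 + k.choose 2 =
      n * r + (r - k + 1).choose 2 := by
  obtain ⟨u, rfl⟩ := Nat.exists_eq_add_of_le hk
  obtain ⟨w, rfl⟩ := Nat.exists_eq_add_of_le hn
  have h := two_mul_choose_two_add k
  rw [Nat.add_sub_cancel_left, Nat.add_sub_cancel_left, Nat.choose_succ_succ' u 1,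
    Nat.choose_one_right]
  nlinarith

theorem prod_sub_inv_mul_div {K ι : Type*} [Field K] [Fintype ι] [DecidableEq ι] {T : K} (hT : T ≠ 0)
    (x : ι → K) (s : Finset ι) :
    ∏ j ∈ s, ∏ i ∈ sᶜ, (x j - T⁻¹ * x i) / (x j - x i) =
      T⁻¹ ^ (s.card * (Fintype.card ι - s.card)) *
        ∏ j ∈ s, ∏ i ∈ sᶜ, (T * x j - x i) / (x j - x i) := by
  have h : ∀ i j, (x j - T⁻¹ * x i) / (x j - x i) = T⁻¹ * ((T * x j - x i) / (x j - x i)) := by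
    intro i j
    rw [← mul_div_assoc, mul_sub, inv_mul_cancel_left₀ hT]
  simp only [h, Finset.prod_mul_distrib, Finset.prod_const, Finset.card_compl]
  rw [← pow_mul, mul_comm (Fintype.card ι - _)]

/-- The comparison of a summand of the functional with a summand of the Macdonald operator. -/
theorem macdonald_summand {K : Type*} [Field K] {T : K} (hT : T ≠ 0) {n r k : ℕ} (hk : k ≤ r)
    (hn : k ≤ n) (P F : K) :
    T⁻¹ ^ r * (T⁻¹ ^ k.choose 2 * (T⁻¹ ^ (k * (n - k)) * P) *
        ((T⁻¹ ^ n) ^ (r - k) * eulerCoeff T⁻¹ (r - k)) * F) =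
      T⁻¹ ^ (n * r + (r - k + 1).choose 2) / (∏ i ∈ Finset.range (r - k), (1 - T⁻¹ * T⁻¹ ^ i)) *
        (T ^ (k * (k - 1) / 2) * (P * F)) := by
  have h1 : T⁻¹ ^ k.choose 2 * T ^ k.choose 2 = 1 := inv_pow_mul_pow_self hT _
  rw [← Nat.choose_two_right, ← exponent_identity hk hn, eulerCoeff]
  simp only [pow_succ' T⁻¹, ← pow_mul, pow_add]
  linear_combination (-(T⁻¹ ^ r * T⁻¹ ^ k.choose 2 * T⁻¹ ^ (k * (n - k)) * T⁻¹ ^ (n * (r - k)) *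
    T⁻¹ ^ (r - k).choose 2 / (∏ i ∈ Finset.range (r - k), (1 - T⁻¹ * T⁻¹ ^ i)) * (P * F))) * h1

/-- The functional, at the polynomial attached to a vector, gives the Macdonald operator. -/
theorem macdonaldFunctional_eq (n r : ℕ) (v : Fock) :
    (t⁻¹ ^ r / (r.factorial : 𝔽)) • macdonaldFunctional n r (MvPolynomial.map
      (fockToPoly n : Fock →+* MvPolynomial (Fin n) 𝔽) (multiShiftHom r v)) =
      macdonaldEFin r n (fockToPoly n v) := by
  have hinv : algebraMap 𝔽 (RatField n) t⁻¹ = (algebraMap 𝔽 (RatField n) t)⁻¹ :=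
    map_inv₀ (algebraMap 𝔽 (RatField n)) t
  have hdiv : ∀ a b : 𝔽, algebraMap 𝔽 (RatField n) (a / b) =
      algebraMap 𝔽 (RatField n) a / algebraMap 𝔽 (RatField n) b :=
    fun a b => map_div₀ (algebraMap 𝔽 (RatField n)) a b
  have hpow : ∀ k, algebraMap 𝔽 (RatField n) (t⁻¹ ^ k) = (algebraMap 𝔽 (RatField n) t)⁻¹ ^ k :=
    fun k => by rw [map_pow, hinv]
  have hinj : Function.Injective (algebraMap 𝔽 (RatField n)) :=
    (IsFractionRing.injective (MvPolynomial (Fin n) 𝔽) (RatField n)).comp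
      (MvPolynomial.C_injective (Fin n) 𝔽)
  have hT : algebraMap 𝔽 (RatField n) t ≠ 0 := fun h =>
    t_ne_zero (hinj (h.trans (map_zero _).symm))
  have hfac : (r.factorial : RatField n) ≠ 0 := fun h => by
    have h1 : algebraMap 𝔽 (RatField n) (r.factorial : 𝔽) = algebraMap 𝔽 (RatField n) 0 := by
      rw [map_natCast, map_zero, h]
    exact r.factorial_ne_zero (Nat.cast_eq_zero.1 (hinj h1))
  rw [macdonaldFunctional, macdonaldEFin, LinearMap.sum_apply, Finset.smul_sum]
  refine Finset.sum_congr rfl fun k hk => ?_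
  have hk' := Nat.lt_succ_iff.1 (Finset.mem_range.1 hk)
  rw [LinearMap.sum_apply, macdonaldD, Finset.smul_sum, Finset.smul_sum, Finset.smul_sum]
  refine Finset.sum_congr rfl fun s hs => ?_
  have hs' := (Finset.mem_powersetCard.1 hs).2
  have hn : k ≤ n := by
    have h := Finset.card_le_univ s
    rwa [hs', Fintype.card_fin] at h
  have hpoch : algebraMap 𝔽 (RatField n) (qPochhammer t⁻¹ t⁻¹ (r - k)) =
      ∏ i ∈ Finset.range (r - k), (1 - (algebraMap 𝔽 (RatField n) t)⁻¹ *
        (algebraMap 𝔽 (RatField n) t)⁻¹ ^ i) := by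
    rw [qPochhammer, map_prod]
    refine Finset.prod_congr rfl fun i _ => ?_
    rw [map_sub, map_mul, map_one, hinv, hpow]
  rw [LinearMap.smul_apply, LinearMap.comp_apply, AlgHom.toLinearMap_apply,
    aeval_paddedPoint_multiShiftHom s (hs'.trans_le hk'), Algebra.linearMap_apply]
  simp only [Algebra.smul_def, Algebra.algebraMap_self, RingHom.id_apply]
  rw [hdiv, hdiv, hpow, hpow, map_natCast, hpoch, map_pow, hinv, prod_sub_inv_mul_div hT, hs',
    Fintype.card_fin, ← macdonald_summand hT hk' hn]
  field_simp

/-- The formal residue in `n` variables is the Macdonald operator. -/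
theorem algebraMap_fockToPoly_detResidue (n r : ℕ) (v : Fock) :
    algebraMap _ (RatField n) (fockToPoly n ((t⁻¹ ^ r / (r.factorial : 𝔽)) • detResidue r v)) =
      macdonaldEFin r n (fockToPoly n v) := by
  obtain ⟨Q, hQ⟩ := exists_quotient (fun i : Fin n => MvPolynomial.X (R := 𝔽) i)
    (MvPolynomial.C t⁻¹)
  have hG : (MvPolynomial.map (fockToPoly n : Fock →+* MvPolynomial (Fin n) 𝔽)
      (multiShiftHom r v)).IsSymmetric := fun σ => by
    rw [← MvPolynomial.map_rename, rename_multiShiftHom]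
  have h : algebraMap (MvPolynomial (Fin n) 𝔽) (RatField n) (fockToPoly n (detResidue r v)) = _ :=
    (congrArg _ (fockToPoly_detResidue Q hQ r v)).trans
      (residueFunctional_eq_macdonaldFunctional n r Q hQ _ hG)
  rw [map_smul, ← macdonaldFunctional_eq, ← h]
  exact map_smul (IsScalarTower.toAlgHom 𝔽 (MvPolynomial (Fin n) 𝔽) (RatField n)) _ _

/-! ### Power sums generate the symmetric polynomials freely -/

section PowerSums

/-- The kernels of the powers of the endomorphism form an ascending chain, which becomes stationary. -/
theorem injective_of_surjective_of_isNoetherianRing {R : Type*} [CommRing R]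
    [IsNoetherianRing R] (f : R →+* R) (hf : Function.Surjective f) : Function.Injective f := by
  have hmono : Monotone fun n : ℕ => RingHom.ker (f ^ n) := by
    refine monotone_nat_of_le_succ fun n x hx => ?_
    rw [RingHom.mem_ker] at *
    rw [pow_succ', RingHom.mul_def, RingHom.comp_apply, hx, map_zero]
  obtain ⟨n, hn⟩ := monotone_stabilizes_iff_noetherian.2 ‹IsNoetherianRing R›
    (⟨fun n => RingHom.ker (f ^ n), hmono⟩ : ℕ →o Ideal R)
  refine (injective_iff_map_eq_zero f).2 fun x hx => ?_
  have hs : Function.Surjective (f ^ n) := by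
    rw [RingHom.coe_pow]
    exact hf.iterate n
  obtain ⟨y, rfl⟩ := hs x
  have h1 : y ∈ RingHom.ker (f ^ (n + 1)) := by
    rw [RingHom.mem_ker, pow_succ', RingHom.mul_def, RingHom.comp_apply, hx]
  have h2 : RingHom.ker (f ^ n) = RingHom.ker (f ^ (n + 1)) := hn (n + 1) n.le_succ
  rw [← h2] at h1
  exact h1

variable {F : Type*} [Field F] [CharZero F]

/-- Newton's identities express the elementary symmetric polynomials in terms of the power sums. -/
theorem esymm_mem_of_psum_mem {N : ℕ} (S : Subalgebra F (MvPolynomial (Fin N) F))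
    (hS : ∀ k, 1 ≤ k → k ≤ N → MvPolynomial.psum (Fin N) F k ∈ S) (k : ℕ) (hk : k ≤ N) :
    MvPolynomial.esymm (Fin N) F k ∈ S := by
  induction k using Nat.strong_induction_on with
  | _ k ih =>
    rcases Nat.eq_zero_or_pos k with rfl | hk0
    · rw [MvPolynomial.esymm_zero]
      exact one_mem S
    · have h := MvPolynomial.mul_esymm_eq_sum (Fin N) F k
      have h1 : ((k : ℕ) : MvPolynomial (Fin N) F) * MvPolynomial.esymm (Fin N) F k ∈ S := by
        rw [h]
        refine mul_mem (pow_mem (neg_mem (one_mem S)) _) (sum_mem fun a ha => ?_)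
        obtain ⟨h2, h3⟩ := Finset.mem_filter.1 ha
        have h4 := Finset.HasAntidiagonal.mem_antidiagonal.1 h2
        exact mul_mem (mul_mem (pow_mem (neg_mem (one_mem S)) _) (ih _ h3 (by omega)))
          (hS _ (by omega) (by omega))
      have h2 : MvPolynomial.esymm (Fin N) F k =
          ((k : F)⁻¹) • (((k : ℕ) : MvPolynomial (Fin N) F) * MvPolynomial.esymm (Fin N) F k) := by
        have hk' : (k : F) ≠ 0 := Nat.cast_ne_zero.2 hk0.ne'
        rw [← nsmul_eq_mul, ← Nat.cast_smul_eq_nsmul F, smul_smul, inv_mul_cancel₀ hk', one_smul]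
      rw [h2]
      exact S.smul_mem h1 _

/-- In characteristic zero, the power sums generate the algebra of symmetric polynomials. -/
theorem mem_of_isSymmetric {N : ℕ} (S : Subalgebra F (MvPolynomial (Fin N) F))
    (hS : ∀ k, 1 ≤ k → k ≤ N → MvPolynomial.psum (Fin N) F k ∈ S) (f : MvPolynomial (Fin N) F)
    (hf : f.IsSymmetric) : f ∈ S := by
  obtain ⟨p, hp⟩ := (MvPolynomial.esymmAlgHom_fin_bijective F N).2 ⟨f, hf⟩
  have h1 : f = MvPolynomial.aeval (fun i : Fin N => MvPolynomial.esymm (Fin N) F (i + 1)) p := by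
    rw [← MvPolynomial.esymmAlgHom_apply, hp]
  have h2 : f ∈ (MvPolynomial.aeval (R := F)
      (fun i : Fin N => MvPolynomial.esymm (Fin N) F (i + 1))).range := ⟨p, h1.symm⟩
  rw [← Algebra.adjoin_range_eq_range_aeval] at h2
  refine Algebra.adjoin_le ?_ h2
  rintro _ ⟨i, rfl⟩
  exact esymm_mem_of_psum_mem S hS _ i.2

/-- The algebraic independence of the power sums. -/
theorem injective_aeval_psum (N : ℕ) : Function.Injective (MvPolynomial.aeval (R := F)
    (fun i : Fin N => MvPolynomial.psum (Fin N) F (i + 1))) := by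
  set P := MvPolynomial.aeval (R := F) (fun i : Fin N => MvPolynomial.psum (Fin N) F (i + 1))
  have hP : ∀ p, P p ∈ MvPolynomial.symmetricSubalgebra (Fin N) F := by
    intro p
    have h2 : P p ∈ P.range := ⟨p, rfl⟩
    rw [← Algebra.adjoin_range_eq_range_aeval] at h2
    refine Algebra.adjoin_le ?_ h2
    rintro _ ⟨i, rfl⟩
    exact MvPolynomial.psum_isSymmetric _ _ _
  let e := AlgEquiv.ofBijective _ (MvPolynomial.esymmAlgHom_fin_bijective F N)
  let f := e.symm.toAlgHom.comp (P.codRestrict _ hP)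
  have hf : Function.Surjective f := by
    refine e.symm.surjective.comp ?_
    rintro ⟨y, hy⟩
    obtain ⟨x, hx⟩ := mem_of_isSymmetric P.range (fun k h1 h2 =>
      ⟨MvPolynomial.X ⟨k - 1, by omega⟩, by simp [P, Nat.sub_add_cancel h1]⟩) y hy
    exact ⟨x, Subtype.ext hx⟩
  have hinj := injective_of_surjective_of_isNoetherianRing f.toRingHom hf
  intro x y hxy
  refine hinj ?_
  change e.symm _ = e.symm _
  congr 1
  exact Subtype.ext hxy

end PowerSums

/-! ### The identification of the Fock space with the symmetric functions -/

/-- The algebra homomorphism `a₋ₖ ↦ pₖ`. -/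
def fockToSym : Fock →ₐ[𝔽] Sym := MvPolynomial.aeval powerSum

theorem reduction_fockToSym (n : ℕ) (v : Fock) : reduction n (fockToSym v) = fockToPoly n v := by
  refine congrArg (fun f : Fock →ₐ[𝔽] MvPolynomial (Fin n) 𝔽 => f v)
    (MvPolynomial.algHom_ext (f := ((Pi.evalAlgHom 𝔽 _ n).comp symmFunc.val).comp fockToSym)
      (g := fockToPoly n) fun k => ?_)
  change reduction n (fockToSym _) = fockToPoly n _
  rw [fockToSym, fockToPoly, MvPolynomial.aeval_X, MvPolynomial.aeval_X]
  rfl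

/-- Only finitely many of the `pₖ` occur in a given vector, and these are independent in sufficiently
many variables. -/
theorem fockToSym_injective : Function.Injective fockToSym := by
  refine (injective_iff_map_eq_zero fockToSym).2 fun v hv => ?_
  obtain ⟨N, hN⟩ : ∃ N : ℕ, ∀ k ∈ v.vars, (k : ℕ) ≤ N :=
    ⟨v.vars.sup fun k => (k : ℕ), fun k hk => Finset.le_sup (f := fun k : ℕ+ => (k : ℕ)) hk⟩
  obtain ⟨p, rfl⟩ := MvPolynomial.exists_rename_eq_of_vars_subset_range v
    (fun i : Fin N => (i : ℕ).succPNat) (fun i j h => Fin.ext (Nat.succPNat_injective h)) (by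
      intro k hk
      have h1 := hN k hk
      have h2 := k.natPred_add_one
      exact ⟨⟨k.natPred, by omega⟩, by simp⟩)
  have h1 := congrArg (reduction N) hv
  rw [reduction_fockToSym, fockToPoly, MvPolynomial.aeval_rename] at h1
  have h2 : p = 0 := injective_aeval_psum (F := 𝔽) N (h1.trans (map_zero _).symm)
  rw [h2, map_zero]

theorem coeff_dropLast {n : ℕ} (f : MvPolynomial (Fin (n + 1)) 𝔽) (s : Fin (n + 1) →₀ ℕ)
    (hs : s (Fin.last n) = 0) :
    (dropLast n f).coeff (Finsupp.equivFunOnFinite.symm fun i => s i.castSucc) = f.coeff s := by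
  classical
  induction f using MvPolynomial.induction_on' with
  | monomial m c =>
    have h1 : dropLast n (MvPolynomial.monomial m c) = MvPolynomial.monomial
        (Finsupp.equivFunOnFinite.symm fun i => m i.castSucc) (c * 0 ^ m (Fin.last n)) := by
      rw [dropLast, MvPolynomial.aeval_monomial, Finsupp.prod_fintype _ _ fun _ => pow_zero _,
        Fin.prod_univ_castSucc, MvPolynomial.monomial_eq, Finsupp.prod_fintype _ _ fun _ => pow_zero _]
      simp only [Fin.snoc_castSucc, Fin.snoc_last, MvPolynomial.algebraMap_eq, map_mul, map_pow,
        map_zero, Finsupp.coe_equivFunOnFinite_symm]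
      ring
    rw [h1, MvPolynomial.coeff_monomial, MvPolynomial.coeff_monomial]
    by_cases h : m = s
    · subst h
      simp [hs]
    · rw [if_neg h]
      split_ifs with h2
      · by_cases h3 : m (Fin.last n) = 0
        · refine absurd (Finsupp.ext fun i => ?_) h
          refine Fin.lastCases (h3.trans hs.symm) (fun i => ?_) i
          exact congrFun (Finsupp.equivFunOnFinite.symm.injective h2) i
        · rw [zero_pow h3, mul_zero]
      · rfl
  | add p q hp hq => rw [map_add, MvPolynomial.coeff_add, MvPolynomial.coeff_add, hp, hq]

/-- A monomial of degree at most `n` misses one of the `n + 1` variables, and by symmetry it may be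
assumed to be the last one. -/
theorem eq_zero_of_dropLast_eq_zero {n : ℕ} (f : MvPolynomial (Fin (n + 1)) 𝔽) (hf : f.IsSymmetric)
    (hd : f.totalDegree ≤ n) (h0 : dropLast n f = 0) : f = 0 := by
  classical
  ext m
  rw [MvPolynomial.coeff_zero]
  by_cases hm : m ∈ f.support
  · have h1 : m.support.card < Fintype.card (Fin (n + 1)) := by
      have h2 := MvPolynomial.le_totalDegree hm
      have h3 : m.support.card ≤ m.sum fun _ e => e := by
        rw [Finset.card_eq_sum_ones]
        exact Finset.sum_le_sum fun i hi => Nat.one_le_iff_ne_zero.2 (Finsupp.mem_support_iff.1 hi)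
      rw [Fintype.card_fin]
      omega
    obtain ⟨i, hi⟩ : ∃ i, i ∉ m.support := by
      by_contra! h
      rw [Finset.eq_univ_iff_forall.2 h, Finset.card_univ] at h1
      exact lt_irrefl _ h1
    have h2 : f.coeff (m.mapDomain (Equiv.swap i (Fin.last n))) = f.coeff m := by
      conv_lhs => rw [← hf (Equiv.swap i (Fin.last n))]
      exact MvPolynomial.coeff_rename_mapDomain _ (Equiv.injective _) _ _
    rw [← h2, ← coeff_dropLast, h0, MvPolynomial.coeff_zero]
    have h4 := Finsupp.mapDomain_apply (Equiv.injective (Equiv.swap i (Fin.last n))) m i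
    rw [Equiv.swap_apply_left] at h4
    exact h4.trans (Finsupp.notMem_support_iff.1 hi)
  · exact MvPolynomial.notMem_support_iff.1 hm

/-- A symmetric function of degree at most `d` is determined by its reduction to `d` variables. -/
theorem sym_eq_zero (f : Sym) (d : ℕ) (hd : ∀ n, (reduction n f).totalDegree ≤ d)
    (h0 : reduction d f = 0) : f = 0 := by
  have hup : ∀ n, d ≤ n → reduction n f = 0 := by
    intro n hn
    induction n, hn using Nat.le_induction with
    | base => exact h0
    | succ n hn ih =>
      exact eq_zero_of_dropLast_eq_zero _ (f.2.1 (n + 1)) ((hd _).trans hn) ((f.2.2.1 n).trans ih)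
  have hdown : ∀ k n, reduction (n + k) f = 0 → reduction n f = 0 := by
    intro k
    induction k with
    | zero => exact fun n h => h
    | succ k ih =>
      intro n h
      refine ih n ?_
      have h1 : dropLast (n + k) (reduction (n + k + 1) f) = reduction (n + k) f := f.2.2.1 (n + k)
      rw [← h1, show reduction (n + k + 1) f = 0 from h, map_zero]
  exact Subtype.ext (funext fun n => hdown d n (hup _ (Nat.le_add_left _ _)))

theorem fockToPoly_monomial_isHomogeneous (n : ℕ) (m : ℕ+ →₀ ℕ) (c : 𝔽) :
    (fockToPoly n (MvPolynomial.monomial m c)).IsHomogeneous (m.sum fun k e => (k : ℕ) * e) := by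
  rw [fockToPoly, MvPolynomial.aeval_monomial, MvPolynomial.algebraMap_eq]
  refine MvPolynomial.IsHomogeneous.C_mul (MvPolynomial.IsHomogeneous.prod _ _ _ fun k _ => ?_) c
  refine MvPolynomial.IsHomogeneous.pow ?_ _
  refine MvPolynomial.IsHomogeneous.sum _ _ _ fun i _ => ?_
  have := (MvPolynomial.isHomogeneous_X 𝔽 i).pow (k : ℕ)
  rwa [one_mul] at this

/-- A vector of the Fock space may be truncated at weight `d` without changing its image if the latter
has degree at most `d`. -/
theorem exists_truncation (d N : ℕ) (v : Fock) (hv : (fockToPoly N v).totalDegree ≤ d) :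
    ∃ u : Fock, fockToPoly N u = fockToPoly N v ∧ ∀ n, (fockToPoly n u).totalDegree ≤ d := by
  classical
  set w : (ℕ+ →₀ ℕ) → ℕ := fun m => m.sum fun k e => (k : ℕ) * e with hw
  refine ⟨∑ m ∈ v.support with w m ≤ d, MvPolynomial.monomial m (v.coeff m), ?_, fun n => ?_⟩
  · have h1 : fockToPoly N v = ∑ i ∈ Finset.range (d + 1),
        MvPolynomial.homogeneousComponent i (fockToPoly N v) := by
      conv_lhs => rw [← MvPolynomial.sum_homogeneousComponent (fockToPoly N v)]
      refine Finset.sum_subset (Finset.range_subset_range.2 (by omega)) fun i _ hi => ?_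
      refine MvPolynomial.homogeneousComponent_eq_zero _ _ ?_
      simpa using hi
    rw [h1]
    conv_rhs => rw [v.as_sum]
    simp only [map_sum]
    rw [Finset.sum_comm, Finset.sum_filter]
    refine Finset.sum_congr rfl fun m _ => ?_
    have h2 : ∀ i, MvPolynomial.homogeneousComponent i
        (fockToPoly N (MvPolynomial.monomial m (v.coeff m))) =
        if i = w m then fockToPoly N (MvPolynomial.monomial m (v.coeff m)) else 0 := fun i =>
      MvPolynomial.homogeneousComponent_of_mem (fockToPoly_monomial_isHomogeneous N m _)
    simp only [h2, Finset.sum_ite_eq', Finset.mem_range, Nat.lt_succ_iff]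
  · rw [map_sum]
    refine MvPolynomial.totalDegree_finsetSum_le fun m hm => ?_
    exact (fockToPoly_monomial_isHomogeneous n m _).totalDegree_le.trans (Finset.mem_filter.1 hm).2

theorem fockToSym_surjective : Function.Surjective fockToSym := by
  intro f
  obtain ⟨d, hd⟩ := f.2.2.2
  obtain ⟨v, hv⟩ := mem_of_isSymmetric (F := 𝔽) (fockToPoly d).range (fun k hk _ =>
    ⟨MvPolynomial.X ⟨k, hk⟩, MvPolynomial.aeval_X _ _⟩) (reduction d f) (f.2.1 d)
  have hv' : fockToPoly d v = reduction d f := hv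
  obtain ⟨u, hu, hu'⟩ := exists_truncation d d v (by rw [hv']; exact hd d)
  refine ⟨u, sub_eq_zero.1 (sym_eq_zero _ d (fun n => ?_) ?_)⟩
  · change (reduction n (fockToSym u) - reduction n f).totalDegree ≤ d
    rw [reduction_fockToSym]
    exact (MvPolynomial.totalDegree_sub _ _).trans (max_le (hu' n) (hd n))
  · change reduction d (fockToSym u) - reduction d f = 0
    rw [reduction_fockToSym, hu, hv', sub_self]

theorem ket_eq_prod (l : List ℕ+) : ket l = (l.map MvPolynomial.X).prod := by
  induction l with
  | nil => simp [ket, vacuum]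
  | cons n l ih =>
    have h : ket (n :: l) = heis (-((n : ℕ) : ℤ)) (ket l) := by
      simp [ket]
    rw [h, heis_neg_natCast, ih, List.map_cons, List.prod_cons]

theorem fockToSym_ket (l : List ℕ+) : fockToSym (ket l) = powerSumProd l := by
  rw [ket_eq_prod, map_list_prod, List.map_map, powerSumProd]
  congr 2
  funext k
  exact MvPolynomial.aeval_X _ _

/-- The identification of the Fock space with the symmetric functions. -/
def fockIso : Fock ≃ₗ[𝔽] Sym :=
  LinearEquiv.ofBijective fockToSym.toLinearMap ⟨fockToSym_injective, fockToSym_surjective⟩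

theorem fockIso_apply (v : Fock) : fockIso v = fockToSym v := rfl

theorem isFockIso_fockIso : IsFockIso fockIso := fun l _ => fockToSym_ket l

theorem IsFockIso.eq_fockIso {iota : Fock ≃ₗ[𝔽] Sym} (h : IsFockIso iota) : iota = fockIso := by
  have h1 : (iota : Fock →ₗ[𝔽] Sym) = (fockIso : Fock →ₗ[𝔽] Sym) := by
    refine (MvPolynomial.basisMonomials ℕ+ 𝔽).ext fun m => ?_
    rw [MvPolynomial.coe_basisMonomials]
    change iota (MvPolynomial.monomial m 1) = fockIso (MvPolynomial.monomial m 1)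
    have h2 : MvPolynomial.monomial m (1 : 𝔽) = ket (m.toMultiset.sort (· ≥ ·)) := by
      rw [ket_eq_prod, ← Multiset.prod_coe, ← Multiset.map_coe, Multiset.sort_eq,
        Finsupp.toMultiset_map, Finsupp.prod_toMultiset, MvPolynomial.monomial_eq, map_one, one_mul,
        Finsupp.prod_mapDomain_index (by simp) (by simp [pow_add])]
    rw [h2]
    exact (h _ (Multiset.pairwise_sort _ _)).trans (isFockIso_fockIso _ (Multiset.pairwise_sort _ _)).symm
  exact LinearEquiv.toLinearMap_injective h1

/-! ### The Macdonald operators -/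

theorem macdonaldD_add (n k : ℕ) (f g : MvPolynomial (Fin n) 𝔽) :
    macdonaldD n k (f + g) = macdonaldD n k f + macdonaldD n k g := by
  simp only [macdonaldD, map_add, mul_add, Finset.sum_add_distrib, smul_add]

theorem macdonaldD_smul (n k : ℕ) (c : 𝔽) (f : MvPolynomial (Fin n) 𝔽) :
    macdonaldD n k (c • f) = c • macdonaldD n k f := by
  have h : ∀ g : MvPolynomial (Fin n) 𝔽, algebraMap _ (RatField n) (c • g) =
      c • algebraMap _ (RatField n) g := fun g =>
    map_smul (IsScalarTower.toAlgHom 𝔽 (MvPolynomial (Fin n) 𝔽) (RatField n)) c g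
  simp only [macdonaldD, map_smul, h, mul_smul_comm, ← Finset.smul_sum]
  rw [smul_comm]

theorem macdonaldEFin_add (r n : ℕ) (f g : MvPolynomial (Fin n) 𝔽) :
    macdonaldEFin r n (f + g) = macdonaldEFin r n f + macdonaldEFin r n g := by
  simp only [macdonaldEFin, macdonaldD_add, smul_add, Finset.sum_add_distrib]

theorem macdonaldEFin_smul (r n : ℕ) (c : 𝔽) (f : MvPolynomial (Fin n) 𝔽) :
    macdonaldEFin r n (c • f) = c • macdonaldEFin r n f := by
  simp only [macdonaldEFin, macdonaldD_smul, Finset.smul_sum]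
  refine Finset.sum_congr rfl fun k _ => ?_
  rw [smul_comm]

/-- A vector of the Fock space is determined by its images in all finite numbers of variables. -/
theorem fock_ext {u v : Fock} (h : ∀ n, algebraMap _ (RatField n) (fockToPoly n u) =
    algebraMap _ (RatField n) (fockToPoly n v)) : u = v := by
  refine fockToSym_injective (Subtype.ext (funext fun n => ?_))
  have h1 := IsFractionRing.injective (MvPolynomial (Fin n) 𝔽) (RatField n) (h n)
  rw [← reduction_fockToSym, ← reduction_fockToSym] at h1
  exact h1

/-- The normalized formal residue, as an operator on the Fock space. Linearity follows from that of the
Macdonald operators in `n` variables. -/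
def residueOperator (r : ℕ) : Module.End 𝔽 Fock where
  toFun v := (t⁻¹ ^ r / (r.factorial : 𝔽)) • detResidue r v
  map_add' u v := fock_ext fun n => by
    rw [map_add, map_add, algebraMap_fockToPoly_detResidue, algebraMap_fockToPoly_detResidue,
      algebraMap_fockToPoly_detResidue, map_add, macdonaldEFin_add]
  map_smul' c v := fock_ext fun n => by
    have h : algebraMap _ (RatField n)
        (c • fockToPoly n ((t⁻¹ ^ r / (r.factorial : 𝔽)) • detResidue r v)) =
        c • algebraMap _ (RatField n)
          (fockToPoly n ((t⁻¹ ^ r / (r.factorial : 𝔽)) • detResidue r v)) :=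
      map_smul (IsScalarTower.toAlgHom 𝔽 (MvPolynomial (Fin n) 𝔽) (RatField n)) c _
    rw [algebraMap_fockToPoly_detResidue, map_smul, macdonaldEFin_smul,
      ← algebraMap_fockToPoly_detResidue, RingHom.id_apply, ← h, map_smul (fockToPoly n) c]

/-- The formal residue, transported to the symmetric functions. -/
def symOperator (r : ℕ) : Module.End 𝔽 Sym :=
  fockIso.toLinearMap ∘ₗ residueOperator r ∘ₗ fockIso.symm.toLinearMap

theorem isMacdonaldOperator_symOperator (r : ℕ) : IsMacdonaldOperator r (symOperator r) := by
  intro n _ f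
  obtain ⟨v, rfl⟩ := fockIso.surjective f
  have h : symOperator r (fockIso v) = fockToSym (residueOperator r v) :=
    congrArg (fun u => fockToSym (residueOperator r u)) (fockIso.symm_apply_apply v)
  rw [h, fockIso_apply, reduction_fockToSym, reduction_fockToSym]
  exact algebraMap_fockToPoly_detResidue n r v

theorem IsMacdonaldOperator.unique {r : ℕ} {E E' : Module.End 𝔽 Sym} (h : IsMacdonaldOperator r E)
    (h' : IsMacdonaldOperator r E') : E = E' := by
  refine LinearMap.ext fun f => sub_eq_zero.1 ?_
  obtain ⟨d, hd⟩ := (E f - E' f).2.2.2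
  refine sym_eq_zero _ (max d r) (fun n => (hd n).trans (le_max_left _ _)) ?_
  have h1 := IsFractionRing.injective (MvPolynomial (Fin (max d r)) 𝔽) (RatField (max d r))
    ((h _ (le_max_right d r) f).trans (h' _ (le_max_right d r) f).symm)
  exact sub_eq_zero.2 h1

end MacdonaldFock

end

theorem theorem1p2 (r : ℕ) (hr : 1 ≤ r) :
    -- the isomorphism between the Fock space and the symmetric functions, and the operator
    (∃! iota : MacdonaldFock.Fock ≃ₗ[MacdonaldFock.𝔽] MacdonaldFock.Sym,
      MacdonaldFock.IsFockIso iota) ∧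
    (∃! E : Module.End MacdonaldFock.𝔽 MacdonaldFock.Sym,
      MacdonaldFock.IsMacdonaldOperator r E) ∧
    -- all sums in the formal residue make sense
    (∀ (e : Fin r → ℤ) (v : MacdonaldFock.Fock),
      (Function.support (MacdonaldFock.normalTerm e v)).Finite) ∧
    (∀ (σ : Equiv.Perm (Fin r)) (e : Fin r → ℤ),
      MacdonaldFock.TInvSummable (MacdonaldFock.permTerm σ e)) ∧
    (∀ v : MacdonaldFock.Fock,
      (Function.support (MacdonaldFock.residueTerm (r := r) v)).Finite) ∧
    -- the formula
    (∀ iota : MacdonaldFock.Fock ≃ₗ[MacdonaldFock.𝔽] MacdonaldFock.Sym,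
      MacdonaldFock.IsFockIso iota →
      ∀ E : Module.End MacdonaldFock.𝔽 MacdonaldFock.Sym,
        MacdonaldFock.IsMacdonaldOperator r E →
        ∀ v : MacdonaldFock.Fock,
          MacdonaldFock.freeField iota E v =
            ((MacdonaldFock.t⁻¹) ^ r / (r.factorial : MacdonaldFock.𝔽)) •
              MacdonaldFock.detResidue r v) := by
  refine ⟨⟨MacdonaldFock.fockIso, MacdonaldFock.isFockIso_fockIso, fun iota h => h.eq_fockIso⟩,
    ⟨MacdonaldFock.symOperator r, MacdonaldFock.isMacdonaldOperator_symOperator r,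
      fun E h => h.unique (MacdonaldFock.isMacdonaldOperator_symOperator r)⟩,
    MacdonaldFock.normalTerm_support_finite, MacdonaldFock.tInvSummable_permTerm,
    MacdonaldFock.residueTerm_support_finite, ?_⟩
  intro iota hiota E hE v
  rw [hiota.eq_fockIso, hE.unique (MacdonaldFock.isMacdonaldOperator_symOperator r)]
  simp only [MacdonaldFock.freeField, MacdonaldFock.symOperator, LinearMap.comp_apply,
    LinearEquiv.coe_coe, LinearEquiv.symm_apply_apply]
  rfl
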